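/- **Theorem 4 (Overfitted networks generalize poorly).** *Setting.* Let $\sigma>0$, let $f_\star:[0,1]\to\mathbb R$ be continuous, let $n\ge 2$, $x_i=\frac{i-1}{n-1}$, and $y_i=f_\star(x_i)+\varepsilon_i$ with $\varepsilon_1,\dots,\varepsilon_n$ i.i.d. $\mathcal N(0,\sigma^2)$. Let $f_{\mathtt{LI}}$ be the linear interpolant of the data, $f_{\mathtt{LI}}(x)=y_i+\frac{y_{i+1}-y_i}{x_{i+1}-x_i}(x-x_i)$ for $x\in[x_i,x_{i+1}]$. Consider the two-layer ReLU network of width $2m$, $$f^m_{\theta}(x)=\sqrt{\tfrac{2}{2m}}\sum_{r=1}^{2m}a_r\max\{w_rx+b_r,0\}+b,\qquad \theta=(a_r,w_r,b_r,b)_{r\le 2m},$$ with the mirrored random initialization $a_r(0)=-a_{r+m}(0)$, $w_r(0)=w_{r+m}(0)$, $b_r(0)=b_{r+m}(0)$ for $r\le m$, where $a_r(0),w_r(0),b_r(0)$, $r\le m$, are i.i.d. $\mathcal N(0,1)$ and independent of the noise, and $b(0)=0$. All parameters are trained by the gradient flow $\dot\theta(t)=-\nabla_\theta\frac1{2n}\sum_{i=1}^n(y_i-f^m_{\theta(t)}(x_i))^2$,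 $t\ge0$ (at points where ReLU is not differentiable its derivative may be any number in $[0,1]$; trajectories are locally absolutely continuous and solve the equation for almost every $t$). Let $\mathcal E(g)=\int_0^1(g(x)-f_\star(x))^2\,dx$ be the excess risk. *Claim.* There are absolute constants $C_1,C_2,C_5>0$, a constant $C_4>0$ depending only on $\sigma$, and a constant $C_3>0$ depending only on $\sigma$ and an upper bound for $\sup_{[0,1]}|f_\star|$, such that for every $n\ge2$ and every sufficiently large $m$ (how large may depend on $n$, $\sigma$, $f_\star$) the following holds for every $t>C_1n^2\log n$. (i) With probability at least $1-\frac{C_2}{n}$ over the noise and the initialization, every gradient flow trajectory satisfies $$\sup_{x\in[0,1]}|f^m_{\theta(t)}(x)-f_{\mathtt{LI}}(x)|\le C_3\frac{\sqrt{\log n}}{(n-1)^2}.$$ (ii) With probability at least $1-\frac{C_5}{n}$ over the noise and the initialization, every gradient flow trajectory satisfies $\mathcal E(f^m_{\theta(t)})\ge C_4$. -/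

import Mathlib

open Set MeasureTheory ProbabilityTheory
open scoped ENNReal NNReal

noncomputable section

namespace WideNet

/-! ### The data -/

/-- The equally spaced design on `[0, 1]`, indexed from `0`: `i / (n - 1)` for `i = 0, …, n - 1`. -/
def gridPoint (n i : ℕ) : ℝ := (i : ℝ) / ((n : ℝ) - 1)

/-- The responses `y_i = f⋆(x_i) + ε_i`. -/
def response {n : ℕ} (fstar : ℝ → ℝ) (ε : Fin n → ℝ) (i : Fin n) : ℝ :=
  fstar (gridPoint n i) + ε i

/-- The piecewise linear interpolant of the points `(x_i, y_i)`. For `n ≥ 2` the number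
`min ⌊x (n - 1)⌋ (n - 2)` is the index `i` of a grid interval `[x_i, x_{i+1}]` which contains
`x ∈ [0, 1]`; see `linearInterp_eq`. -/
def linearInterp {n : ℕ} (y : Fin n → ℝ) (x : ℝ) : ℝ :=
  let Y : ℕ → ℝ := fun i => if h : i < n then y ⟨i, h⟩ else 0
  let i : ℕ := min ⌊x * ((n : ℝ) - 1)⌋₊ (n - 2)
  Y i + (Y (i + 1) - Y i) / (gridPoint n (i + 1) - gridPoint n i) * (x - gridPoint n i)

/-- On each `[x_i, x_{i+1}]` the interpolant is given by the expected formula. -/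
theorem linearInterp_eq {n : ℕ} (y : Fin n → ℝ) (i : ℕ) (hi : i + 1 < n) (x : ℝ)
    (hx : x ∈ Icc (gridPoint n i) (gridPoint n (i + 1))) :
    linearInterp y x = y ⟨i, by omega⟩ + (y ⟨i + 1, hi⟩ - y ⟨i, by omega⟩) /
      (gridPoint n (i + 1) - gridPoint n i) * (x - gridPoint n i) := by
  have hn : (0 : ℝ) < (n : ℝ) - 1 := by
    have h2 : ((2 : ℕ) : ℝ) ≤ n := by exact_mod_cast (by omega : 2 ≤ n)
    push_cast at h2
    linarith
  obtain ⟨h1, h2⟩ := hx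
  have hstep : gridPoint n (i + 1) - gridPoint n i ≠ 0 := by
    have : gridPoint n (i + 1) - gridPoint n i = 1 / ((n : ℝ) - 1) := by
      simp only [gridPoint]; push_cast; ring
    rw [this]; positivity
  have h1' : (i : ℝ) ≤ x * ((n : ℝ) - 1) := by
    simpa [gridPoint, div_le_iff₀ hn] using h1
  rcases lt_or_eq_of_le h2 with h2 | h2
  · have h2' : x * ((n : ℝ) - 1) < (i : ℝ) + 1 := by
      simpa [gridPoint, lt_div_iff₀ hn] using h2
    have hfl : ⌊x * ((n : ℝ) - 1)⌋₊ = i := by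
      rw [Nat.floor_eq_iff (le_trans (Nat.cast_nonneg i) h1')]
      exact ⟨h1', h2'⟩
    have hmin : min ⌊x * ((n : ℝ) - 1)⌋₊ (n - 2) = i := by rw [hfl]; omega
    simp only [linearInterp, hmin, dif_pos hi, dif_pos (show i < n by omega)]
  · have hfl : ⌊x * ((n : ℝ) - 1)⌋₊ = i + 1 := by
      have hx1 : x * ((n : ℝ) - 1) = ((i + 1 : ℕ) : ℝ) := by
        rw [h2, gridPoint]; field_simp
      rw [hx1, Nat.floor_natCast]
    have hr : y ⟨i, by omega⟩ + (y ⟨i + 1, hi⟩ - y ⟨i, by omega⟩) /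
        (gridPoint n (i + 1) - gridPoint n i) * (x - gridPoint n i) = y ⟨i + 1, hi⟩ := by
      have hx2 : x - gridPoint n i = gridPoint n (i + 1) - gridPoint n i := by rw [h2]
      rw [hx2, div_mul_cancel₀ _ hstep]; ring
    have h0 : x - gridPoint n (i + 1) = 0 := by rw [h2, sub_self]
    rw [hr]
    rcases lt_or_ge (i + 1) (n - 1) with h3 | h3
    · have hmin : min ⌊x * ((n : ℝ) - 1)⌋₊ (n - 2) = i + 1 := by rw [hfl]; omega
      simp only [linearInterp, hmin, dif_pos hi, h0, mul_zero, add_zero]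
    · have hmin : min ⌊x * ((n : ℝ) - 1)⌋₊ (n - 2) = i := by rw [hfl]; omega
      simp only [linearInterp, hmin, dif_pos hi, dif_pos (show i < n by omega)]
      exact hr

/-- The excess risk of `g` with respect to Lebesgue measure on `[0, 1]`. -/
def excessRisk (fstar g : ℝ → ℝ) : ℝ := ∫ x in (0 : ℝ)..1, (g x - fstar x) ^ 2

/-! ### The network -/

/-- The hidden neurons of a network of width `2 m`; neuron `inr r` is the mirror image of neuron
`inl r` at initialization. -/
abbrev Neuron (m : ℕ) : Type := Fin m ⊕ Fin m

/-- The parameters of a two-layer network of width `2 m` with one-dimensional input: the outer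
weights `a`, the inner weights `w`, the inner biases `b` and the outer bias `c`. -/
structure Params (m : ℕ) where
  a : Neuron m → ℝ
  w : Neuron m → ℝ
  b : Neuron m → ℝ
  c : ℝ

/-- The pre-activation of a neuron at the input `x`. -/
def preact {m : ℕ} (θ : Params m) (r : Neuron m) (x : ℝ) : ℝ := θ.w r * x + θ.b r

/-- The two-layer ReLU network of width `2 m`. -/
def net {m : ℕ} (θ : Params m) (x : ℝ) : ℝ :=
  √(2 / (2 * (m : ℝ))) * ∑ r, θ.a r * max (preact θ r x) 0 + θ.c

/-- The subdifferential of the ReLU function `z ↦ max z 0`. -/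
def reluSubdiff (z : ℝ) : Set ℝ :=
  {s | 0 ≤ s ∧ s ≤ 1 ∧ (0 < z → s = 1) ∧ (z < 0 → s = 0)}

/-- The (sub)gradient of the network output at `x` with respect to the parameters, for a choice
`s r` of the slope of the activation of each neuron `r` at `x`. -/
def netGrad {m : ℕ} (θ : Params m) (x : ℝ) (s : Neuron m → ℝ) : Params m where
  a r := √(2 / (2 * (m : ℝ))) * max (preact θ r x) 0
  w r := √(2 / (2 * (m : ℝ))) * (θ.a r * s r * x)
  b r := √(2 / (2 * (m : ℝ))) * (θ.a r * s r)
  c := 1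

/-- The (sub)gradient of the empirical loss `(1 / (2 n)) ∑ i, (y i - net θ (x i)) ^ 2` with respect
to the parameters, for a choice `s i r` of the slopes. If no pre-activation vanishes at a data
point and `s i r ∈ reluSubdiff (preact θ r (x i))`, this is the gradient. -/
def lossGrad {m n : ℕ} (y : Fin n → ℝ) (θ : Params m) (s : Fin n → Neuron m → ℝ) : Params m where
  a r := (1 / (n : ℝ)) * ∑ i : Fin n,
    (netGrad θ (gridPoint n i) (s i)).a r * (net θ (gridPoint n i) - y i)
  w r := (1 / (n : ℝ)) * ∑ i : Fin n,
    (netGrad θ (gridPoint n i) (s i)).w r * (net θ (gridPoint n i) - y i)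
  b r := (1 / (n : ℝ)) * ∑ i : Fin n,
    (netGrad θ (gridPoint n i) (s i)).b r * (net θ (gridPoint n i) - y i)
  c := (1 / (n : ℝ)) * ∑ i : Fin n,
    (netGrad θ (gridPoint n i) (s i)).c * (net θ (gridPoint n i) - y i)

/-- `θ` is a trajectory on `[0, ∞)` of the gradient flow of the empirical loss, started at `θ₀`.
As ReLU is not differentiable at `0`, this is understood as usual: `θ` is locally absolutely
continuous, and at almost every time its velocity is minus a subgradient of the loss. This
covers every choice of the derivative of ReLU at `0` in `[0, 1]`, and limits of such choices. -/
structure IsGradientFlow {m n : ℕ} (y : Fin n → ℝ) (θ₀ : Params m) (θ : ℝ → Params m) :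
    Prop where
  init : θ 0 = θ₀
  ac_a : ∀ r, ∀ T : ℝ, 0 ≤ T → AbsolutelyContinuousOnInterval (fun t => (θ t).a r) 0 T
  ac_w : ∀ r, ∀ T : ℝ, 0 ≤ T → AbsolutelyContinuousOnInterval (fun t => (θ t).w r) 0 T
  ac_b : ∀ r, ∀ T : ℝ, 0 ≤ T → AbsolutelyContinuousOnInterval (fun t => (θ t).b r) 0 T
  ac_c : ∀ T : ℝ, 0 ≤ T → AbsolutelyContinuousOnInterval (fun t => (θ t).c) 0 T
  flow : ∀ᵐ t ∂(volume.restrict (Ioi (0 : ℝ))), ∃ s : Fin n → Neuron m → ℝ,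
    (∀ (i : Fin n) (r : Neuron m), s i r ∈ reluSubdiff (preact (θ t) r (gridPoint n i))) ∧
    (∀ r, HasDerivAt (fun u => (θ u).a r) (-(lossGrad y (θ t) s).a r) t) ∧
    (∀ r, HasDerivAt (fun u => (θ u).w r) (-(lossGrad y (θ t) s).w r) t) ∧
    (∀ r, HasDerivAt (fun u => (θ u).b r) (-(lossGrad y (θ t) s).b r) t) ∧
    HasDerivAt (fun u => (θ u).c) (-(lossGrad y (θ t) s).c) t

/-! ### The randomness -/

/-- The mirrored initialization built from `3 m` numbers: neuron `r` and its mirror image have the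
same inner weight and bias and opposite outer weights, and the outer bias is `0`. -/
def initParams {m : ℕ} (ξ : Fin m × Fin 3 → ℝ) : Params m where
  a := Sum.elim (fun r => ξ (r, 0)) (fun r => -ξ (r, 0))
  w := Sum.elim (fun r => ξ (r, 1)) (fun r => ξ (r, 1))
  b := Sum.elim (fun r => ξ (r, 2)) (fun r => ξ (r, 2))
  c := 0

/-- The joint law of the noise `ε_i ∼ N(0, σ²)`, `i = 1, …, n`, and of the `3 m` standard Gaussian
numbers that define the initialization, all independent. -/
def jointLaw (σ : ℝ) (n m : ℕ) : Measure ((Fin n → ℝ) × (Fin m × Fin 3 → ℝ)) :=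
  (Measure.pi fun _ => gaussianReal 0 (Real.toNNReal (σ ^ 2))).prod
    (Measure.pi fun _ => gaussianReal 0 1)

/-- The event `E` holds with probability at least `p`: its complement has (outer) measure at most
`1 - p`, so that `E` contains a measurable event of probability at least `p`. -/
def HoldsWithProbAtLeast {Ω : Type*} [MeasurableSpace Ω] (P : Measure Ω) (p : ℝ)
    (E : Ω → Prop) : Prop :=
  P {ω | ¬ E ω} ≤ ENNReal.ofReal (1 - p)

end WideNet

end

noncomputable section

namespace WideNet

/-! ### The limiting tangent kernel -/

/-! At infinite width the residuals solve the linear system r' = -(1/n) K r, where K is the matrix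
of `ntk` on the grid, and the trained network lies in the span of the functions K(·, x_j). The proof
combines an analytic fact about this span, a comparison of finite with infinite width, and a count
of large noise variables.

Analysis. Any g = Σ α_j K(·, x_j) is nearly the linear interpolant of its grid values. Between grid
points, (1 + x²)² g'' equals Q = (4/π) Σ α_j |x - x_j|. The kinks of the absolute value and of the
arctangent term cancel in `smoothPart`, so R = g + Q/4 is twice differentiable on the whole line and
solves R'' = 4 (R - g) / (1 + x²)². An energy inequality for this equation, together with the
boundary values of R, controls Σ α_j and Σ α_j x_j by sup |g|; Grönwall's inequality then bounds R,
hence Q (`abs_curvature_le`). The chord estimate gives an error of order sup |g| / (n - 1)², and for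
large n sup |g| is itself controlled by the grid values (`exists_abs_ntkSpan_sub_linearInterp_le`).

Width. The smallest eigenvalue of K is at least 1/(26 n) (`le_quadraticForm_ntk`), so residuals
decay at a rate of order 1/n²; this is why times of order n² log n suffice. While the kernel is
close to its limit the loss decays exponentially, hence each neuron of a wide network moves little,
hence the kernel stays close (`IsGradientFlow.sqLoss_le_exp`). Closeness near a random
initialization follows from the law of large numbers on a finite net of inputs and from the rarity
of neurons with a kink near a given input (`exists_tendsto_initLaw_not_kernelStable`). The outcome
is `FollowsLimit`, an event about the initialization alone, uniform in the responses and in time.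
Claim (i) follows from this and the analytic fact.

Risk. By linearity of the limiting dynamics, the error of the network is D + (linear interpolant of
the noise) up to σ/64, with D independent of the noise (`FollowsLimit.abs_error_sub_le`). Nothing is
assumed about the size of D. On each cell, testing against an affine function dual to the left
endpoint value leaves d_k + ε_k, with d_k deterministic. Whatever the d_k are, with high probability
fewer than half of these numbers are small, and each remaining cell contributes order σ²/n to the
risk. -/

/-- The tangent kernel of the network in the limit of infinite width. -/
def ntk (x z : ℝ) : ℝ :=
  1 / Real.pi * (|x - z| + 2 * (Real.pi - |Real.arctan x - Real.arctan z|) * (1 + x * z)) + 1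

/-- The smooth part of the tangent kernel. -/
def smoothPart (z x : ℝ) : ℝ :=
  |x - z| + (Real.pi - |Real.arctan x - Real.arctan z|) * (1 + x * z)

/-- The derivative of `smoothPart z`. -/
def smoothPartDeriv (z x : ℝ) : ℝ :=
  x * |x - z| / (1 + x ^ 2) + (Real.pi - |Real.arctan x - Real.arctan z|) * z

theorem abs_arctan_sub_of_le {x z : ℝ} (h : z ≤ x) :
    |Real.arctan x - Real.arctan z| = Real.arctan x - Real.arctan z :=
  abs_of_nonneg (sub_nonneg.2 (Real.arctan_mono h))

theorem abs_arctan_sub_of_ge {x z : ℝ} (h : x ≤ z) :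
    |Real.arctan x - Real.arctan z| = -(Real.arctan x - Real.arctan z) :=
  abs_of_nonpos (sub_nonpos.2 (Real.arctan_mono h))

/-- On either side of z the absolute values are linear with a sign s. The parameter c covers both
`smoothPart` (c = 1) and the kernel itself (c = 2). -/
theorem hasDerivAt_branch (s c z x : ℝ) :
    HasDerivAt (fun u => s * (u - z) + c * (Real.pi - s * (Real.arctan u - Real.arctan z)) *
        (1 + u * z))
      (s + (c * (-(s * (1 / (1 + x ^ 2)))) * (1 + x * z) +
        c * (Real.pi - s * (Real.arctan x - Real.arctan z)) * z)) x := by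
  have h1 := (((hasDerivAt_id x).sub_const z).const_mul s)
  have h2 := (((((Real.hasDerivAt_arctan x).sub_const (Real.arctan z)).const_mul s).const_sub
    Real.pi).const_mul c)
  have h3 := ((hasDerivAt_id x).mul_const z).const_add 1
  refine (h1.add (h2.mul h3)).congr_deriv ?_
  simp

theorem hasDerivAt_branch_deriv (s c z x : ℝ) :
    HasDerivAt (fun x => s + (c * (-(s * (1 / (1 + x ^ 2)))) * (1 + x * z) +
        c * (Real.pi - s * (Real.arctan x - Real.arctan z)) * z))
      (2 * c * s * (x - z) / (1 + x ^ 2) ^ 2) x := by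
  have hp : (1 + x ^ 2) ≠ 0 := by positivity
  have h0 : HasDerivAt (fun u : ℝ => 1 / (1 + u ^ 2)) (-(2 * x) / (1 + x ^ 2) ^ 2) x := by
    have := ((hasDerivAt_pow 2 x).const_add 1).fun_inv hp
    simpa using this
  have h1 := ((h0.const_mul s).fun_neg.const_mul c).fun_mul (((hasDerivAt_id x).mul_const z).const_add 1)
  have h2 := (((((Real.hasDerivAt_arctan x).sub_const (Real.arctan z)).const_mul s).const_sub
    Real.pi).const_mul c).mul_const z
  refine ((h1.fun_add h2).const_add s).congr_deriv ?_
  simp only [id]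
  field_simp
  ring

theorem continuous_smoothPart (z : ℝ) : Continuous (smoothPart z) := by
  have := Real.continuous_arctan
  unfold smoothPart; fun_prop

theorem continuous_smoothPartDeriv (z : ℝ) : Continuous (smoothPartDeriv z) := by
  have := Real.continuous_arctan
  have h : ∀ x : ℝ, 1 + x ^ 2 ≠ 0 := fun x => by positivity
  unfold smoothPartDeriv; fun_prop (disch := exact h _)

/-- At x = z the slope jump of |x - z| is cancelled by that of the arctangent term, since 1 - (1 +
xz)/(1 + x²) vanishes there. The derivative off z therefore extends continuously, and a continuous
function is differentiable where its derivative extends continuously. The same argument gives the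
second derivative. -/
theorem hasDerivAt_smoothPart (z x : ℝ) : HasDerivAt (smoothPart z) (smoothPartDeriv z x) x := by
  have hp : ∀ y : ℝ, 1 + y ^ 2 ≠ 0 := fun y => by positivity
  refine hasDerivAt_of_hasDerivAt_of_ne' (x := z) (g := smoothPartDeriv z) (fun y hy => ?_)
    (continuous_smoothPart z).continuousAt (continuous_smoothPartDeriv z).continuousAt x
  rcases lt_or_gt_of_ne hy with h | h
  · refine ((hasDerivAt_branch (-1) 1 z y).congr_of_eventuallyEq ?_).congr_deriv ?_
    · filter_upwards [Iio_mem_nhds h] with u hu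
      rw [smoothPart, abs_arctan_sub_of_ge (le_of_lt hu), abs_of_neg (sub_neg.2 hu)]; ring
    · rw [smoothPartDeriv, abs_arctan_sub_of_ge h.le, abs_of_neg (sub_neg.2 h)]
      have := hp y
      field_simp; ring
  · refine ((hasDerivAt_branch 1 1 z y).congr_of_eventuallyEq ?_).congr_deriv ?_
    · filter_upwards [Ioi_mem_nhds h] with u hu
      rw [smoothPart, abs_arctan_sub_of_le (le_of_lt hu), abs_of_pos (sub_pos.2 hu)]; ring
    · rw [smoothPartDeriv, abs_arctan_sub_of_le h.le, abs_of_pos (sub_pos.2 h)]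
      have := hp y
      field_simp; ring

theorem hasDerivAt_smoothPartDeriv (z x : ℝ) :
    HasDerivAt (smoothPartDeriv z) (2 * |x - z| / (1 + x ^ 2) ^ 2) x := by
  have hp : ∀ y : ℝ, 1 + y ^ 2 ≠ 0 := fun y => by positivity
  refine hasDerivAt_of_hasDerivAt_of_ne' (x := z) (g := fun x => 2 * |x - z| / (1 + x ^ 2) ^ 2)
    (fun y hy => ?_)
    (continuous_smoothPartDeriv z).continuousAt ?_ x
  · rcases lt_or_gt_of_ne hy with h | h
    · refine ((hasDerivAt_branch_deriv (-1) 1 z y).congr_of_eventuallyEq ?_).congr_deriv ?_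
      · filter_upwards [Iio_mem_nhds h] with u hu
        rw [smoothPartDeriv, abs_arctan_sub_of_ge (le_of_lt hu), abs_of_neg (sub_neg.2 hu)]
        have := hp u
        field_simp; ring
      · rw [abs_of_neg (sub_neg.2 h)]; ring
    · refine ((hasDerivAt_branch_deriv 1 1 z y).congr_of_eventuallyEq ?_).congr_deriv ?_
      · filter_upwards [Ioi_mem_nhds h] with u hu
        rw [smoothPartDeriv, abs_arctan_sub_of_le (le_of_lt hu), abs_of_pos (sub_pos.2 hu)]
        have := hp u
        field_simp; ring
      · rw [abs_of_pos (sub_pos.2 h)]; ring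
  · have h : ∀ x : ℝ, (1 + x ^ 2) ^ 2 ≠ 0 := fun x => by positivity
    have : Continuous (fun x => 2 * |x - z| / (1 + x ^ 2) ^ 2) := by
      fun_prop (disch := exact h _)
    exact this.continuousAt

/-- A function whose second derivative is bounded by `M` is within `M h² / 8` of its chord on an
interval of length `h`. -/
theorem abs_sub_chord_le {f f' f'' : ℝ → ℝ} {l r M : ℝ} (hlr : l < r)
    (hf : ∀ x, HasDerivAt f (f' x) x) (hf' : ∀ x, HasDerivAt f' (f'' x) x)
    (hM : ∀ x ∈ Icc l r, |f'' x| ≤ M) {x : ℝ} (hx : x ∈ Icc l r) :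
    |f x - (f l + (f r - f l) / (r - l) * (x - l))| ≤ M * (r - l) ^ 2 / 8 := by
  have hM0 : 0 ≤ M := (abs_nonneg _).trans (hM l ⟨le_rfl, hlr.le⟩)
  have key : ∀ (f f' f'' : ℝ → ℝ), (∀ x, HasDerivAt f (f' x) x) →
      (∀ x, HasDerivAt f' (f'' x) x) → (∀ x ∈ Icc l r, -M ≤ f'' x) →
      f x - (f l + (f r - f l) / (r - l) * (x - l)) ≤ M * (r - l) ^ 2 / 8 := by
    intro f f' f'' hf hf' hM
    have hd1 : ∀ x, HasDerivAt (fun u => f u + M / 2 * ((u - l) * (u - r)))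
        (f' x + M / 2 * ((x - r) + (x - l))) x := fun x =>
      ((hf x).add ((((hasDerivAt_id x).sub_const l).mul
        ((hasDerivAt_id x).sub_const r)).const_mul (M / 2))).congr_deriv (by simp)
    have hd2 : ∀ x, HasDerivAt (fun x => f' x + M / 2 * ((x - r) + (x - l)))
        (f'' x + M) x := fun x =>
      ((hf' x).add ((((hasDerivAt_id x).sub_const r).add
        ((hasDerivAt_id x).sub_const l)).const_mul (M / 2))).congr_deriv (by ring)
    -- The added parabola vanishes at both endpoints, so the chord is unchanged; convexity puts f
    -- below the chord plus M/2 · (x - l)(r - x), which is at most M (r - l)²/8.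
    have hconv : ConvexOn ℝ (Icc l r) (fun u => f u + M / 2 * ((u - l) * (u - r))) := by
      refine convexOn_of_hasDerivWithinAt2_nonneg (convex_Icc l r)
        (fun x _ => (hd1 x).continuousAt.continuousWithinAt)
        (fun x _ => (hd1 x).hasDerivWithinAt) (fun x _ => (hd2 x).hasDerivWithinAt) ?_
      intro x hx
      have := hM x (interior_subset hx)
      linarith
    have hd : 0 < r - l := sub_pos.2 hlr
    have h := hconv.2 (left_mem_Icc.2 hlr.le) (right_mem_Icc.2 hlr.le)
      (div_nonneg (by linarith [hx.2]) hd.le : 0 ≤ (r - x) / (r - l))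
      (div_nonneg (by linarith [hx.1]) hd.le : 0 ≤ (x - l) / (r - l))
      (by field_simp; ring)
    have hxe : (r - x) / (r - l) * l + (x - l) / (r - l) * r = x := by field_simp; ring
    simp only [smul_eq_mul, hxe] at h
    have hc : (r - x) / (r - l) * (f l + M / 2 * ((l - l) * (l - r))) +
        (x - l) / (r - l) * (f r + M / 2 * ((r - l) * (r - r)))
        = f l + (f r - f l) / (r - l) * (x - l) := by field_simp; ring
    rw [hc] at h
    nlinarith [mul_nonneg hM0 (sq_nonneg (2 * x - l - r))]
  rw [abs_le]
  constructor
  · have := key (fun x => -f x) (fun x => -f' x) (fun x => -f'' x) (fun x => (hf x).neg)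
      (fun x => (hf' x).neg) (fun x hx => by have := (abs_le.1 (hM x hx)).2; linarith)
    have h2 : (-f r - -f l) / (r - l) = -((f r - f l) / (r - l)) := by ring
    rw [h2] at this
    linarith
  · exact key f f' f'' hf hf' (fun x hx => (abs_le.1 (hM x hx)).1)

/-! ### The grid and linear interpolation -/

theorem cast_sub_one_pos {n : ℕ} (hn : 2 ≤ n) : (0 : ℝ) < (n : ℝ) - 1 := by
  have : (2 : ℝ) ≤ n := by exact_mod_cast hn
  linarith

theorem gridPoint_succ_sub {n : ℕ} (i : ℕ) :
    gridPoint n (i + 1) - gridPoint n i = 1 / ((n : ℝ) - 1) := by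
  simp only [gridPoint]; push_cast; ring

theorem gridPoint_mono {n : ℕ} (hn : 2 ≤ n) {i j : ℕ} (h : i ≤ j) :
    gridPoint n i ≤ gridPoint n j := by
  have := cast_sub_one_pos hn
  have h' : (i : ℝ) ≤ j := by exact_mod_cast h
  unfold gridPoint; gcongr

theorem gridPoint_zero (n : ℕ) : gridPoint n 0 = 0 := by simp [gridPoint]

theorem gridPoint_last {n : ℕ} (hn : 2 ≤ n) : gridPoint n (n - 1) = 1 := by
  have := cast_sub_one_pos hn
  rw [gridPoint, Nat.cast_sub (by omega)]; push_cast; field_simp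

theorem gridPoint_mem {n : ℕ} (hn : 2 ≤ n) (i : Fin n) : gridPoint n i ∈ Icc (0 : ℝ) 1 := by
  constructor
  · rw [← gridPoint_zero n]; exact gridPoint_mono hn (Nat.zero_le _)
  · rw [← gridPoint_last hn]; exact gridPoint_mono hn (by omega)

theorem exists_mem_cell {n : ℕ} (hn : 2 ≤ n) {x : ℝ} (hx : x ∈ Icc (0 : ℝ) 1) :
    ∃ i, i + 1 < n ∧ x ∈ Icc (gridPoint n i) (gridPoint n (i + 1)) := by
  have hp := cast_sub_one_pos hn
  have h0 : 0 ≤ x * ((n : ℝ) - 1) := mul_nonneg hx.1 hp.le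
  refine ⟨min ⌊x * ((n : ℝ) - 1)⌋₊ (n - 2), by omega, ?_, ?_⟩
  · rw [gridPoint, div_le_iff₀ hp]
    exact (Nat.cast_le.2 (min_le_left _ _)).trans (Nat.floor_le h0)
  · rcases le_total ⌊x * ((n : ℝ) - 1)⌋₊ (n - 2) with h | h
    · rw [min_eq_left h, gridPoint, le_div_iff₀ hp]
      push_cast
      exact (Nat.lt_floor_add_one _).le
    · rw [min_eq_right h, show n - 2 + 1 = n - 1 by omega, gridPoint_last hn]
      exact hx.2

theorem linearInterp_eq_convex {n : ℕ} (y : Fin n → ℝ) (i : ℕ) (hi : i + 1 < n) (x : ℝ)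
    (hx : x ∈ Icc (gridPoint n i) (gridPoint n (i + 1))) :
    ∃ l : ℝ, l = (x - gridPoint n i) * ((n : ℝ) - 1) ∧ 0 ≤ l ∧ l ≤ 1 ∧
      linearInterp y x = (1 - l) * y ⟨i, by omega⟩ + l * y ⟨i + 1, hi⟩ := by
  have hp := cast_sub_one_pos (show 2 ≤ n by omega)
  have hs := gridPoint_succ_sub (n := n) i
  refine ⟨_, rfl, mul_nonneg (by linarith [hx.1]) hp.le, ?_, ?_⟩
  · have : x - gridPoint n i ≤ 1 / ((n : ℝ) - 1) := by linarith [hx.2]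
    rwa [le_div_iff₀ hp] at this
  · rw [linearInterp_eq y i hi x hx, hs]
    field_simp; ring

theorem abs_linearInterp_le {n : ℕ} (hn : 2 ≤ n) {y : Fin n → ℝ} {Y : ℝ} (hY : ∀ i, |y i| ≤ Y)
    {x : ℝ} (hx : x ∈ Icc (0 : ℝ) 1) : |linearInterp y x| ≤ Y := by
  obtain ⟨i, hi, hxi⟩ := exists_mem_cell hn hx
  obtain ⟨l, -, h0, h1, he⟩ := linearInterp_eq_convex y i hi x hxi
  rw [he, abs_le]
  have a1 := abs_le.1 (hY ⟨i, by omega⟩)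
  have a2 := abs_le.1 (hY ⟨i + 1, hi⟩)
  constructor <;> nlinarith

theorem linearInterp_sub {n : ℕ} (hn : 2 ≤ n) (y y' : Fin n → ℝ) {x : ℝ}
    (hx : x ∈ Icc (0 : ℝ) 1) :
    linearInterp y x - linearInterp y' x = linearInterp (fun i => y i - y' i) x := by
  obtain ⟨i, hi, hxi⟩ := exists_mem_cell hn hx
  rw [linearInterp_eq _ i hi x hxi, linearInterp_eq _ i hi x hxi, linearInterp_eq _ i hi x hxi]
  ring

/-! ### Functions in the span of the tangent kernel at the data points -/

/-- A linear combination of the kernel functions at the data points. -/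
def ntkSpan {n : ℕ} (α : Fin n → ℝ) (x : ℝ) : ℝ := ∑ j, α j * ntk x (gridPoint n j)

/-- Up to the factor `(1 + x ^ 2) ^ 2`, the second derivative of `ntkSpan α` between the data
points. -/
def curvature {n : ℕ} (α : Fin n → ℝ) (x : ℝ) : ℝ :=
  4 / Real.pi * ∑ j, α j * |x - gridPoint n j|

theorem abs_ntkSpan_sub_linearInterp_le_of_curvature {n : ℕ} (hn : 2 ≤ n) (α : Fin n → ℝ) {M : ℝ}
    (hM : ∀ x ∈ Icc (0 : ℝ) 1, |curvature α x| ≤ M) {x : ℝ} (hx : x ∈ Icc (0 : ℝ) 1) :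
    |ntkSpan α x - linearInterp (fun i : Fin n => ntkSpan α (gridPoint n i)) x| ≤
      M / (8 * ((n : ℝ) - 1) ^ 2) := by
  have hp := cast_sub_one_pos hn
  obtain ⟨k, hk, hxk⟩ := exists_mem_cell hn hx
  have hs := gridPoint_succ_sub (n := n) k
  have hlt : gridPoint n k < gridPoint n (k + 1) := by
    have : 0 < 1 / ((n : ℝ) - 1) := by positivity
    linarith
  -- On a single cell the signs of x - x_j are constant, so the span function agrees there with a
  -- function F that is smooth on the whole line.
  let s : Fin n → ℝ := fun j => if (j : ℕ) ≤ k then 1 else -1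
  let z : Fin n → ℝ := fun j => gridPoint n j
  let F : ℝ → ℝ := fun u => ∑ j, α j * (1 / Real.pi *
    (s j * (u - z j) + 2 * (Real.pi - s j * (Real.arctan u - Real.arctan (z j))) * (1 + u * z j))
      + 1)
  let F' : ℝ → ℝ := fun x => ∑ j, α j * (1 / Real.pi *
    (s j + (2 * (-(s j * (1 / (1 + x ^ 2)))) * (1 + x * z j) +
        2 * (Real.pi - s j * (Real.arctan x - Real.arctan (z j))) * z j)))
  let F'' : ℝ → ℝ := fun x => ∑ j, α j * (1 / Real.pi *
    (2 * 2 * s j * (x - z j) / (1 + x ^ 2) ^ 2))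
  have hF : ∀ x, HasDerivAt F (F' x) x := fun x => HasDerivAt.fun_sum fun j _ =>
    (((hasDerivAt_branch (s j) 2 (z j) x).const_mul _).add_const _).const_mul _
  have hF' : ∀ x, HasDerivAt F' (F'' x) x := fun x => HasDerivAt.fun_sum fun j _ =>
    ((hasDerivAt_branch_deriv (s j) 2 (z j) x).const_mul _).const_mul _
  have habs : ∀ u ∈ Icc (gridPoint n k) (gridPoint n (k + 1)), ∀ j : Fin n,
      |u - z j| = s j * (u - z j) ∧
      |Real.arctan u - Real.arctan (z j)| = s j * (Real.arctan u - Real.arctan (z j)) := by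
    intro u hu j
    by_cases h : (j : ℕ) ≤ k
    · have hz : z j ≤ u := (gridPoint_mono hn h).trans hu.1
      simp only [s, if_pos h, one_mul]
      exact ⟨abs_of_nonneg (sub_nonneg.2 hz), abs_arctan_sub_of_le hz⟩
    · have hz : u ≤ z j := hu.2.trans (gridPoint_mono hn (by omega))
      simp only [s, if_neg h, neg_mul, one_mul]
      exact ⟨abs_of_nonpos (sub_nonpos.2 hz), abs_arctan_sub_of_ge hz⟩
  have hFe : ∀ u ∈ Icc (gridPoint n k) (gridPoint n (k + 1)), ntkSpan α u = F u := by
    intro u hu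
    refine Finset.sum_congr rfl fun j _ => ?_
    rw [ntk, (habs u hu j).1, (habs u hu j).2]
  have hFc : ∀ u ∈ Icc (gridPoint n k) (gridPoint n (k + 1)),
      F'' u = curvature α u / (1 + u ^ 2) ^ 2 := by
    intro u hu
    simp only [F'', curvature, Finset.mul_sum, Finset.sum_div]
    refine Finset.sum_congr rfl fun j _ => ?_
    rw [(habs u hu j).1]; ring
  have hsub : ∀ u ∈ Icc (gridPoint n k) (gridPoint n (k + 1)), u ∈ Icc (0 : ℝ) 1 := by
    intro u hu
    exact ⟨(gridPoint_mem hn ⟨k, by omega⟩).1.trans hu.1,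
      hu.2.trans (gridPoint_mem hn ⟨k + 1, hk⟩).2⟩
  have h := abs_sub_chord_le hlt hF hF' (M := M) ?_ hxk
  · rw [linearInterp_eq _ k hk x hxk, hFe x hxk]
    simp only
    rw [hFe _ (left_mem_Icc.2 hlt.le), hFe _ (right_mem_Icc.2 hlt.le)]
    refine h.trans (le_of_eq ?_)
    rw [hs]; field_simp
  · intro u hu
    rw [hFc u hu, abs_div, abs_of_pos (by positivity : (0 : ℝ) < (1 + u ^ 2) ^ 2)]
    have h1 : (1 : ℝ) ≤ (1 + u ^ 2) ^ 2 := one_le_pow₀ (by nlinarith [sq_nonneg u])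
    exact (div_le_self (abs_nonneg _) h1).trans (hM u (hsub u hu))

/-- Here Y₁ and Y₂ are the values of g at 0 and 1, and A₀ and A₁ are the moments Σ α_j and Σ α_j
x_j. Expanding the energy inequality in these variables, the terms quadratic in A₀, A₁ form a
negative definite form, so the linear terms force both moments to be of order G. -/
theorem abs_moments_le {p G A₀ A₁ Y₁ Y₂ : ℝ} (hp0 : 0.3 ≤ p) (hp1 : p ≤ 0.33) (hY₁ : |Y₁| ≤ G)
    (hY₂ : |Y₂| ≤ G)
    (h : -G ^ 2 ≤ (Y₂ + p * (A₀ - A₁)) * (-(p * A₁) - 5.5 * A₀ + Y₁ + Y₂) -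
      (Y₁ + p * A₁) * (3.5 * A₁ + (5.5 + p) * A₀ - (Y₁ + Y₂))) :
    |A₀| ≤ 13 * G ∧ |A₁| ≤ 13 * G := by
  have hG : 0 ≤ G := (abs_nonneg _).trans hY₁
  have a1 : ∀ Y A : ℝ, |Y| ≤ G → |Y * A| ≤ G * |A| := fun Y A hY => by
    rw [abs_mul]; gcongr
  have a2 : ∀ Y A : ℝ, |Y| ≤ G → |p * (Y * A)| ≤ 0.33 * (G * |A|) := fun Y A hY => by
    rw [abs_mul, abs_of_nonneg (by linarith : 0 ≤ p)]
    exact mul_le_mul hp1 (a1 Y A hY) (abs_nonneg _) (by norm_num)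
  obtain ⟨b1, b1r⟩ := abs_le.1 (a1 Y₁ A₀ hY₁)
  obtain ⟨b2, b2r⟩ := abs_le.1 (a1 Y₂ A₀ hY₂)
  obtain ⟨b3, b3r⟩ := abs_le.1 (a1 Y₁ A₁ hY₁)
  obtain ⟨b5, b5r⟩ := abs_le.1 (a2 Y₁ A₀ hY₁)
  obtain ⟨b6, b6r⟩ := abs_le.1 (a2 Y₂ A₀ hY₂)
  obtain ⟨b7, b7r⟩ := abs_le.1 (a2 Y₁ A₁ hY₁)
  obtain ⟨b8, b8r⟩ := abs_le.1 (a2 Y₂ A₁ hY₂)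
  have c1 : (Y₁ + Y₂) ^ 2 ≤ 4 * G ^ 2 := by
    have := abs_le.1 hY₁
    have := abs_le.1 hY₂
    nlinarith
  have q1 : 0.3 * A₀ ^ 2 ≤ p * A₀ ^ 2 := by gcongr
  have q2 : 0.3 * A₁ ^ 2 ≤ p * A₁ ^ 2 := by gcongr
  have q3 : p ^ 2 * (A₀ + A₁) ^ 2 ≥ 0 := by positivity
  have q4 : p ^ 2 * A₀ ^ 2 ≤ 0.33 * (p * A₀ ^ 2) := by
    have : 0 ≤ p * A₀ ^ 2 := by positivity
    nlinarith
  have q5 : p ^ 2 * A₁ ^ 2 ≤ 0.33 * (p * A₁ ^ 2) := by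
    have : 0 ≤ p * A₁ ^ 2 := by positivity
    nlinarith
  have main : 1.5 * A₀ ^ 2 + 0.8 * A₁ ^ 2 ≤ 12 * (G * |A₀|) + 5.2 * (G * |A₁|) + 5 * G ^ 2 := by
    have e : (Y₂ + p * (A₀ - A₁)) * (-(p * A₁) - 5.5 * A₀ + Y₁ + Y₂) -
        (Y₁ + p * A₁) * (3.5 * A₁ + (5.5 + p) * A₀ - (Y₁ + Y₂)) =
        (Y₁ + Y₂) ^ 2 - 5.5 * (p * A₀ ^ 2) - 3.5 * (p * A₁ ^ 2) + 2 * (p ^ 2 * A₁ ^ 2) +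
        p ^ 2 * A₀ ^ 2 - p ^ 2 * (A₀ + A₁) ^ 2 - p * (Y₂ * A₁) - 5.5 * (Y₂ * A₀) +
        p * (Y₂ * A₀) - 3.5 * (Y₁ * A₁) - 5.5 * (Y₁ * A₀) := by ring
    have n0 : 0 ≤ G * |A₀| := by positivity
    have n1 : 0 ≤ G * |A₁| := by positivity
    rw [e] at h
    linarith [sq_nonneg A₀, sq_nonneg A₁]
  have e0 : |A₀| ^ 2 = A₀ ^ 2 := sq_abs _
  have e1 : |A₁| ^ 2 = A₁ ^ 2 := sq_abs _
  constructor
  · refine abs_le_of_sq_le_sq' ?_ (by positivity) |> abs_le.2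
    nlinarith [sq_nonneg (|A₀| - 8 * G), sq_nonneg (|A₁| - 3.25 * G), sq_nonneg G]
  · refine abs_le_of_sq_le_sq' ?_ (by positivity) |> abs_le.2
    nlinarith [sq_nonneg (|A₀| - 4 * G), sq_nonneg (|A₁| - 6.5 * G), sq_nonneg G]

theorem one_div_pi_bounds : 0.3 ≤ 1 / Real.pi ∧ 1 / Real.pi ≤ 0.33 := by
  have h1 := Real.pi_gt_d2
  have h2 := Real.pi_lt_d2
  have hp := Real.pi_pos
  constructor
  · rw [le_div_iff₀ hp]; linarith
  · rw [div_le_iff₀ hp]; linarith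

set_option maxHeartbeats 400000 in
/-- If `|g| ≤ G` on `[0, 1]` for `g = ntkSpan α`, then the curvature of `g` is at most a constant
times `G`. -/
theorem abs_curvature_le {n : ℕ} (hn : 2 ≤ n) (α : Fin n → ℝ) {G : ℝ}
    (hG : ∀ x ∈ Icc (0 : ℝ) 1, |ntkSpan α x| ≤ G) {x : ℝ} (hx : x ∈ Icc (0 : ℝ) 1) :
    |curvature α x| ≤ 4 * (131 * Real.exp 4 + 1) * G := by
  have hpi := Real.pi_pos
  obtain ⟨hp0, hp1⟩ := one_div_pi_bounds
  set p := 1 / Real.pi with hp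
  have hppi : p * Real.pi = 1 := by rw [hp]; field_simp
  have hG0 : 0 ≤ G := (abs_nonneg _).trans (hG 0 (by simp))
  let z : Fin n → ℝ := fun j => gridPoint n j
  have hz0 : ∀ j, 0 ≤ z j := fun j => (gridPoint_mem hn j).1
  have hz1 : ∀ j, z j ≤ 1 := fun j => (gridPoint_mem hn j).2
  set A₀ := ∑ j, α j with hA₀
  set A₁ := ∑ j, α j * z j with hA₁
  set T₀ := ∑ j, α j * Real.arctan (z j) with hT₀
  set T₁ := ∑ j, α j * (z j * Real.arctan (z j)) with hT₁
  let R : ℝ → ℝ := fun x => 2 * p * ∑ j, α j * smoothPart (z j) x + A₀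
  let R' : ℝ → ℝ := fun x => 2 * p * ∑ j, α j * smoothPartDeriv (z j) x
  have hR : ∀ x, HasDerivAt R (R' x) x := fun x =>
    ((HasDerivAt.fun_sum fun j _ => (hasDerivAt_smoothPart (z j) x).const_mul _).const_mul
      _).add_const _
  -- Hence the second derivative of R is an expression in R and g: a linear equation with a bounded
  -- forcing term.
  have hcurv : ∀ x, curvature α x = 4 * (R x - ntkSpan α x) := by
    intro x
    simp only [curvature, R, ntkSpan, hA₀, Finset.mul_sum, ← Finset.sum_add_distrib,
      ← Finset.sum_sub_distrib, smoothPart, ntk, z]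
    refine Finset.sum_congr rfl fun j _ => ?_
    rw [show 4 / Real.pi = 4 * p by rw [hp]; ring]
    ring
  have hR' : ∀ x, HasDerivAt R' (4 * (R x - ntkSpan α x) / (1 + x ^ 2) ^ 2) x := fun x => by
    refine ((HasDerivAt.fun_sum fun j _ =>
      (hasDerivAt_smoothPartDeriv (z j) x).const_mul (α j)).const_mul (2 * p)).congr_deriv ?_
    rw [← hcurv, curvature, Finset.mul_sum, Finset.mul_sum, Finset.sum_div]
    refine Finset.sum_congr rfl fun j _ => ?_
    rw [show 4 / Real.pi = 4 * p by rw [hp]; ring]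
    ring
  have hq : ∀ x : ℝ, 1 ≤ (1 + x ^ 2) ^ 2 := fun x => one_le_pow₀ (by nlinarith [sq_nonneg x])
  -- the energy inequality
  have hE : ∀ x, HasDerivAt (fun u => R u * R' u + G ^ 2 * u)
      (R' x * R' x + R x * (4 * (R x - ntkSpan α x) / (1 + x ^ 2) ^ 2) + G ^ 2) x := fun x =>
    (((hR x).mul (hR' x)).add ((hasDerivAt_id x).const_mul (G ^ 2))).congr_deriv (by simp)
  have henergy : R 0 * R' 0 - G ^ 2 ≤ R 1 * R' 1 := by
    have hmono : MonotoneOn (fun u => R u * R' u + G ^ 2 * u) (Icc 0 1) := by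
      refine monotoneOn_of_hasDerivWithinAt_nonneg (convex_Icc 0 1)
        (fun x _ => (hE x).continuousAt.continuousWithinAt)
        (fun x _ => (hE x).hasDerivWithinAt) fun x hx => ?_
      have hg := abs_le.1 (hG x (interior_subset hx))
      -- Completing the square, 4R(R - g) = (2R - g)² - g², so the derivative of R R' is at least
      -- -G².
      have h1 : -G ^ 2 ≤ R x * (4 * (R x - ntkSpan α x)) := by
        nlinarith [sq_nonneg (2 * R x - ntkSpan α x)]
      have h2 : -G ^ 2 ≤ R x * (4 * (R x - ntkSpan α x) / (1 + x ^ 2) ^ 2) := by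
        rw [← mul_div_assoc, le_div_iff₀ (by positivity)]
        nlinarith [hq x, sq_nonneg G]
      nlinarith [mul_self_nonneg (R' x)]
    have := hmono (left_mem_Icc.2 zero_le_one) (right_mem_Icc.2 zero_le_one) zero_le_one
    simp only [mul_zero, mul_one, add_zero] at this
    linarith
  -- boundary values
  have q0 : curvature α 0 = 4 * p * A₁ := by
    rw [curvature, show 4 / Real.pi = 4 * p by rw [hp]; ring, hA₁]
    congr 1
    exact Finset.sum_congr rfl fun j _ => by rw [zero_sub, abs_neg, abs_of_nonneg (hz0 j)]
  have q1 : curvature α 1 = 4 * p * (A₀ - A₁) := by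
    rw [curvature, show 4 / Real.pi = 4 * p by rw [hp]; ring, hA₁, hA₀, ← Finset.sum_sub_distrib]
    congr 1
    refine Finset.sum_congr rfl fun j _ => ?_
    rw [abs_of_nonneg (sub_nonneg.2 (hz1 j))]; ring
  have r0 : R 0 = ntkSpan α 0 + p * A₁ := by have := hcurv 0; linarith
  have r1 : R 1 = ntkSpan α 1 + p * (A₀ - A₁) := by have := hcurv 1; linarith
  have s0 : R 0 = 2 * p * (A₁ + Real.pi * A₀ - T₀) + A₀ := by
    simp only [R, hA₁, hA₀, hT₀, Finset.mul_sum, ← Finset.sum_add_distrib,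
      ← Finset.sum_sub_distrib]
    refine Finset.sum_congr rfl fun j _ => ?_
    rw [smoothPart, abs_arctan_sub_of_ge (hz0 j), zero_sub, abs_neg, abs_of_nonneg (hz0 j),
      Real.arctan_zero]
    ring
  have s1 : R 1 = 2 * p * (A₀ - A₁ + 3 * Real.pi / 4 * (A₀ + A₁) + T₀ + T₁) + A₀ := by
    simp only [R, hA₁, hA₀, hT₀, hT₁, Finset.mul_sum, ← Finset.sum_add_distrib,
      ← Finset.sum_sub_distrib]
    refine Finset.sum_congr rfl fun j _ => ?_
    rw [smoothPart, abs_arctan_sub_of_le (hz1 j), abs_of_nonneg (sub_nonneg.2 (hz1 j)),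
      Real.arctan_one]
    ring
  have t0 : R' 0 = 2 * p * (Real.pi * A₁ - T₁) := by
    simp only [R', hA₁, hT₁, Finset.mul_sum, ← Finset.sum_sub_distrib]
    refine Finset.sum_congr rfl fun j _ => ?_
    rw [smoothPartDeriv, abs_arctan_sub_of_ge (hz0 j), Real.arctan_zero]
    ring
  have t1 : R' 1 = 2 * p * (1 / 2 * (A₀ - A₁) + 3 * Real.pi / 4 * A₁ + T₁) := by
    simp only [R', hA₁, hA₀, hT₁, Finset.mul_sum, ← Finset.sum_add_distrib,
      ← Finset.sum_sub_distrib]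
    refine Finset.sum_congr rfl fun j _ => ?_
    rw [smoothPartDeriv, abs_arctan_sub_of_le (hz1 j), abs_of_nonneg (sub_nonneg.2 (hz1 j)),
      Real.arctan_one]
    ring
  have m0 : 2 * p * (Real.pi * A₀) = 2 * A₀ := by linear_combination 2 * A₀ * hppi
  have m1 : 2 * p * (Real.pi * A₁) = 2 * A₁ := by linear_combination 2 * A₁ * hppi
  -- The arctangent moments T₀ and T₁ are eliminated between the direct formulas at the two
  -- endpoints; the identities for R - g at 0 and 1 replace the remaining values of R.
  have u0 : R' 0 = 3.5 * A₁ + (5.5 + p) * A₀ - (ntkSpan α 0 + ntkSpan α 1) := by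
    linear_combination t0 + s0 + s1 - r0 - r1 + 7 / 4 * m0 + 7 / 4 * m1
  have u1 : R' 1 = -(p * A₁) - 5.5 * A₀ + ntkSpan α 0 + ntkSpan α 1 := by
    linear_combination t1 - s0 - s1 + r0 + r1 - 7 / 4 * m0
  have hY0 := hG 0 (by simp)
  have hY1 := hG 1 (by simp)
  obtain ⟨hA0, hA1⟩ := abs_moments_le hp0 hp1 hY0 hY1 (A₀ := A₀) (A₁ := A₁) (by
    rw [← u0, ← u1, ← r0, ← r1]; linarith)
  -- Grönwall's inequality
  have hb0 : |R 0| ≤ 130 * G := by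
    rw [r0]
    refine (abs_add_le _ _).trans ?_
    rw [abs_mul, abs_of_nonneg (by linarith : 0 ≤ p)]
    have : p * |A₁| ≤ 0.33 * (13 * G) := mul_le_mul hp1 hA1 (abs_nonneg _) (by norm_num)
    linarith
  have hb1 : |R' 0| ≤ 130 * G := by
    obtain ⟨_, _⟩ := abs_le.1 hY0
    obtain ⟨_, _⟩ := abs_le.1 hY1
    obtain ⟨_, _⟩ := abs_le.1 hA0
    obtain ⟨_, _⟩ := abs_le.1 hA1
    have hpA : |p * A₀| ≤ 0.33 * (13 * G) := by
      rw [abs_mul, abs_of_nonneg (by linarith : 0 ≤ p)]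
      exact mul_le_mul hp1 hA0 (abs_nonneg _) (by norm_num)
    obtain ⟨_, _⟩ := abs_le.1 hpA
    rw [u0, abs_le, add_mul]
    constructor <;> linarith
  -- The equation is written as a first-order system for (R, R') in the maximum norm.
  have hgr := norm_le_gronwallBound_of_norm_deriv_right_le (f := fun x => (R x, R' x))
    (f' := fun x => (R' x, 4 * (R x - ntkSpan α x) / (1 + x ^ 2) ^ 2)) (δ := 130 * G) (K := 4)
    (ε := 4 * G) (a := 0) (b := 1)
    (fun x _ => ((hR x).prodMk (hR' x)).continuousAt.continuousWithinAt)
    (fun x _ => ((hR x).prodMk (hR' x)).hasDerivWithinAt) (by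
      rw [Prod.norm_def]
      exact max_le hb0 hb1) (by
      intro x hx
      have hg := hG x ⟨hx.1, hx.2.le⟩
      have h1 : ‖R x‖ ≤ ‖(R x, R' x)‖ := norm_fst_le (R x, R' x)
      have h2 : ‖R' x‖ ≤ ‖(R x, R' x)‖ := norm_snd_le (R x, R' x)
      rw [Prod.norm_def]
      refine max_le ?_ ?_
      · simp only
        linarith [norm_nonneg (R x, R' x)]
      · simp only
        rw [norm_div, norm_mul, Real.norm_eq_abs ((1 + x ^ 2) ^ 2),
          abs_of_nonneg (by positivity : (0 : ℝ) ≤ (1 + x ^ 2) ^ 2)]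
        refine (div_le_self (by positivity) (hq x)).trans ?_
        have h3 : ‖R x - ntkSpan α x‖ ≤ ‖R x‖ + |ntkSpan α x| := norm_sub_le _ _
        have h4 : ‖(4 : ℝ)‖ = 4 := by norm_num
        rw [h4]
        linarith) x hx
  have hRx : |R x| ≤ 131 * Real.exp 4 * G := by
    refine (norm_fst_le (R x, R' x)).trans (hgr.trans ?_)
    rw [gronwallBound_of_K_ne_0 (by norm_num)]
    have h1 : Real.exp (4 * (x - 0)) ≤ Real.exp 4 := Real.exp_le_exp.2 (by linarith [hx.2])
    have h2 : G * Real.exp (4 * (x - 0)) ≤ G * Real.exp 4 := by gcongr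
    simp only
    linarith
  rw [hcurv, abs_mul, abs_of_pos (by norm_num : (0 : ℝ) < 4)]
  have := abs_sub (R x) (ntkSpan α x)
  have := hG x hx
  linarith

/-- For a large number of data points, a function in the span of the kernel at the data points
is uniformly close to the linear interpolant of its own values at the data points. -/
theorem exists_abs_ntkSpan_sub_linearInterp_le :
    ∃ (C : ℝ) (N : ℕ), 0 < C ∧ 2 ≤ N ∧ ∀ n : ℕ, N ≤ n → ∀ (α : Fin n → ℝ) (Y : ℝ),
      (∀ i : Fin n, |ntkSpan α (gridPoint n i)| ≤ Y) → ∀ x ∈ Icc (0 : ℝ) 1,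
        |ntkSpan α x - linearInterp (fun i : Fin n => ntkSpan α (gridPoint n i)) x| ≤
          C * Y / ((n : ℝ) - 1) ^ 2 := by
  set D : ℝ := 4 * (131 * Real.exp 4 + 1) with hD
  have hD0 : 0 < D := by positivity
  -- For such n one has D ≤ (n - 1)². This lets the contribution of M to sup |g| be absorbed: M ≤ D
  -- Y + M/8.
  refine ⟨D, ⌈D⌉₊ + 2, hD0, by omega, fun n hn α Y hY => ?_⟩
  have hn2 : 2 ≤ n := by omega
  have hp := cast_sub_one_pos hn2
  have hnD : D + 1 ≤ (n : ℝ) - 1 := by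
    have h1 : D ≤ ⌈D⌉₊ := Nat.le_ceil D
    have h2 : ((⌈D⌉₊ + 2 : ℕ) : ℝ) ≤ n := by exact_mod_cast hn
    push_cast at h2
    linarith
  have hsq : D ≤ ((n : ℝ) - 1) ^ 2 := by nlinarith
  have hsq0 : 0 < ((n : ℝ) - 1) ^ 2 := by positivity
  have hcont : Continuous (curvature α) := by unfold curvature; fun_prop
  obtain ⟨x₀, hx₀, hmax⟩ := isCompact_Icc.exists_isMaxOn (nonempty_Icc.2 zero_le_one)
    (hcont.abs.continuousOn (s := Icc (0 : ℝ) 1))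
  set M := |curvature α x₀| with hM
  have hM0 : 0 ≤ M := abs_nonneg _
  have hb : ∀ x ∈ Icc (0 : ℝ) 1, |curvature α x| ≤ M := fun x hx => hmax hx
  have hchord := fun x hx => abs_ntkSpan_sub_linearInterp_le_of_curvature hn2 α hb (x := x) hx
  have hG : ∀ x ∈ Icc (0 : ℝ) 1, |ntkSpan α x| ≤ Y + M / (8 * ((n : ℝ) - 1) ^ 2) := by
    intro x hx
    have h1 := hchord x hx
    have h2 := abs_linearInterp_le hn2 hY hx
    have h3 := abs_sub_abs_le_abs_sub (ntkSpan α x)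
      (linearInterp (fun i : Fin n => ntkSpan α (gridPoint n i)) x)
    linarith
  have hMb := abs_curvature_le hn2 α hG hx₀
  rw [← hM, ← hD] at hMb
  have h1 : D * (M / (8 * ((n : ℝ) - 1) ^ 2)) ≤ M / 8 := by
    rw [← mul_div_assoc, div_le_div_iff₀ (by positivity) (by norm_num)]
    nlinarith
  have hMle : M ≤ 2 * D * Y := by nlinarith
  intro x hx
  refine (hchord x hx).trans ?_
  rw [div_le_div_iff₀ (by positivity) (by positivity)]
  have hY0 : 0 ≤ D * Y := by nlinarith
  nlinarith

/-! ### Gaussian integrals of homogeneous functions of two variables -/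

theorem integral_gaussian_prod (F : ℝ × ℝ → ℝ) :
    ∫ q, F q ∂((gaussianReal 0 1).prod (gaussianReal 0 1)) =
      ∫ q : ℝ × ℝ, (2 * Real.pi)⁻¹ * Real.exp (-(q.1 ^ 2 + q.2 ^ 2) / 2) * F q := by
  rw [gaussianReal_of_var_ne_zero 0 one_ne_zero,
    prod_withDensity (measurable_gaussianPDF _ _) (measurable_gaussianPDF _ _),
    integral_withDensity_eq_integral_toReal_smul (by
      have := measurable_gaussianPDF 0 1
      fun_prop)
    (Filter.Eventually.of_forall fun q => ENNReal.mul_lt_top (by simp [gaussianPDF])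
      (by simp [gaussianPDF]))]
  refine integral_congr_ae (Filter.Eventually.of_forall fun q => ?_)
  simp only [ENNReal.toReal_mul, toReal_gaussianPDF, gaussianPDFReal_def, smul_eq_mul, sub_zero,
    NNReal.coe_one, mul_one]
  rw [show (2 * Real.pi)⁻¹ = (√(2 * Real.pi))⁻¹ * (√(2 * Real.pi))⁻¹ by
    rw [← mul_inv, Real.mul_self_sqrt (by positivity)],
    show -(q.1 ^ 2 + q.2 ^ 2) / 2 = -q.1 ^ 2 / 2 + -q.2 ^ 2 / 2 by ring, Real.exp_add]
  ring

/-- The Gaussian density depends only on the radius, so in polar coordinates a homogeneous integrand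
splits into a radial and an angular integral. -/
theorem integral_gaussian_homogeneous {F : ℝ × ℝ → ℝ} {Φ : ℝ → ℝ} (k : ℕ)
    (hF : ∀ r θ, 0 < r → θ ∈ Ioo (-Real.pi) Real.pi →
      F (r * Real.cos θ, r * Real.sin θ) = r ^ k * Φ θ) :
    ∫ q, F q ∂((gaussianReal 0 1).prod (gaussianReal 0 1)) =
      (∫ r in Ioi (0 : ℝ), r ^ (k + 1) * Real.exp (-r ^ 2 / 2)) * (2 * Real.pi)⁻¹ *
        ∫ θ in Ioo (-Real.pi) Real.pi, Φ θ := by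
  rw [integral_gaussian_prod, ← integral_comp_polarCoord_symm, polarCoord_target,
    mul_assoc, ← integral_const_mul, Measure.volume_eq_prod, ← setIntegral_prod_mul]
  refine setIntegral_congr_fun (measurableSet_Ioi.prod measurableSet_Ioo) fun q hq => ?_
  simp only [polarCoord_symm_apply, smul_eq_mul]
  rw [hF q.1 q.2 hq.1 hq.2, show (q.1 * Real.cos q.2) ^ 2 + (q.1 * Real.sin q.2) ^ 2 = q.1 ^ 2 by
    rw [mul_pow, mul_pow, ← mul_add, Real.cos_sq_add_sin_sq, mul_one]]
  ring

theorem integral_Ioi_mul_exp_neg_sq :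
    ∫ r in Ioi (0 : ℝ), r ^ (0 + 1) * Real.exp (-r ^ 2 / 2) = 1 := by
  have h := integral_rpow_mul_exp_neg_mul_rpow (p := 2) (q := 1) (b := 1 / 2) (by norm_num)
    (by norm_num) (by norm_num)
  rw [show ((1 : ℝ) + 1) / 2 = 1 by norm_num, Real.Gamma_one,
    show -((1 : ℝ) + 1) / 2 = -1 by norm_num, Real.rpow_neg_one] at h
  rw [show (1 / 2 : ℝ)⁻¹ * (1 / 2) * 1 = 1 by norm_num] at h
  rw [← h]
  refine setIntegral_congr_fun measurableSet_Ioi fun r hr => ?_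
  rw [Real.rpow_one, Real.rpow_two]
  ring_nf

theorem integral_Ioi_pow_three_mul_exp_neg_sq :
    ∫ r in Ioi (0 : ℝ), r ^ (2 + 1) * Real.exp (-r ^ 2 / 2) = 2 := by
  have h := integral_rpow_mul_exp_neg_mul_rpow (p := 2) (q := 3) (b := 1 / 2) (by norm_num)
    (by norm_num) (by norm_num)
  rw [show ((3 : ℝ) + 1) / 2 = 1 + 1 by norm_num, Real.Gamma_add_one one_ne_zero, Real.Gamma_one,
    show -((3 : ℝ) + 1) / 2 = ((-2 : ℤ) : ℝ) by norm_num, Real.rpow_intCast] at h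
  rw [show (1 / 2 : ℝ) ^ (-2 : ℤ) * (1 / 2) * (1 * 1) = 2 by norm_num] at h
  refine Eq.trans ?_ h
  refine setIntegral_congr_fun measurableSet_Ioi fun r hr => ?_
  rw [show (3 : ℝ) = ((3 : ℕ) : ℝ) by norm_num, Real.rpow_natCast, Real.rpow_two]
  ring_nf

/-! ### The features of a random neuron -/

/-- The value at `z` of a neuron with inner weight `q.1` and inner bias `q.2`. -/
def act (z : ℝ) (q : ℝ × ℝ) : ℝ := max (q.1 * z + q.2) 0

/-- The indicator that a neuron with inner weight `q.1` and inner bias `q.2` is active at `z`. -/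
def gate (z : ℝ) (q : ℝ × ℝ) : ℝ := if 0 < q.1 * z + q.2 then 1 else 0

theorem act_eq (z : ℝ) (q : ℝ × ℝ) : act z q = gate z q * (q.1 * z + q.2) := by
  unfold act gate
  split_ifs with h
  · rw [one_mul, max_eq_left h.le]
  · rw [zero_mul, max_eq_right (not_lt.1 h)]

/-- In polar coordinates the pre-activation is a positive multiple of sin(θ + arctan z), so the
active weight vectors form a half-plane. Two such half-planes overlap in an angle π - |arctan z -
arctan z'|, the source of the arctangents in the kernel. -/
theorem gate_polar {z r θ : ℝ} (hz : 0 ≤ z) (hr : 0 < r) (hθ : θ ∈ Ioo (-Real.pi) Real.pi) :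
    gate z (r * Real.cos θ, r * Real.sin θ) =
      if θ ∈ Ioo (-Real.arctan z) (Real.pi - Real.arctan z) then 1 else 0 := by
  have hc := Real.cos_arctan_pos z
  have ha0 : 0 ≤ Real.arctan z := Real.arctan_nonneg.2 hz
  have ha1 := Real.arctan_lt_pi_div_two z
  have hpi := Real.pi_pos
  have hs : Real.sin (Real.arctan z) = z * Real.cos (Real.arctan z) := by
    rw [← Real.tan_mul_cos hc.ne', Real.tan_arctan]
  have h1 : r * Real.cos θ * z + r * Real.sin θ =
      r / Real.cos (Real.arctan z) * Real.sin (θ + Real.arctan z) := by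
    rw [Real.sin_add, hs]; field_simp; ring
  unfold gate
  simp only [h1]
  refine if_congr ?_ rfl rfl
  rw [mul_pos_iff_of_pos_left (by positivity)]
  constructor
  · intro h
    constructor
    · by_contra hcon
      have := Real.sin_nonpos_of_nonpos_of_neg_pi_le (x := θ + Real.arctan z)
        (by linarith [not_lt.1 hcon]) (by linarith [hθ.1])
      linarith
    · by_contra hcon
      have := Real.sin_nonpos_of_nonpos_of_neg_pi_le (x := θ + Real.arctan z - 2 * Real.pi)
        (by linarith [hθ.2]) (by linarith [not_lt.1 hcon])
      rw [Real.sin_sub_two_pi] at this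
      linarith
  · intro h
    exact Real.sin_pos_of_pos_of_lt_pi (by linarith [h.1]) (by linarith [h.2])

theorem setIntegral_gates {z z' : ℝ} (hz : 0 ≤ z) (hzz : z ≤ z') (f : ℝ → ℝ) :
    ∫ θ in Ioo (-Real.pi) Real.pi,
      (if θ ∈ Ioo (-Real.arctan z) (Real.pi - Real.arctan z) then (1 : ℝ) else 0) *
        (if θ ∈ Ioo (-Real.arctan z') (Real.pi - Real.arctan z') then 1 else 0) * f θ =
      ∫ θ in (-Real.arctan z)..(Real.pi - Real.arctan z'), f θ := by
  have ha0 : 0 ≤ Real.arctan z := Real.arctan_nonneg.2 hz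
  have ha1 := Real.arctan_lt_pi_div_two z'
  have haa := Real.arctan_mono hzz
  have hpi := Real.pi_pos
  rw [intervalIntegral.integral_of_le (by linarith), integral_Ioc_eq_integral_Ioo]
  have : ∀ θ, (if θ ∈ Ioo (-Real.arctan z) (Real.pi - Real.arctan z) then (1 : ℝ) else 0) *
        (if θ ∈ Ioo (-Real.arctan z') (Real.pi - Real.arctan z') then 1 else 0) * f θ =
      (Ioo (-Real.arctan z) (Real.pi - Real.arctan z')).indicator f θ := by
    intro θ
    by_cases h : θ ∈ Ioo (-Real.arctan z) (Real.pi - Real.arctan z')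
    · rw [indicator_of_mem h, if_pos ⟨h.1, by linarith [h.2]⟩,
        if_pos ⟨by linarith [h.1], h.2⟩]
      ring
    · rw [indicator_of_notMem h]
      by_cases h1 : θ ∈ Ioo (-Real.arctan z) (Real.pi - Real.arctan z)
      · rw [if_neg (c := θ ∈ Ioo (-Real.arctan z') (Real.pi - Real.arctan z'))
          (fun h2 => h ⟨h1.1, h2.2⟩)]
        ring
      · rw [if_neg h1]; ring
  simp only [this]
  rw [setIntegral_indicator measurableSet_Ioo, inter_eq_self_of_subset_right]
  exact Ioo_subset_Ioo (by linarith) (by linarith)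

theorem integral_gate_mul_gate_of_le {z z' : ℝ} (hz : 0 ≤ z) (hzz : z ≤ z') :
    ∫ q, gate z q * gate z' q ∂((gaussianReal 0 1).prod (gaussianReal 0 1)) =
      (Real.pi - (Real.arctan z' - Real.arctan z)) / (2 * Real.pi) := by
  rw [integral_gaussian_homogeneous 0 (Φ := fun θ =>
      (if θ ∈ Ioo (-Real.arctan z) (Real.pi - Real.arctan z) then (1 : ℝ) else 0) *
        (if θ ∈ Ioo (-Real.arctan z') (Real.pi - Real.arctan z') then 1 else 0) * 1)
    (fun r θ hr hθ => by
      rw [gate_polar hz hr hθ, gate_polar (hz.trans hzz) hr hθ]; ring),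
    setIntegral_gates hz hzz, integral_Ioi_mul_exp_neg_sq]
  simp
  ring

theorem integral_act_mul_act_of_le {z z' : ℝ} (hz : 0 ≤ z) (hzz : z ≤ z') :
    ∫ q, act z q * act z' q ∂((gaussianReal 0 1).prod (gaussianReal 0 1)) =
      ((z' - z) + (Real.pi - (Real.arctan z' - Real.arctan z)) * (1 + z * z')) /
        (2 * Real.pi) := by
  have hpi := Real.pi_pos
  rw [integral_gaussian_homogeneous 2 (Φ := fun θ =>
      (if θ ∈ Ioo (-Real.arctan z) (Real.pi - Real.arctan z) then (1 : ℝ) else 0) *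
        (if θ ∈ Ioo (-Real.arctan z') (Real.pi - Real.arctan z') then 1 else 0) *
        ((z * Real.cos θ + Real.sin θ) * (z' * Real.cos θ + Real.sin θ)))
    (fun r θ hr hθ => by
      rw [act_eq, act_eq, gate_polar hz hr hθ, gate_polar (hz.trans hzz) hr hθ]; ring),
    setIntegral_gates hz hzz, integral_Ioi_pow_three_mul_exp_neg_sq]
  have hd : ∀ θ ∈ uIcc (-Real.arctan z) (Real.pi - Real.arctan z'), HasDerivAt (fun θ =>
      z * z' * (θ + Real.sin θ * Real.cos θ) / 2 + (z + z') * (Real.sin θ * Real.sin θ) / 2 +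
        (θ - Real.sin θ * Real.cos θ) / 2)
      ((z * Real.cos θ + Real.sin θ) * (z' * Real.cos θ + Real.sin θ)) θ := by
    intro θ _
    have hs := Real.hasDerivAt_sin θ
    have hc := Real.hasDerivAt_cos θ
    have hid := hasDerivAt_id θ
    refine ((((hid.fun_add (hs.fun_mul hc)).const_mul (z * z')).div_const 2).fun_add
      (((hs.fun_mul hs).const_mul (z + z')).div_const 2)).fun_add
      ((hid.fun_sub (hs.fun_mul hc)).div_const 2) |>.congr_deriv ?_
    have := Real.sin_sq_add_cos_sq θ
    linear_combination (-(z * z') / 2 - 1 / 2) * this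
  rw [intervalIntegral.integral_eq_sub_of_hasDerivAt hd
    (Continuous.intervalIntegrable (by fun_prop) _ _)]
  have hcs : ∀ z : ℝ, Real.sin (Real.arctan z) = z * Real.cos (Real.arctan z) ∧
      (1 + z ^ 2) * Real.cos (Real.arctan z) ^ 2 = 1 := by
    intro z
    have hs : Real.sin (Real.arctan z) = z * Real.cos (Real.arctan z) := by
      rw [← Real.tan_mul_cos (Real.cos_arctan_pos z).ne', Real.tan_arctan]
    refine ⟨hs, ?_⟩
    have := Real.sin_sq_add_cos_sq (Real.arctan z)
    rw [hs] at this
    linear_combination this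
  obtain ⟨s1, c1⟩ := hcs z
  obtain ⟨s2, c2⟩ := hcs z'
  simp only [Real.sin_neg, Real.cos_neg, Real.sin_pi_sub, Real.cos_pi_sub, s1, s2]
  field_simp
  linear_combination z' * c2 - z * c1

theorem integral_gate_mul_gate {z z' : ℝ} (hz : 0 ≤ z) (hz' : 0 ≤ z') :
    ∫ q, gate z q * gate z' q ∂((gaussianReal 0 1).prod (gaussianReal 0 1)) =
      (Real.pi - |Real.arctan z - Real.arctan z'|) / (2 * Real.pi) := by
  rcases le_total z z' with h | h
  · rw [integral_gate_mul_gate_of_le hz h, abs_arctan_sub_of_ge h]; ring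
  · simp only [mul_comm (gate z _)]
    rw [integral_gate_mul_gate_of_le hz' h, abs_arctan_sub_of_le h]

theorem integral_act_mul_act {z z' : ℝ} (hz : 0 ≤ z) (hz' : 0 ≤ z') :
    ∫ q, act z q * act z' q ∂((gaussianReal 0 1).prod (gaussianReal 0 1)) =
      (|z - z'| + (Real.pi - |Real.arctan z - Real.arctan z'|) * (1 + z * z')) /
        (2 * Real.pi) := by
  rcases le_total z z' with h | h
  · rw [integral_act_mul_act_of_le hz h, abs_arctan_sub_of_ge h, abs_of_nonpos (sub_nonpos.2 h)]
    ring
  · simp only [mul_comm (act z _)]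
    rw [integral_act_mul_act_of_le hz' h, abs_arctan_sub_of_le h, abs_of_nonneg (sub_nonneg.2 h)]
    ring

/-- The law of the inner weight and the inner bias of a neuron at initialization. -/
abbrev innerLaw : Measure (ℝ × ℝ) := (gaussianReal 0 1).prod (gaussianReal 0 1)

/-- The law of the outer weight, the inner weight and the inner bias of a neuron at
initialization. -/
abbrev neuronLaw : Measure (ℝ × ℝ × ℝ) := (gaussianReal 0 1).prod innerLaw

/-- The `ℓ¹` norm of the weights of a neuron. -/
def weightNorm (v : ℝ × ℝ × ℝ) : ℝ := |v.1| + |v.2.1| + |v.2.2|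

theorem weightNorm_nonneg (v : ℝ × ℝ × ℝ) : 0 ≤ weightNorm v := by unfold weightNorm; positivity

theorem measurable_weightNorm : Measurable weightNorm := by unfold weightNorm; fun_prop

theorem measurable_gate (z : ℝ) : Measurable (gate z) := by
  unfold gate
  exact Measurable.ite (measurableSet_lt (by fun_prop) (by fun_prop)) measurable_const
    measurable_const

theorem measurable_act (z : ℝ) : Measurable (act z) := by unfold act; fun_prop

theorem gate_eq_zero_or_one (z : ℝ) (q : ℝ × ℝ) : gate z q = 0 ∨ gate z q = 1 := by
  unfold gate; split_ifs <;> simp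

theorem gate_nonneg (z : ℝ) (q : ℝ × ℝ) : 0 ≤ gate z q := by
  rcases gate_eq_zero_or_one z q with h | h <;> rw [h]; exact zero_le_one

theorem gate_le_one (z : ℝ) (q : ℝ × ℝ) : gate z q ≤ 1 := by
  rcases gate_eq_zero_or_one z q with h | h <;> rw [h]; exact zero_le_one

theorem act_nonneg (z : ℝ) (q : ℝ × ℝ) : 0 ≤ act z q := le_max_right _ _

theorem act_le {z : ℝ} (hz : z ∈ Icc (0 : ℝ) 1) (q : ℝ × ℝ) : act z q ≤ |q.1| + |q.2| := by
  refine max_le ?_ (by positivity)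
  have h1 : q.1 * z ≤ |q.1| := (le_abs_self _).trans (by
    rw [abs_mul, abs_of_nonneg hz.1]; exact mul_le_of_le_one_right (abs_nonneg _) hz.2)
  linarith [le_abs_self q.2]

theorem memLp_weightNorm (p : ℝ≥0) : MemLp weightNorm p neuronLaw := by
  have h : MemLp (fun x : ℝ => |x|) p (gaussianReal 0 1) := (memLp_id_gaussianReal p).abs
  have h1 : MemLp (fun v : ℝ × ℝ × ℝ => |v.1|) p neuronLaw :=
    h.comp_measurePreserving measurePreserving_fst
  have h2 : MemLp (fun v : ℝ × ℝ × ℝ => |v.2.1|) p neuronLaw :=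
    (h.comp_measurePreserving (measurePreserving_fst (ν := gaussianReal 0 1))).comp_measurePreserving
      measurePreserving_snd
  have h3 : MemLp (fun v : ℝ × ℝ × ℝ => |v.2.2|) p neuronLaw :=
    (h.comp_measurePreserving (measurePreserving_snd (μ := gaussianReal 0 1))).comp_measurePreserving
      measurePreserving_snd
  exact (h1.add h2).add h3

theorem memLp_weightNorm_sq : MemLp (fun v => weightNorm v ^ 2) 2 neuronLaw := by
  have h := (memLp_weightNorm 4).norm_rpow_div (q := 2)
  have e : ((4 : ℝ≥0) : ℝ≥0∞) / 2 = 2 := by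
    rw [show (2 : ℝ≥0∞) = ((2 : ℝ≥0) : ℝ≥0∞) by norm_num, ← ENNReal.coe_div (by norm_num)]
    norm_num
  rw [e] at h
  convert h using 2 with v
  rw [Real.norm_eq_abs, abs_of_nonneg (weightNorm_nonneg v)]
  norm_num

theorem integrable_act_mul_act {z z' : ℝ} (hz : z ∈ Icc (0 : ℝ) 1) (hz' : z' ∈ Icc (0 : ℝ) 1) :
    Integrable (fun q => act z q * act z' q) innerLaw := by
  have h : MemLp (fun x : ℝ => |x|) 2 (gaussianReal 0 1) := (memLp_id_gaussianReal 2).abs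
  have h2 : MemLp (fun q : ℝ × ℝ => |q.1| + |q.2|) 2 innerLaw :=
    (h.comp_measurePreserving measurePreserving_fst).add
      (h.comp_measurePreserving measurePreserving_snd)
  refine h2.integrable_sq.mono' ((measurable_act z).mul (measurable_act z')).aestronglyMeasurable
    (Filter.Eventually.of_forall fun q => ?_)
  rw [Real.norm_eq_abs, abs_of_nonneg (mul_nonneg (act_nonneg _ _) (act_nonneg _ _)), sq]
  exact mul_le_mul (act_le hz q) (act_le hz' q) (act_nonneg _ _) (by positivity)

theorem integrable_gate_mul_gate (z z' : ℝ) :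
    Integrable (fun q => gate z q * gate z' q) innerLaw := by
  refine (integrable_const (1 : ℝ)).mono'
    ((measurable_gate z).mul (measurable_gate z')).aestronglyMeasurable
    (Filter.Eventually.of_forall fun q => ?_)
  rw [Real.norm_eq_abs, abs_of_nonneg (mul_nonneg (gate_nonneg _ _) (gate_nonneg _ _))]
  exact mul_le_one₀ (gate_le_one _ _) (gate_nonneg _ _) (gate_le_one _ _)

/-- The contribution of a neuron and its mirror image to the tangent kernel at initialization. -/
def neuronKernel (z z' : ℝ) (v : ℝ × ℝ × ℝ) : ℝ :=
  2 * (act z v.2 * act z' v.2) + 2 * (z * z' + 1) * (v.1 ^ 2 * (gate z v.2 * gate z' v.2))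

theorem measurable_neuronKernel (z z' : ℝ) : Measurable (neuronKernel z z') := by
  have h1 := measurable_gate z
  have h2 := measurable_gate z'
  have h3 := measurable_act z
  have h4 := measurable_act z'
  unfold neuronKernel
  fun_prop

theorem ntk_eq {z z' : ℝ} (hz : z ∈ Icc (0 : ℝ) 1) (hz' : z' ∈ Icc (0 : ℝ) 1) :
    ntk z z' = 2 * ∫ q, act z q * act z' q ∂innerLaw +
      2 * (z * z' + 1) * ∫ q, gate z q * gate z' q ∂innerLaw + 1 := by
  have := Real.pi_pos
  rw [integral_act_mul_act hz.1 hz'.1, integral_gate_mul_gate hz.1 hz'.1, ntk]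
  field_simp
  ring

theorem integral_neuronKernel {z z' : ℝ} (hz : z ∈ Icc (0 : ℝ) 1) (hz' : z' ∈ Icc (0 : ℝ) 1) :
    ∫ v, neuronKernel z z' v ∂neuronLaw = ntk z z' - 1 := by
  have h1 : ∫ v : ℝ × ℝ × ℝ, act z v.2 * act z' v.2 ∂neuronLaw =
      ∫ q, act z q * act z' q ∂innerLaw := by
    have := integral_prod_mul (μ := gaussianReal 0 1) (ν := innerLaw) (fun _ : ℝ => (1 : ℝ))
      (fun q => act z q * act z' q)
    simpa using this
  have hsq : ∫ x : ℝ, x ^ 2 ∂(gaussianReal 0 1) = 1 := by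
    have h := variance_fun_id_gaussianReal (μ := 0) (v := 1)
    rw [variance_eq_integral measurable_id'.aemeasurable] at h
    simpa using h
  have h2 : ∫ v : ℝ × ℝ × ℝ, v.1 ^ 2 * (gate z v.2 * gate z' v.2) ∂neuronLaw =
      ∫ q, gate z q * gate z' q ∂innerLaw := by
    have := integral_prod_mul (μ := gaussianReal 0 1) (ν := innerLaw) (fun x : ℝ => x ^ 2)
      (fun q => gate z q * gate z' q)
    rw [this, hsq, one_mul]
  have i1 : Integrable (fun v : ℝ × ℝ × ℝ => act z v.2 * act z' v.2) neuronLaw :=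
    (measurePreserving_snd (μ := gaussianReal 0 1) (ν := innerLaw)).integrable_comp_of_integrable
      (integrable_act_mul_act hz hz')
  have i2 : Integrable (fun v : ℝ × ℝ × ℝ => v.1 ^ 2 * (gate z v.2 * gate z' v.2)) neuronLaw :=
    ((memLp_id_gaussianReal (μ := 0) (v := 1) 2).integrable_sq).mul_prod
      (integrable_gate_mul_gate z z')
  unfold neuronKernel
  rw [integral_add (i1.const_mul _) (i2.const_mul _), integral_const_mul, integral_const_mul, h1,
    h2, ntk_eq hz hz']
  ring

theorem integral_sq_sum {ι : Type*} [Fintype ι] (α : ι → ℝ) (f : ι → ℝ × ℝ → ℝ)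
    (hf : ∀ i j, Integrable (fun q => f i q * f j q) innerLaw) :
    ∫ q, (∑ i, α i * f i q) ^ 2 ∂innerLaw =
      ∑ i, ∑ j, α i * α j * ∫ q, f i q * f j q ∂innerLaw := by
  have : ∀ q, (∑ i, α i * f i q) ^ 2 = ∑ i, ∑ j, α i * α j * (f i q * f j q) := by
    intro q
    rw [sq, Finset.sum_mul_sum]
    refine Finset.sum_congr rfl fun i _ => Finset.sum_congr rfl fun j _ => by ring
  simp only [this]
  rw [integral_finsetSum _ fun i _ => integrable_finsetSum _ fun j _ => (hf i j).const_mul _]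
  refine Finset.sum_congr rfl fun i _ => ?_
  rw [integral_finsetSum _ fun j _ => (hf i j).const_mul _]
  exact Finset.sum_congr rfl fun j _ => integral_const_mul _ _

/-- The quadratic form of the tangent kernel dominates the one of the gates. -/
theorem integral_sq_gates_le {n : ℕ} (z α : Fin n → ℝ) (hz : ∀ i, z i ∈ Icc (0 : ℝ) 1) :
    2 * ∫ q, (∑ i, α i * gate (z i) q) ^ 2 ∂innerLaw ≤
      ∑ i, ∑ j, α i * α j * ntk (z i) (z j) := by
  have hg : ∀ i j, Integrable (fun q => gate (z i) q * gate (z j) q) innerLaw :=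
    fun i j => integrable_gate_mul_gate _ _
  have e1 := integral_sq_sum α (fun i => gate (z i)) hg
  have e2 := integral_sq_sum (fun i => α i * z i) (fun i => gate (z i)) hg
  have e3 := integral_sq_sum α (fun i => act (z i)) fun i j => integrable_act_mul_act (hz i) (hz j)
  have e4 : (∑ i, α i) ^ 2 = ∑ i, ∑ j, α i * α j := by rw [sq, Finset.sum_mul_sum]
  have p2 : 0 ≤ ∫ q, (∑ i, α i * z i * gate (z i) q) ^ 2 ∂innerLaw :=
    integral_nonneg fun q => sq_nonneg _
  have p3 : 0 ≤ ∫ q, (∑ i, α i * act (z i) q) ^ 2 ∂innerLaw :=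
    integral_nonneg fun q => sq_nonneg _
  have p4 := sq_nonneg (∑ i, α i)
  -- The kernel is a sum of four Gram kernels: activations, gates, gates weighted by the inputs, and
  -- the constant from the outer bias. All but the gates are discarded.
  have e : ∑ i, ∑ j, α i * α j * ntk (z i) (z j) =
      2 * (∑ i, ∑ j, α i * α j * ∫ q, act (z i) q * act (z j) q ∂innerLaw) +
      2 * (∑ i, ∑ j, α i * α j * ∫ q, gate (z i) q * gate (z j) q ∂innerLaw) +
      2 * (∑ i, ∑ j, α i * z i * (α j * z j) * ∫ q, gate (z i) q * gate (z j) q ∂innerLaw) +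
      ∑ i, ∑ j, α i * α j := by
    simp only [Finset.mul_sum, ← Finset.sum_add_distrib]
    refine Finset.sum_congr rfl fun i _ => Finset.sum_congr rfl fun j _ => ?_
    rw [ntk_eq (hz i) (hz j)]; ring
  rw [e, ← e1, ← e2, ← e3, ← e4]
  linarith

/-! ### The smallest eigenvalue of the tangent kernel at the data points -/

/-- Each entry is a difference of two consecutive partial sums. -/
theorem sum_sq_le_four_mul_sum_sq_partialSums (a : ℕ → ℝ) (n : ℕ) :
    ∑ k ∈ Finset.range n, a k ^ 2 ≤
      4 * ∑ k ∈ Finset.range n, (∑ j ∈ Finset.range (k + 1), a j) ^ 2 := by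
  set P : ℕ → ℝ := fun k => ∑ j ∈ Finset.range k, a j with hP
  have h1 : ∀ k, a k ^ 2 ≤ 2 * P (k + 1) ^ 2 + 2 * P k ^ 2 := by
    intro k
    have : a k = P (k + 1) - P k := by
      rw [eq_sub_iff_add_eq']; exact (Finset.sum_range_succ _ _).symm
    rw [this]
    nlinarith [sq_nonneg (P (k + 1) + P k)]
  have h2 : ∑ k ∈ Finset.range n, P k ^ 2 ≤ ∑ k ∈ Finset.range n, P (k + 1) ^ 2 := by
    have e1 := Finset.sum_range_succ (fun k => P k ^ 2) n
    have e2 := Finset.sum_range_succ' (fun k => P k ^ 2) n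
    have e3 : P 0 = 0 := by simp [hP]
    rw [e3] at e2
    nlinarith [sq_nonneg (P n)]
  calc ∑ k ∈ Finset.range n, a k ^ 2
      ≤ ∑ k ∈ Finset.range n, (2 * P (k + 1) ^ 2 + 2 * P k ^ 2) :=
        Finset.sum_le_sum fun k _ => h1 k
    _ = 2 * ∑ k ∈ Finset.range n, P (k + 1) ^ 2 + 2 * ∑ k ∈ Finset.range n, P k ^ 2 := by
        rw [Finset.sum_add_distrib, Finset.mul_sum, Finset.mul_sum]
    _ ≤ _ := by linarith

theorem gate_eq_one_iff {z : ℝ} {q : ℝ × ℝ} : gate z q = 1 ↔ 0 < q.1 * z + q.2 := by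
  unfold gate; split_ifs with h <;> simp [h]

theorem gate_eq_zero_iff {z : ℝ} {q : ℝ × ℝ} : gate z q = 0 ↔ q.1 * z + q.2 ≤ 0 := by
  unfold gate; split_ifs with h
  · simp [h]
  · simpa using h

/-- The indicator of the event that a neuron is active exactly at the data points with index at
most `k` (for `k < n - 1`), or at all data points (for `k = n - 1`). -/
def cellIndicator (n k : ℕ) (q : ℝ × ℝ) : ℝ :=
  if k + 1 < n then gate (gridPoint n k) q * (1 - gate (gridPoint n (k + 1)) q)
  else gate (gridPoint n 0) q * gate (gridPoint n k) q

/-- The pre-activation is affine in the input. Being active at one grid point and inactive at the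
next forces a negative slope, so the sign pattern on the whole grid is determined; being active at
both ends forces activity everywhere. -/
theorem cellIndicator_eq_zero_or {n : ℕ} (hn : 2 ≤ n) {k : ℕ} (hk : k < n) (q : ℝ × ℝ) :
    cellIndicator n k q = 0 ∨ (cellIndicator n k q = 1 ∧
      ∀ j < n, gate (gridPoint n j) q = if j ≤ k then 1 else 0) := by
  unfold cellIndicator
  split_ifs with h
  · rcases gate_eq_zero_or_one (gridPoint n k) q with h1 | h1
    · left; rw [h1, zero_mul]
    rcases gate_eq_zero_or_one (gridPoint n (k + 1)) q with h2 | h2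
    swap
    · left; rw [h2, sub_self, mul_zero]
    right
    refine ⟨by rw [h1, h2]; norm_num, fun j hj => ?_⟩
    rw [gate_eq_one_iff] at h1
    rw [gate_eq_zero_iff] at h2
    have hlt : gridPoint n k ≤ gridPoint n (k + 1) := gridPoint_mono hn (Nat.le_succ k)
    have hw : q.1 < 0 := by
      by_contra hcon
      nlinarith [mul_le_mul_of_nonneg_left hlt (not_lt.1 hcon)]
    split_ifs with hjk
    · rw [gate_eq_one_iff]
      nlinarith [gridPoint_mono hn hjk]
    · rw [gate_eq_zero_iff]
      nlinarith [gridPoint_mono hn (show k + 1 ≤ j by omega)]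
  · rcases gate_eq_zero_or_one (gridPoint n 0) q with h1 | h1
    · left; rw [h1, zero_mul]
    rcases gate_eq_zero_or_one (gridPoint n k) q with h2 | h2
    · left; rw [h2, mul_zero]
    right
    refine ⟨by rw [h1, h2]; norm_num, fun j hj => ?_⟩
    rw [if_pos (by omega), gate_eq_one_iff]
    rw [gate_eq_one_iff] at h1 h2
    have e1 := gridPoint_mono hn (Nat.zero_le j)
    have e2 := gridPoint_mono hn (show j ≤ k by omega)
    rcases le_total 0 q.1 with hw | hw <;> nlinarith

/-- The events are disjoint, and on the k-th one the gate sum is exactly the k-th partial sum of the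
coefficients. -/
theorem sum_cellIndicator_mul_le {n : ℕ} (hn : 2 ≤ n) (a : ℕ → ℝ) (q : ℝ × ℝ) :
    ∑ k ∈ Finset.range n, cellIndicator n k q * (∑ j ∈ Finset.range (k + 1), a j) ^ 2 ≤
      (∑ j ∈ Finset.range n, a j * gate (gridPoint n j) q) ^ 2 := by
  by_cases hex : ∃ k < n, cellIndicator n k q ≠ 0
  · obtain ⟨k, hk, hk0⟩ := hex
    obtain ⟨hk1, hg⟩ := (cellIndicator_eq_zero_or hn hk q).resolve_left hk0
    rw [Finset.sum_eq_single_of_mem k (Finset.mem_range.2 hk)]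
    · rw [hk1, one_mul]
      apply le_of_eq
      congr 1
      rw [← Finset.sum_subset (Finset.range_subset_range.2 (show k + 1 ≤ n by omega))]
      · refine Finset.sum_congr rfl fun j hj => ?_
        have hj' := Finset.mem_range.1 hj
        rw [hg j (by omega), if_pos (by omega), mul_one]
      · intro j hj hj'
        rw [Finset.mem_range] at hj hj'
        rw [hg j hj, if_neg (by omega), mul_zero]
    · intro l hl hlk
      rw [Finset.mem_range] at hl
      rcases cellIndicator_eq_zero_or hn hl q with h | ⟨-, h⟩
      · rw [h, zero_mul]
      · exfalso
        have h1 := h k hk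
        have h2 := h l hl
        have h3 := hg k hk
        have h4 := hg l hl
        rw [if_pos le_rfl] at h2 h3
        rw [h3] at h1
        rw [h2] at h4
        split_ifs at h1 with h5
        split_ifs at h4 with h6
        · omega
        · norm_num at h4
        · norm_num at h1
  · push Not at hex
    rw [Finset.sum_eq_zero fun k hk => by rw [hex k (Finset.mem_range.1 hk), zero_mul]]
    positivity

theorem half_sub_le_arctan_sub {z z' : ℝ} (hz : 0 ≤ z) (hzz : z ≤ z') (hz' : z' ≤ 1) :
    (z' - z) / 2 ≤ Real.arctan z' - Real.arctan z := by
  have hmono : MonotoneOn (fun u => Real.arctan u - u / 2) (Icc 0 1) := by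
    have hd : ∀ x : ℝ, HasDerivAt (fun u => Real.arctan u - u / 2) (1 / (1 + x ^ 2) - 1 / 2) x :=
      fun x => (Real.hasDerivAt_arctan x).sub ((hasDerivAt_id x).div_const 2)
    refine monotoneOn_of_hasDerivWithinAt_nonneg (convex_Icc 0 1)
      (fun x _ => (hd x).continuousAt.continuousWithinAt)
      (fun x _ => (hd x).hasDerivWithinAt) fun x hx => ?_
    have := interior_subset hx
    rw [sub_nonneg]
    exact one_div_le_one_div_of_le (by positivity) (by nlinarith [this.1, this.2])
  have := hmono ⟨hz, hzz.trans hz'⟩ ⟨hz.trans hzz, hz'⟩ hzz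
  simp only at this
  linarith

theorem integrable_gate (z : ℝ) : Integrable (gate z) innerLaw :=
  (integrable_const (1 : ℝ)).mono' (measurable_gate z).aestronglyMeasurable
    (Filter.Eventually.of_forall fun q => by
      rw [Real.norm_eq_abs, abs_of_nonneg (gate_nonneg _ _)]; exact gate_le_one _ _)

theorem gate_mul_self (z : ℝ) (q : ℝ × ℝ) : gate z q * gate z q = gate z q := by
  rcases gate_eq_zero_or_one z q with h | h <;> rw [h] <;> norm_num

theorem integrable_cellIndicator (n k : ℕ) : Integrable (cellIndicator n k) innerLaw := by
  unfold cellIndicator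
  split_ifs
  · simp only [mul_sub, mul_one]
    exact (integrable_gate _).sub (integrable_gate_mul_gate _ _)
  · exact integrable_gate_mul_gate _ _

/-- The event of index k < n - 1 is a sector of angle arctan x_{k+1} - arctan x_k ≥ 1/(2(n - 1)),
and 4π ≤ 13. The last event has the fixed probability 3/8. -/
theorem le_integral_cellIndicator {n : ℕ} (hn : 2 ≤ n) {k : ℕ} (hk : k < n) :
    1 / (13 * (n : ℝ)) ≤ ∫ q, cellIndicator n k q ∂innerLaw := by
  have hp := cast_sub_one_pos hn
  have hpi := Real.pi_pos
  have hpi2 := Real.pi_lt_d2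
  have hm : ∀ j < n, gridPoint n j ∈ Icc (0 : ℝ) 1 := fun j hj => gridPoint_mem hn ⟨j, hj⟩
  have hn0 : (0 : ℝ) < n := by linarith
  unfold cellIndicator
  split_ifs with h
  · simp only [mul_sub, mul_one]
    rw [integral_sub (integrable_gate _) (integrable_gate_mul_gate _ _)]
    have e : ∫ q, gate (gridPoint n k) q ∂innerLaw =
        ∫ q, gate (gridPoint n k) q * gate (gridPoint n k) q ∂innerLaw := by
      simp only [gate_mul_self]
    have hle := gridPoint_mono hn (show k ≤ k + 1 by omega)
    rw [e, integral_gate_mul_gate (hm k hk).1 (hm k hk).1,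
      integral_gate_mul_gate (hm k hk).1 (hm _ h).1, abs_arctan_sub_of_ge hle]
    have := half_sub_le_arctan_sub (hm k hk).1 hle (hm _ h).2
    rw [gridPoint_succ_sub] at this
    have h2 : 1 / (n : ℝ) ≤ 1 / ((n : ℝ) - 1) := one_div_le_one_div_of_le hp (by linarith)
    rw [sub_self, abs_zero, sub_zero, div_sub_div_same, le_div_iff₀ (by positivity)]
    have h3 : 1 / (13 * (n : ℝ)) * (2 * Real.pi) = 1 / (n : ℝ) * (2 * Real.pi / 13) := by
      field_simp
    have h4 : 1 / (n : ℝ) * (2 * Real.pi / 13) ≤ 1 / (n : ℝ) * (1 / 2) :=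
      mul_le_mul_of_nonneg_left (by linarith) (by positivity)
    rw [h3]
    linarith
  · have hk' : k = n - 1 := by omega
    rw [hk', gridPoint_zero, gridPoint_last hn, integral_gate_mul_gate le_rfl zero_le_one,
      Real.arctan_zero, Real.arctan_one, zero_sub, abs_neg, abs_of_pos (by positivity)]
    have : (Real.pi - Real.pi / 4) / (2 * Real.pi) = 3 / 8 := by field_simp; norm_num
    have h2 : (2 : ℝ) ≤ n := by exact_mod_cast hn
    rw [this, div_le_div_iff₀ (by positivity) (by norm_num)]
    linarith

/-- The smallest eigenvalue of the tangent kernel matrix is at least of order `1 / n`. -/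
theorem le_quadraticForm_ntk {n : ℕ} (hn : 2 ≤ n) (α : Fin n → ℝ) :
    1 / (26 * (n : ℝ)) * ∑ i, α i ^ 2 ≤
      ∑ i : Fin n, ∑ j : Fin n, α i * α j * ntk (gridPoint n i) (gridPoint n j) := by
  refine le_trans ?_ (integral_sq_gates_le (fun i : Fin n => gridPoint n i) α
    fun i => gridPoint_mem hn i)
  let a : ℕ → ℝ := fun j => if h : j < n then α ⟨j, h⟩ else 0
  have ha : ∀ i : Fin n, α i = a i := fun i => by simp [a]
  have h1 : ∀ q, ∑ i : Fin n, α i * gate (gridPoint n i) q =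
      ∑ j ∈ Finset.range n, a j * gate (gridPoint n j) q := fun q => by
    rw [← Fin.sum_univ_eq_sum_range (fun j => a j * gate (gridPoint n j) q)]
    exact Finset.sum_congr rfl fun i _ => by rw [ha]
  have h2 : ∑ i, α i ^ 2 = ∑ j ∈ Finset.range n, a j ^ 2 := by
    rw [← Fin.sum_univ_eq_sum_range (fun j => a j ^ 2)]
    exact Finset.sum_congr rfl fun i _ => by rw [ha]
  simp only [h1]
  rw [h2]
  have h3 := sum_sq_le_four_mul_sum_sq_partialSums a n
  have hint : ∀ k ∈ Finset.range n, Integrable (fun q => cellIndicator n k q *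
      (∑ j ∈ Finset.range (k + 1), a j) ^ 2) innerLaw :=
    fun k _ => (integrable_cellIndicator n k).mul_const _
  have hint2 : Integrable (fun q => (∑ j ∈ Finset.range n, a j * gate (gridPoint n j) q) ^ 2)
      innerLaw := by
    have : ∀ q, (∑ j ∈ Finset.range n, a j * gate (gridPoint n j) q) ^ 2 =
        ∑ i ∈ Finset.range n, ∑ j ∈ Finset.range n,
          a i * a j * (gate (gridPoint n i) q * gate (gridPoint n j) q) := by
      intro q
      rw [sq, Finset.sum_mul_sum]
      refine Finset.sum_congr rfl fun i _ => Finset.sum_congr rfl fun j _ => by ring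
    simp only [this]
    exact integrable_finsetSum _ fun i _ => integrable_finsetSum _ fun j _ =>
      (integrable_gate_mul_gate _ _).const_mul _
  have h4 : ∑ k ∈ Finset.range n, 1 / (13 * (n : ℝ)) * (∑ j ∈ Finset.range (k + 1), a j) ^ 2 ≤
      ∫ q, (∑ j ∈ Finset.range n, a j * gate (gridPoint n j) q) ^ 2 ∂innerLaw := by
    refine le_trans ?_ (integral_mono (integrable_finsetSum _ hint) hint2
      fun q => sum_cellIndicator_mul_le hn a q)
    rw [integral_finsetSum _ hint]
    refine Finset.sum_le_sum fun k hk => ?_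
    rw [integral_mul_const]
    exact mul_le_mul_of_nonneg_right (le_integral_cellIndicator hn (Finset.mem_range.1 hk))
      (sq_nonneg _)
  rw [← Finset.mul_sum] at h4
  have h5 : 1 / (26 * (n : ℝ)) * ∑ k ∈ Finset.range n, a k ^ 2 ≤ 1 / (26 * (n : ℝ)) * (4 *
      ∑ k ∈ Finset.range n, (∑ j ∈ Finset.range (k + 1), a j) ^ 2) := by gcongr
  -- The constant is 2 · 1/(13 n) · 1/4 = 1/(26 n).
  refine h5.trans (le_trans (le_of_eq ?_) (mul_le_mul_of_nonneg_left h4 zero_le_two))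
  field_simp
  ring

/-! ### Absolutely continuous functions -/

theorem ac_le_of_ae_deriv_nonpos {f : ℝ → ℝ} {T : ℝ} (hT : 0 ≤ T)
    (hf : AbsolutelyContinuousOnInterval f 0 T)
    (h : ∀ᵐ t ∂(volume.restrict (Ioi (0 : ℝ))), t < T → deriv f t ≤ 0) : f T ≤ f 0 := by
  rw [← sub_nonpos, ← hf.integral_deriv_eq_sub, intervalIntegral.integral_of_le hT,
    integral_Ioc_eq_integral_Ioo]
  refine setIntegral_nonpos_ae measurableSet_Ioo ?_
  rw [ae_restrict_iff' measurableSet_Ioi] at h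
  filter_upwards [h] with t ht hmem
  exact ht hmem.1 hmem.2

theorem ac_of_contDiff {f : ℝ → ℝ} (hf : ContDiff ℝ 1 f) (a b : ℝ) :
    AbsolutelyContinuousOnInterval f a b := hf.contDiffOn.absolutelyContinuousOnInterval

/-- An exponentially decaying speed has total displacement at most C/c; f and -f are compared with a
primitive of the bound. This turns loss decay into a bound on the motion of the weights that is
uniform in time. -/
theorem ac_abs_sub_le_of_ae_abs_deriv_le {f : ℝ → ℝ} {T C c : ℝ} (hT : 0 ≤ T) (hC : 0 ≤ C)
    (hc : 0 < c) (hf : AbsolutelyContinuousOnInterval f 0 T)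
    (h : ∀ᵐ t ∂(volume.restrict (Ioi (0 : ℝ))), t < T →
      ∃ d, HasDerivAt f d t ∧ |d| ≤ C * Real.exp (-(c * t))) :
    |f T - f 0| ≤ C / c := by
  let g : ℝ → ℝ := fun t => -(C / c) * Real.exp (-(c * t))
  have hg : ∀ t, HasDerivAt g (C * Real.exp (-(c * t))) t := fun t => by
    have h1 : HasDerivAt (fun t => -(c * t)) (-(c * 1)) t := ((hasDerivAt_id t).const_mul c).neg
    refine (h1.exp.const_mul (-(C / c))).congr_deriv ?_
    field_simp
  have hgac : AbsolutelyContinuousOnInterval g 0 T := ac_of_contDiff (by fun_prop) _ _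
  have hg0 : g T - g 0 ≤ C / c := by
    simp only [g, mul_zero, neg_zero, Real.exp_zero, mul_one]
    have : 0 ≤ C / c * Real.exp (-(c * T)) := by positivity
    linarith
  have h1 : (f - g) T ≤ (f - g) 0 := by
    refine ac_le_of_ae_deriv_nonpos hT (hf.sub hgac) ?_
    filter_upwards [h] with t ht htT
    obtain ⟨d, hd, hle⟩ := ht htT
    rw [(hd.sub (hg t)).deriv]
    linarith [(abs_le.1 hle).2]
  have h2 : (-f - g) T ≤ (-f - g) 0 := by
    refine ac_le_of_ae_deriv_nonpos hT (hf.neg.sub hgac) ?_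
    filter_upwards [h] with t ht htT
    obtain ⟨d, hd, hle⟩ := ht htT
    rw [(hd.neg.sub (hg t)).deriv]
    linarith [(abs_le.1 hle).1]
  simp only [Pi.sub_apply, Pi.neg_apply] at h1 h2
  rw [abs_le]
  constructor <;> linarith

theorem ac_finsetSum {ι : Type*} (s : Finset ι) {f : ι → ℝ → ℝ} {a b : ℝ}
    (hf : ∀ i ∈ s, AbsolutelyContinuousOnInterval (f i) a b) :
    AbsolutelyContinuousOnInterval (fun t => ∑ i ∈ s, f i t) a b := by
  classical
  induction s using Finset.induction_on with
  | empty => simpa using ac_of_contDiff contDiff_const a b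
  | insert i s hi ih =>
    simp only [Finset.sum_insert hi]
    exact (hf i (Finset.mem_insert_self i s)).add
      (ih fun j hj => hf j (Finset.mem_insert_of_mem hj))

theorem ac_relu {f : ℝ → ℝ} {a b : ℝ} (hf : AbsolutelyContinuousOnInterval f a b) :
    AbsolutelyContinuousOnInterval (fun t => max (f t) 0) a b := by
  rw [absolutelyContinuousOnInterval_iff] at hf ⊢
  intro ε hε
  obtain ⟨δ, hδ, h⟩ := hf ε hε
  refine ⟨δ, hδ, fun E hE hlt => lt_of_le_of_lt (Finset.sum_le_sum fun i _ => ?_) (h E hE hlt)⟩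
  rw [Real.dist_eq, Real.dist_eq]
  exact abs_max_sub_max_le_abs _ _ _

/-- The chain rule for ReLU, at points where the composition is differentiable. -/
theorem hasDerivAt_relu_comp {f : ℝ → ℝ} {f' t s : ℝ} (hf : HasDerivAt f f' t)
    (hd : DifferentiableAt ℝ (fun u => max (f u) 0) t) (hs : s ∈ reluSubdiff (f t)) :
    HasDerivAt (fun u => max (f u) 0) (s * f') t := by
  obtain ⟨-, -, hs1, hs0⟩ := hs
  rcases lt_trichotomy (f t) 0 with h | h | h
  · rw [hs0 h, zero_mul]
    refine (hasDerivAt_const t (0 : ℝ)).congr_of_eventuallyEq ?_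
    filter_upwards [hf.continuousAt.eventually_lt_const h] with u hu
    exact max_eq_right hu.le
  -- At a zero of f, both max(f, 0) and max(f, 0) - f attain their minimum 0. Differentiability then
  -- forces f' = 0, so every slope gives the correct derivative.
  · have h1 : HasDerivAt (fun u => max (f u) 0) 0 t := by
      have hmin : IsLocalMin (fun u => max (f u) 0) t :=
        Filter.Eventually.of_forall fun u => by simp [h]
      have := hd.hasDerivAt
      rwa [hmin.deriv_eq_zero] at this
    have h2 : HasDerivAt (fun u => max (f u) 0 - f u) (0 - f') t := h1.sub hf
    have hmin : IsLocalMin (fun u => max (f u) 0 - f u) t :=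
      Filter.Eventually.of_forall fun u => by simp [h]
    have h3 : f' = 0 := by
      have := hmin.hasDerivAt_eq_zero h2
      linarith
    rwa [h3, mul_zero]
  · rw [hs1 h, one_mul]
    refine hf.congr_of_eventuallyEq ?_
    filter_upwards [hf.continuousAt.eventually_const_lt h] with u hu
    exact max_eq_left hu.le

/-! ### The tangent kernel of a finite network -/

/-- The inner product of the gradients of the network output at two inputs, for given slopes of
the activations. -/
def tangentKernel {m : ℕ} (θ : Params m) (x : ℝ) (s : Neuron m → ℝ) (x' : ℝ)
    (s' : Neuron m → ℝ) : ℝ :=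
  1 / (m : ℝ) * ∑ r, (max (preact θ r x) 0 * max (preact θ r x') 0 +
    θ.a r ^ 2 * (s r * s' r) * (x * x' + 1)) + 1

/-- The residual at the `i`-th data point. -/
def residual {m n : ℕ} (y : Fin n → ℝ) (θ : Params m) (i : Fin n) : ℝ :=
  net θ (gridPoint n i) - y i

theorem sqrt_two_div_mul_self (m : ℕ) : √(2 / (2 * (m : ℝ))) * √(2 / (2 * (m : ℝ))) = 1 / m := by
  rw [Real.mul_self_sqrt (by positivity)]
  exact mul_div_mul_left 1 (m : ℝ) two_ne_zero |>.symm ▸ by norm_num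

/-- The velocity of the output at x is the pairing of the output gradient at x with minus the loss
gradient. The input x need not be a data point, which is what later gives uniform control on [0, 1].
-/
theorem hasDerivAt_net {m n : ℕ} {y : Fin n → ℝ} {θ : ℝ → Params m} {t : ℝ}
    {s : Fin n → Neuron m → ℝ}
    (ha : ∀ r, HasDerivAt (fun u => (θ u).a r) (-(lossGrad y (θ t) s).a r) t)
    (hw : ∀ r, HasDerivAt (fun u => (θ u).w r) (-(lossGrad y (θ t) s).w r) t)
    (hb : ∀ r, HasDerivAt (fun u => (θ u).b r) (-(lossGrad y (θ t) s).b r) t)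
    (hc : HasDerivAt (fun u => (θ u).c) (-(lossGrad y (θ t) s).c) t) {x : ℝ}
    (hd : ∀ r, DifferentiableAt ℝ (fun u => max (preact (θ u) r x) 0) t)
    {sx : Neuron m → ℝ} (hsx : ∀ r, sx r ∈ reluSubdiff (preact (θ t) r x)) :
    HasDerivAt (fun u => net (θ u) x)
      (-(1 / (n : ℝ) * ∑ j : Fin n, tangentKernel (θ t) x sx (gridPoint n j) (s j) *
        residual y (θ t) j)) t := by
  have hp : ∀ r, HasDerivAt (fun u => preact (θ u) r x)
      (-(lossGrad y (θ t) s).w r * x + -(lossGrad y (θ t) s).b r) t := fun r =>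
    ((hw r).mul_const x).add (hb r)
  have hact := fun r => hasDerivAt_relu_comp (hp r) (hd r) (hsx r)
  refine (((HasDerivAt.fun_sum fun r (_ : r ∈ Finset.univ) => (ha r).fun_mul (hact r)).const_mul
    (√(2 / (2 * (m : ℝ))))).fun_add hc).congr_deriv ?_
  have hk := sqrt_two_div_mul_self m
  set κ := √(2 / (2 * (m : ℝ))) with hκ
  simp only [tangentKernel, lossGrad, netGrad, ← hκ, residual]
  have key : ∀ r : Neuron m,
      -(1 / (n : ℝ) * ∑ i : Fin n, κ * max (preact (θ t) r (gridPoint n i)) 0 *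
          (net (θ t) (gridPoint n i) - y i)) * max (preact (θ t) r x) 0 +
        (θ t).a r * (sx r * (-(1 / (n : ℝ) * ∑ i : Fin n, κ * ((θ t).a r * s i r *
          gridPoint n i) * (net (θ t) (gridPoint n i) - y i)) * x +
          -(1 / (n : ℝ) * ∑ i : Fin n, κ * ((θ t).a r * s i r) *
            (net (θ t) (gridPoint n i) - y i)))) =
      ∑ i : Fin n, -(1 / (n : ℝ)) * κ * ((max (preact (θ t) r x) 0 *
        max (preact (θ t) r (gridPoint n i)) 0 +
        (θ t).a r ^ 2 * (sx r * s i r) * (x * gridPoint n i + 1)) *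
          (net (θ t) (gridPoint n i) - y i)) := by
    intro r
    simp only [Finset.mul_sum, Finset.sum_mul, ← Finset.sum_neg_distrib, ← Finset.sum_add_distrib]
    exact Finset.sum_congr rfl fun i _ => by ring
  simp only [key]
  rw [Finset.sum_comm, Finset.mul_sum, Finset.mul_sum, Finset.mul_sum, ← Finset.sum_neg_distrib,
    ← Finset.sum_neg_distrib, ← Finset.sum_add_distrib]
  refine Finset.sum_congr rfl fun i _ => ?_
  rw [← hk, ← Finset.mul_sum, ← Finset.sum_mul]
  ring

theorem IsGradientFlow.ac_preact {m n : ℕ} {y : Fin n → ℝ} {θ₀ : Params m} {θ : ℝ → Params m}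
    (h : IsGradientFlow y θ₀ θ) (r : Neuron m) (x : ℝ) {T : ℝ} (hT : 0 ≤ T) :
    AbsolutelyContinuousOnInterval (fun t => preact (θ t) r x) 0 T := by
  have h1 := ((h.ac_w r T hT).const_mul x).add (h.ac_b r T hT)
  refine (congrArg (fun f => AbsolutelyContinuousOnInterval f 0 T) ?_).mp h1
  funext t
  simp only [Pi.add_apply, preact]
  ring

theorem IsGradientFlow.ac_net {m n : ℕ} {y : Fin n → ℝ} {θ₀ : Params m} {θ : ℝ → Params m}
    (h : IsGradientFlow y θ₀ θ) (x : ℝ) {T : ℝ} (hT : 0 ≤ T) :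
    AbsolutelyContinuousOnInterval (fun t => net (θ t) x) 0 T :=
  ((ac_finsetSum Finset.univ fun r _ =>
    (h.ac_a r T hT).mul (ac_relu (h.ac_preact r x hT))).const_mul _).add (h.ac_c T hT)

theorem ae_differentiableAt_of_ac {f : ℝ → ℝ}
    (hf : ∀ T, 0 ≤ T → AbsolutelyContinuousOnInterval f 0 T) :
    ∀ᵐ t ∂(volume.restrict (Ioi (0 : ℝ))), DifferentiableAt ℝ f t := by
  rw [ae_restrict_iff' measurableSet_Ioi]
  have h : ∀ N : ℕ, ∀ᵐ t : ℝ, t ∈ uIcc (0 : ℝ) N → DifferentiableAt ℝ f t :=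
    fun N => (hf N (Nat.cast_nonneg N)).ae_differentiableAt
  filter_upwards [ae_all_iff.2 h] with t ht ht0
  obtain ⟨N, hN⟩ := exists_nat_ge t
  refine ht N ?_
  rw [uIcc_of_le (Nat.cast_nonneg N)]
  exact ⟨le_of_lt ht0, hN⟩

theorem IsGradientFlow.ae_differentiableAt_relu {m n : ℕ} {y : Fin n → ℝ} {θ₀ : Params m}
    {θ : ℝ → Params m} (h : IsGradientFlow y θ₀ θ) (x : ℝ) :
    ∀ᵐ t ∂(volume.restrict (Ioi (0 : ℝ))),
      ∀ r, DifferentiableAt ℝ (fun u => max (preact (θ u) r x) 0) t :=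
  ae_all_iff.2 fun r => ae_differentiableAt_of_ac fun _ hT => ac_relu (h.ac_preact r x hT)

/-! ### Gradient flow near the initialization -/

/-- The `ℓ¹` norm of the weights of the `r`-th neuron. -/
def neuronNorm {m : ℕ} (θ : Params m) (r : Neuron m) : ℝ := |θ.a r| + |θ.w r| + |θ.b r|

/-- Each weight of each neuron of `θ` differs from the one of `θ₀` by at most `δ` times the norm of
the neuron of `θ₀`. -/
def IsNear {m : ℕ} (δ : ℝ) (θ₀ θ : Params m) : Prop :=
  ∀ r, |θ.a r - θ₀.a r| ≤ δ * neuronNorm θ₀ r ∧ |θ.w r - θ₀.w r| ≤ δ * neuronNorm θ₀ r ∧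
    |θ.b r - θ₀.b r| ≤ δ * neuronNorm θ₀ r

/-- Near `θ₀`, the tangent kernel is within `η` of its limit. -/
def KernelStable {m : ℕ} (n : ℕ) (δ η : ℝ) (θ₀ : Params m) : Prop :=
  ∀ θ : Params m, IsNear δ θ₀ θ → ∀ x ∈ Icc (0 : ℝ) 1, ∀ (i : Fin n) (s s' : Neuron m → ℝ),
    (∀ r, s r ∈ reluSubdiff (preact θ r x)) →
    (∀ r, s' r ∈ reluSubdiff (preact θ r (gridPoint n i))) →
    |tangentKernel θ x s (gridPoint n i) s' - ntk x (gridPoint n i)| ≤ η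

/-- The sum of the squared residuals. -/
def sqLoss {m n : ℕ} (y : Fin n → ℝ) (θ : Params m) : ℝ := ∑ i, residual y θ i ^ 2

theorem sum_abs_sq_le {n : ℕ} (u : Fin n → ℝ) : (∑ i, |u i|) ^ 2 ≤ n * ∑ i, u i ^ 2 := by
  have := sq_sum_le_card_mul_sum_sq (s := Finset.univ) (f := fun i => |u i|)
  simpa using this

theorem mean_abs_le_sqrt {n : ℕ} (hn : 0 < n) (u : Fin n → ℝ) :
    1 / (n : ℝ) * ∑ i, |u i| ≤ √(∑ i, u i ^ 2) := by
  have h0 : (1 : ℝ) ≤ n := by exact_mod_cast hn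
  refine Real.le_sqrt_of_sq_le ?_
  have h1 := sum_abs_sq_le u
  have h2 : 0 ≤ ∑ i, u i ^ 2 := Finset.sum_nonneg fun _ _ => sq_nonneg _
  rw [mul_pow, div_pow, one_pow, div_mul_eq_mul_div, one_mul, div_le_iff₀ (by positivity)]
  nlinarith

/-- An entrywise perturbation η changes the quadratic form by at most η n Σ u_i², which for this η
is half of the spectral gap. -/
theorem le_quadraticForm_of_near {n : ℕ} (hn : 2 ≤ n) {η : ℝ} (hη : η ≤ 1 / (52 * (n : ℝ) ^ 2))
    {M : Fin n → Fin n → ℝ} (hM : ∀ i j, |M i j - ntk (gridPoint n i) (gridPoint n j)| ≤ η)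
    (u : Fin n → ℝ) :
    1 / (52 * (n : ℝ)) * ∑ i, u i ^ 2 ≤ ∑ i, u i * ∑ j, M i j * u j := by
  have hn0 : (0 : ℝ) < n := by positivity
  have h0 := le_quadraticForm_ntk hn u
  have h1 : ∑ i : Fin n, ∑ j : Fin n, u i * u j * ntk (gridPoint n i) (gridPoint n j) -
      ∑ i, u i * ∑ j, M i j * u j ≤ ∑ i : Fin n, ∑ j : Fin n, |u i| * |u j| * η := by
    simp only [Finset.mul_sum, ← Finset.sum_sub_distrib]
    refine Finset.sum_le_sum fun i _ => Finset.sum_le_sum fun j _ => ?_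
    have e : u i * u j * ntk (gridPoint n i) (gridPoint n j) - u i * (M i j * u j) =
        -(u i * u j * (M i j - ntk (gridPoint n i) (gridPoint n j))) := by ring
    rw [e]
    refine (neg_le_abs _).trans ?_
    rw [abs_mul, abs_mul]
    exact mul_le_mul_of_nonneg_left (hM i j) (by positivity)
  have h2 : ∑ i : Fin n, ∑ j : Fin n, |u i| * |u j| * η = η * (∑ i, |u i|) ^ 2 := by
    rw [sq, Finset.sum_mul_sum, Finset.mul_sum]
    refine Finset.sum_congr rfl fun i _ => ?_
    rw [Finset.mul_sum]
    exact Finset.sum_congr rfl fun j _ => by ring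
  have h3 := sum_abs_sq_le u
  have hs : 0 ≤ ∑ i, u i ^ 2 := Finset.sum_nonneg fun _ _ => sq_nonneg _
  have h4 : η * (∑ i, |u i|) ^ 2 ≤ 1 / (52 * (n : ℝ) ^ 2) * (n * ∑ i, u i ^ 2) :=
    mul_le_mul hη h3 (sq_nonneg _) (by positivity)
  have h5 : 1 / (52 * (n : ℝ) ^ 2) * (n * ∑ i, u i ^ 2) = 1 / (52 * (n : ℝ)) * ∑ i, u i ^ 2 := by
    field_simp
  have h6 : 1 / (26 * (n : ℝ)) * ∑ i, u i ^ 2 = 2 * (1 / (52 * (n : ℝ)) * ∑ i, u i ^ 2) := by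
    field_simp; ring
  linarith

section Flow

variable {m n : ℕ} {y : Fin n → ℝ} {θ₀ : Params m} {θ : ℝ → Params m}

theorem IsGradientFlow.ac_residual (h : IsGradientFlow y θ₀ θ) (i : Fin n) {T : ℝ} (hT : 0 ≤ T) :
    AbsolutelyContinuousOnInterval (fun t => residual y (θ t) i) 0 T :=
  (h.ac_net _ hT).sub (ac_of_contDiff contDiff_const _ _)

theorem IsGradientFlow.ac_sqLoss (h : IsGradientFlow y θ₀ θ) {T : ℝ} (hT : 0 ≤ T) :
    AbsolutelyContinuousOnInterval (fun t => sqLoss y (θ t)) 0 T := by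
  have := ac_finsetSum Finset.univ fun i (_ : i ∈ Finset.univ) =>
    (h.ac_residual i hT).mul (h.ac_residual i hT)
  simpa only [Pi.mul_apply, sqLoss, sq] using this

/-- At almost every time, the residuals and the output at one further input satisfy the ordinary
differential equation given by the tangent kernel. -/
theorem IsGradientFlow.ae_hasDerivAt (h : IsGradientFlow y θ₀ θ) (x : ℝ) :
    ∀ᵐ t ∂(volume.restrict (Ioi (0 : ℝ))), ∃ (s : Fin n → Neuron m → ℝ) (sx : Neuron m → ℝ),
      (∀ (i : Fin n) r, s i r ∈ reluSubdiff (preact (θ t) r (gridPoint n i))) ∧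
      (∀ r, sx r ∈ reluSubdiff (preact (θ t) r x)) ∧
      (∀ i, HasDerivAt (fun u => residual y (θ u) i) (-(1 / (n : ℝ) * ∑ j : Fin n,
        tangentKernel (θ t) (gridPoint n i) (s i) (gridPoint n j) (s j) *
          residual y (θ t) j)) t) ∧
      HasDerivAt (fun u => net (θ u) x) (-(1 / (n : ℝ) * ∑ j : Fin n,
        tangentKernel (θ t) x sx (gridPoint n j) (s j) * residual y (θ t) j)) t := by
  filter_upwards [h.flow, ae_all_iff.2 fun i : Fin n => h.ae_differentiableAt_relu (gridPoint n i),
    h.ae_differentiableAt_relu x] with t ht hd hdx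
  obtain ⟨s, hs, ha, hw, hb, hc⟩ := ht
  have hsx : ∀ r, (if 0 < preact (θ t) r x then (1 : ℝ) else 0) ∈
      reluSubdiff (preact (θ t) r x) := by
    intro r
    split_ifs with h0
    · exact ⟨zero_le_one, le_rfl, fun _ => rfl, fun h1 => absurd h0 h1.le.not_gt⟩
    · exact ⟨le_rfl, zero_le_one, fun h1 => absurd h1 h0, fun _ => rfl⟩
  exact ⟨s, _, hs, hsx, fun i => (hasDerivAt_net ha hw hb hc (hd i) (hs i)).sub_const _,
    hasDerivAt_net ha hw hb hc hdx hsx⟩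

/-- The derivative of the loss is -(2/n) times the kernel quadratic form, so the rate is (2/n) ·
1/(52 n) = 1/(26 n²). -/
theorem IsGradientFlow.sqLoss_le (h : IsGradientFlow y θ₀ θ) (hn : 2 ≤ n) {δ η : ℝ}
    (hK : KernelStable n δ η θ₀) (hη : η ≤ 1 / (52 * (n : ℝ) ^ 2)) {T : ℝ} (hT : 0 ≤ T)
    (hnear : ∀ t, 0 < t → t < T → IsNear δ θ₀ (θ t)) :
    sqLoss y (θ T) ≤ sqLoss y (θ 0) * Real.exp (-(1 / (26 * (n : ℝ) ^ 2) * T)) := by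
  have hn0 : (0 : ℝ) < n := by positivity
  set c := 1 / (26 * (n : ℝ) ^ 2) with hc
  have hac := (h.ac_sqLoss hT).mul
    (ac_of_contDiff (f := fun t => Real.exp (c * t)) (by fun_prop) 0 T)
  have hle := ac_le_of_ae_deriv_nonpos hT hac ?_
  · simp only [Pi.mul_apply, mul_zero, Real.exp_zero, mul_one] at hle
    rw [Real.exp_neg, ← div_eq_mul_inv, le_div_iff₀ (Real.exp_pos _)]
    exact hle
  filter_upwards [h.ae_hasDerivAt 0, ae_restrict_mem measurableSet_Ioi] with t ht ht0 htT
  obtain ⟨s, -, hs, -, hres, -⟩ := ht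
  have hq := le_quadraticForm_of_near hn hη (fun i j =>
    hK _ (hnear t ht0 htT) _ (gridPoint_mem hn i) j (s i) (s j) (hs i) (hs j))
    (fun i => residual y (θ t) i)
  have hV : HasDerivAt (fun u => sqLoss y (θ u)) (-(2 / (n : ℝ)) * ∑ i, residual y (θ t) i *
      ∑ j : Fin n, tangentKernel (θ t) (gridPoint n i) (s i) (gridPoint n j) (s j) *
          residual y (θ t) j) t := by
    refine (HasDerivAt.fun_sum fun i (_ : i ∈ Finset.univ) => (hres i).pow 2).congr_deriv ?_
    rw [Finset.mul_sum]
    refine Finset.sum_congr rfl fun i _ => ?_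
    push_cast
    ring
  have hE : HasDerivAt (fun u => Real.exp (c * u)) (Real.exp (c * t) * (c * 1)) t :=
    ((hasDerivAt_id t).const_mul c).exp
  rw [(hV.mul hE).deriv]
  have hce : c = 2 / (n : ℝ) * (1 / (52 * (n : ℝ))) := by rw [hc]; field_simp; norm_num
  have h2 : sqLoss y (θ t) * c ≤ 2 / (n : ℝ) * ∑ i, residual y (θ t) i *
      ∑ j : Fin n, tangentKernel (θ t) (gridPoint n i) (s i) (gridPoint n j) (s j) *
          residual y (θ t) j := by
    rw [hce, mul_comm, mul_assoc]
    exact mul_le_mul_of_nonneg_left hq (by positivity)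
  have := Real.exp_pos (c * t)
  nlinarith

theorem abs_preact_le (θ : Params m) (r : Neuron m) {x : ℝ} (hx : x ∈ Icc (0 : ℝ) 1) :
    |preact θ r x| ≤ neuronNorm θ r := by
  refine (abs_add_le _ _).trans ?_
  rw [abs_mul, abs_of_nonneg hx.1]
  have := mul_le_of_le_one_right (abs_nonneg (θ.w r)) hx.2
  unfold neuronNorm
  linarith [abs_nonneg (θ.a r)]

/-- The gradient in the weights of a neuron is controlled by the norm of that same neuron.
Displacements can thus be measured relative to each neuron, and no bound on the largest initial
weight is needed. -/
theorem abs_lossGrad_le (hn : 2 ≤ n) (y : Fin n → ℝ) (θ : Params m) {s : Fin n → Neuron m → ℝ}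
    (hs : ∀ (i : Fin n) r, s i r ∈ reluSubdiff (preact θ r (gridPoint n i))) (r : Neuron m) :
    |(lossGrad y θ s).a r| ≤ √(2 / (2 * (m : ℝ))) * neuronNorm θ r * √(sqLoss y θ) ∧
    |(lossGrad y θ s).w r| ≤ √(2 / (2 * (m : ℝ))) * neuronNorm θ r * √(sqLoss y θ) ∧
    |(lossGrad y θ s).b r| ≤ √(2 / (2 * (m : ℝ))) * neuronNorm θ r * √(sqLoss y θ) := by
  set κ := √(2 / (2 * (m : ℝ))) with hκ
  have hκ0 : 0 ≤ κ := Real.sqrt_nonneg _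
  have hN : 0 ≤ neuronNorm θ r := by unfold neuronNorm; positivity
  have key : ∀ g : Fin n → ℝ, (∀ i, |g i| ≤ neuronNorm θ r) →
      |1 / (n : ℝ) * ∑ i : Fin n, κ * g i * (net θ (gridPoint n i) - y i)| ≤
        κ * neuronNorm θ r * √(sqLoss y θ) := by
    intro g hg
    rw [abs_mul, abs_of_nonneg (by positivity : (0 : ℝ) ≤ 1 / n)]
    calc 1 / (n : ℝ) * |∑ i : Fin n, κ * g i * (net θ (gridPoint n i) - y i)|
        ≤ 1 / (n : ℝ) * ∑ i : Fin n, κ * neuronNorm θ r * |residual y θ i| := by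
          refine mul_le_mul_of_nonneg_left ?_ (by positivity)
          refine (Finset.abs_sum_le_sum_abs _ _).trans (Finset.sum_le_sum fun i _ => ?_)
          rw [abs_mul, abs_mul, abs_of_nonneg hκ0]
          exact mul_le_mul_of_nonneg_right (mul_le_mul_of_nonneg_left (hg i) hκ0) (abs_nonneg _)
      _ = κ * neuronNorm θ r * (1 / (n : ℝ) * ∑ i : Fin n, |residual y θ i|) := by
          rw [← Finset.mul_sum]; ring
      _ ≤ _ := mul_le_mul_of_nonneg_left (mean_abs_le_sqrt (by omega) _) (by positivity)
  have ha : |θ.a r| ≤ neuronNorm θ r := by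
    unfold neuronNorm; linarith [abs_nonneg (θ.w r), abs_nonneg (θ.b r)]
  have hs1 : ∀ i, |θ.a r * s i r| ≤ neuronNorm θ r := fun i => by
    rw [abs_mul, abs_of_nonneg (hs i r).1]
    exact (mul_le_of_le_one_right (abs_nonneg _) (hs i r).2.1).trans ha
  refine ⟨key _ fun i => ?_, key _ fun i => ?_, key _ fun i => hs1 i⟩
  · rw [abs_of_nonneg (le_max_right _ _)]
    exact max_le ((le_abs_self _).trans (abs_preact_le θ r (gridPoint_mem hn i))) hN
  · rw [abs_mul, abs_of_nonneg (gridPoint_mem hn i).1]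
    exact (mul_le_of_le_one_right (abs_nonneg _) (gridPoint_mem hn i).2).trans (hs1 i)

/-- The speed of a neuron involves its current norm, so one compares with the maximum S of this norm
over [0, T]. The displacement of each weight is at most δS/2, and as δ ≤ 1/3 this gives S ≤ 2 ·
(initial norm), closing the estimate. -/
theorem IsGradientFlow.isNear_of_sqLoss_le (h : IsGradientFlow y θ₀ θ) (hn : 2 ≤ n) {W δ c : ℝ}
    (hc : 0 < c) (hδ : δ ≤ 1 / 3)
    (hm : √(2 / (2 * (m : ℝ))) * √(2 * W) * (2 / c) ≤ δ / 2) {T : ℝ} (hT : 0 ≤ T)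
    (hV : ∀ t, 0 < t → t < T → sqLoss y (θ t) ≤ 2 * W * Real.exp (-(c * t))) :
    IsNear δ θ₀ (θ T) := by
  intro r
  set κ := √(2 / (2 * (m : ℝ))) with hκ
  have hκ0 : 0 ≤ κ := Real.sqrt_nonneg _
  have hcont : ContinuousOn (fun t => neuronNorm (θ t) r) (Icc 0 T) := by
    have h1 := (h.ac_a r T hT).continuousOn
    have h2 := (h.ac_w r T hT).continuousOn
    have h3 := (h.ac_b r T hT).continuousOn
    rw [uIcc_of_le hT] at h1 h2 h3
    exact (h1.abs.add h2.abs).add h3.abs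
  obtain ⟨t₁, ht₁, hmax⟩ := isCompact_Icc.exists_isMaxOn (nonempty_Icc.2 hT) hcont
  set S := neuronNorm (θ t₁) r with hS
  have hS0 : 0 ≤ S := by rw [hS]; unfold neuronNorm; positivity
  have hb : ∀ t ∈ Icc 0 T, neuronNorm (θ t) r ≤ S := fun t ht => hmax ht
  have hc2 : 0 < c / 2 := by positivity
  have hC : 0 ≤ κ * S * √(2 * W) := by positivity
  have hgrad : ∀ t, 0 < t → t < T → ∀ s : Fin n → Neuron m → ℝ,
      (∀ (i : Fin n) r, s i r ∈ reluSubdiff (preact (θ t) r (gridPoint n i))) → ∀ g : ℝ,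
      |g| ≤ κ * neuronNorm (θ t) r * √(sqLoss y (θ t)) →
      |-g| ≤ κ * S * √(2 * W) * Real.exp (-(c / 2 * t)) := by
    intro t ht0 htT s hs g hg
    rw [abs_neg]
    refine hg.trans ?_
    have h1 : √(sqLoss y (θ t)) ≤ √(2 * W) * Real.exp (-(c / 2 * t)) := by
      have e : Real.exp (-(c * t)) = Real.exp (-(c / 2 * t)) ^ 2 := by
        rw [← Real.exp_nat_mul]; congr 1; push_cast; ring
      have := Real.sqrt_le_sqrt (hV t ht0 htT)
      rwa [e, Real.sqrt_mul' _ (sq_nonneg _), Real.sqrt_sq (Real.exp_pos _).le] at this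
    calc κ * neuronNorm (θ t) r * √(sqLoss y (θ t))
        ≤ κ * S * (√(2 * W) * Real.exp (-(c / 2 * t))) :=
          mul_le_mul (mul_le_mul_of_nonneg_left (hb t ⟨ht0.le, htT.le⟩) hκ0) h1
            (Real.sqrt_nonneg _) (by positivity)
      _ = _ := by ring
  have hbound : ∀ t ∈ Icc 0 T, |(θ t).a r - θ₀.a r| ≤ δ / 2 * S ∧
      |(θ t).w r - θ₀.w r| ≤ δ / 2 * S ∧ |(θ t).b r - θ₀.b r| ≤ δ / 2 * S := by
    intro t ht
    have hfin : κ * S * √(2 * W) / (c / 2) ≤ δ / 2 * S := by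
      have := mul_le_mul_of_nonneg_right hm hS0
      refine le_trans (le_of_eq ?_) this
      field_simp
    refine ⟨?_, ?_, ?_⟩
    · have := ac_abs_sub_le_of_ae_abs_deriv_le ht.1 hC hc2 (h.ac_a r t ht.1) (by
        filter_upwards [h.flow, ae_restrict_mem measurableSet_Ioi] with u hu hu0 hut
        obtain ⟨s, hs, ha, -⟩ := hu
        exact ⟨_, ha r, hgrad u hu0 (hut.trans_le ht.2) s hs _ (abs_lossGrad_le hn y _ hs r).1⟩)
      rw [h.init] at this
      exact this.trans hfin
    · have := ac_abs_sub_le_of_ae_abs_deriv_le ht.1 hC hc2 (h.ac_w r t ht.1) (by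
        filter_upwards [h.flow, ae_restrict_mem measurableSet_Ioi] with u hu hu0 hut
        obtain ⟨s, hs, -, hw, -⟩ := hu
        exact ⟨_, hw r, hgrad u hu0 (hut.trans_le ht.2) s hs _ (abs_lossGrad_le hn y _ hs r).2.1⟩)
      rw [h.init] at this
      exact this.trans hfin
    · have := ac_abs_sub_le_of_ae_abs_deriv_le ht.1 hC hc2 (h.ac_b r t ht.1) (by
        filter_upwards [h.flow, ae_restrict_mem measurableSet_Ioi] with u hu hu0 hut
        obtain ⟨s, hs, -, -, hb, -⟩ := hu
        exact ⟨_, hb r, hgrad u hu0 (hut.trans_le ht.2) s hs _ (abs_lossGrad_le hn y _ hs r).2.2⟩)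
      rw [h.init] at this
      exact this.trans hfin
  have hSle : S ≤ 2 * neuronNorm θ₀ r := by
    obtain ⟨h1, h2, h3⟩ := hbound t₁ ht₁
    have e1 := abs_sub_abs_le_abs_sub ((θ t₁).a r) (θ₀.a r)
    have e2 := abs_sub_abs_le_abs_sub ((θ t₁).w r) (θ₀.w r)
    have e3 := abs_sub_abs_le_abs_sub ((θ t₁).b r) (θ₀.b r)
    have e4 : S ≤ neuronNorm θ₀ r + 3 * (δ / 2 * S) := by
      rw [hS] at h1 h2 h3 ⊢
      unfold neuronNorm at *
      linarith
    nlinarith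
  have hδ0 : 0 ≤ δ / 2 := le_trans (by positivity) hm
  have hfin : δ / 2 * S ≤ δ * neuronNorm θ₀ r := by
    have := mul_le_mul_of_nonneg_left hSle hδ0
    linarith
  obtain ⟨h1, h2, h3⟩ := hbound T ⟨hT, le_rfl⟩
  exact ⟨h1.trans hfin, h2.trans hfin, h3.trans hfin⟩

/-- The network stays near its initialization, and the loss decays exponentially. -/
theorem IsGradientFlow.sqLoss_le_exp (h : IsGradientFlow y θ₀ θ) (hn : 2 ≤ n) {W δ η : ℝ}
    (hK : KernelStable n δ η θ₀) (hη : η ≤ 1 / (52 * (n : ℝ) ^ 2)) (hδ : δ ≤ 1 / 3)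
    (hW : 0 < W) (hW0 : sqLoss y θ₀ ≤ W)
    (hm : √(2 / (2 * (m : ℝ))) * √(2 * W) * (52 * (n : ℝ) ^ 2) ≤ δ / 2) {t : ℝ} (ht : 0 ≤ t) :
    IsNear δ θ₀ (θ t) ∧ sqLoss y (θ t) ≤ W * Real.exp (-(1 / (26 * (n : ℝ) ^ 2) * t)) := by
  have hn0 : (0 : ℝ) < n := by positivity
  set c := 1 / (26 * (n : ℝ) ^ 2) with hc
  have hc0 : 0 < c := by positivity
  have hm' : √(2 / (2 * (m : ℝ))) * √(2 * W) * (2 / c) ≤ δ / 2 := by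
    refine le_trans (le_of_eq ?_) hm
    rw [hc]; congr 1; field_simp; norm_num
  -- a bound on `[0, T)` by `2 W` improves to a bound by `W` at `T`
  have improve : ∀ T, 0 ≤ T →
      (∀ t, 0 < t → t < T → sqLoss y (θ t) ≤ 2 * W * Real.exp (-(c * t))) →
      IsNear δ θ₀ (θ T) ∧ sqLoss y (θ T) ≤ W * Real.exp (-(c * T)) := by
    intro T hT hV
    have hnear : ∀ t, 0 ≤ t → t ≤ T → IsNear δ θ₀ (θ t) := fun t ht0 htT =>
      h.isNear_of_sqLoss_le hn hc0 hδ hm' ht0 fun u hu0 hut => hV u hu0 (hut.trans_le htT)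
    refine ⟨hnear T hT le_rfl, ?_⟩
    refine (h.sqLoss_le hn hK hη hT fun t ht0 htT => hnear t ht0.le htT.le).trans ?_
    rw [h.init]
    exact mul_le_mul_of_nonneg_right hW0 (Real.exp_pos _).le
  suffices hall : ∀ t, 0 ≤ t → sqLoss y (θ t) ≤ 2 * W * Real.exp (-(c * t)) from
    improve t ht fun u hu0 _ => hall u hu0.le
  by_contra hcon
  push Not at hcon
  obtain ⟨t₁, ht₁, hgt⟩ := hcon
  -- Continuity argument: at the first time T when the bound with 2W is reached, the improved bound
  -- with W also holds, a contradiction.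
  set A := {s | s ∈ Icc 0 t₁ ∧ 2 * W * Real.exp (-(c * s)) ≤ sqLoss y (θ s)} with hA
  have hcontV : ContinuousOn (fun t => sqLoss y (θ t)) (Icc 0 t₁) := by
    have := (h.ac_sqLoss ht₁).continuousOn
    rwa [uIcc_of_le ht₁] at this
  have hAclosed : IsCompact A := by
    refine isCompact_Icc.of_isClosed_subset ?_ (fun s hs => hs.1)
    exact isClosed_Icc.isClosed_le (by fun_prop) hcontV
  obtain ⟨T, hTA, hTmin⟩ := hAclosed.exists_isLeast ⟨t₁, ⟨ht₁, le_rfl⟩, hgt.le⟩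
  have hlt : ∀ t, 0 < t → t < T → sqLoss y (θ t) ≤ 2 * W * Real.exp (-(c * t)) := by
    intro t ht0 htT
    by_contra hcon
    have := hTmin (show t ∈ A from ⟨⟨ht0.le, htT.le.trans hTA.1.2⟩, (not_le.1 hcon).le⟩)
    linarith
  have h1 := (improve T hTA.1.1 hlt).2
  have h2 := hTA.2
  have : 0 < W * Real.exp (-(c * T)) := by positivity
  linarith

theorem abs_sum_mul_residual_le (hn : 2 ≤ n) {η : ℝ} {g : Fin n → ℝ} (hη : ∀ i, |g i| ≤ η)
    (y : Fin n → ℝ) (θ : Params m) :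
    |1 / (n : ℝ) * ∑ j, g j * residual y θ j| ≤ η * √(sqLoss y θ) := by
  have hη0 : 0 ≤ η := (abs_nonneg _).trans (hη ⟨0, by omega⟩)
  rw [abs_mul, abs_of_nonneg (by positivity : (0 : ℝ) ≤ 1 / n)]
  calc 1 / (n : ℝ) * |∑ j, g j * residual y θ j|
      ≤ 1 / (n : ℝ) * ∑ j, η * |residual y θ j| := by
        refine mul_le_mul_of_nonneg_left ?_ (by positivity)
        refine (Finset.abs_sum_le_sum_abs _ _).trans (Finset.sum_le_sum fun i _ => ?_)
        rw [abs_mul]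
        exact mul_le_mul_of_nonneg_right (hη i) (abs_nonneg _)
    _ = η * (1 / (n : ℝ) * ∑ j, |residual y θ j|) := by rw [← Finset.mul_sum]; ring
    _ ≤ _ := mul_le_mul_of_nonneg_left (mean_abs_le_sqrt (by omega) _) hη0

theorem sqrt_mul_exp_le {V W c t : ℝ} (h : V ≤ W * Real.exp (-(c * t))) :
    √V ≤ √W * Real.exp (-(c / 2 * t)) := by
  have e : Real.exp (-(c * t)) = Real.exp (-(c / 2 * t)) ^ 2 := by
    rw [← Real.exp_nat_mul]; congr 1; push_cast; ring
  have := Real.sqrt_le_sqrt h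
  rwa [e, Real.sqrt_mul' _ (sq_nonneg _), Real.sqrt_sq (Real.exp_pos _).le] at this

/-- The trained network is uniformly close to a function in the span of the limiting kernel. -/
theorem IsGradientFlow.exists_ntkSpan (h : IsGradientFlow y θ₀ θ) (hn : 2 ≤ n) {W δ η : ℝ}
    (hK : KernelStable n δ η θ₀) (hη : η ≤ 1 / (52 * (n : ℝ) ^ 2)) (hδ : δ ≤ 1 / 3)
    (hη0 : 0 ≤ η) (hW : 0 < W) (hW0 : sqLoss y θ₀ ≤ W)
    (hm : √(2 / (2 * (m : ℝ))) * √(2 * W) * (52 * (n : ℝ) ^ 2) ≤ δ / 2)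
    (hnet : ∀ x, net θ₀ x = 0) {T : ℝ} (hT : 0 ≤ T) :
    ∃ α : Fin n → ℝ, ∀ x ∈ Icc (0 : ℝ) 1,
      |net (θ T) x - ntkSpan α x| ≤ η * √W * (52 * (n : ℝ) ^ 2) := by
  have hn0 : (0 : ℝ) < n := by positivity
  set c := 1 / (26 * (n : ℝ) ^ 2) with hc
  have hc0 : 0 < c / 2 := by positivity
  -- Time is clamped to [0, T] because the residuals are only known to be continuous for nonnegative
  -- times.
  let u : Fin n → ℝ → ℝ := fun j t => residual y (θ (max 0 (min t T))) j
  have hu : ∀ j, Continuous (u j) := by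
    intro j
    have h1 := (h.ac_residual j hT).continuousOn
    rw [uIcc_of_le hT] at h1
    exact h1.comp_continuous (by fun_prop) fun t =>
      ⟨le_max_left _ _, max_le hT (min_le_right _ _)⟩
  -- The coefficients are the time integrals of the residuals: with the limiting kernel in place of
  -- the actual one, the output would be exactly Σ K(x, x_j) A_j. The velocity of the difference is
  -- a kernel error of size η times a decaying residual.
  let A : Fin n → ℝ → ℝ := fun j t => -(1 / (n : ℝ)) * ∫ s in (0 : ℝ)..t, u j s
  have hA : ∀ j t, HasDerivAt (A j) (-(1 / (n : ℝ)) * u j t) t := fun j t =>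
    ((hu j).integral_hasStrictDerivAt 0 t).hasDerivAt.const_mul _
  have hAac : ∀ j, AbsolutelyContinuousOnInterval (A j) 0 T := fun j =>
    (((hu j).intervalIntegrable 0 T).absolutelyContinuousOnInterval_intervalIntegral
      left_mem_uIcc).const_mul _
  refine ⟨fun j => A j T, fun x hx => ?_⟩
  have hac : AbsolutelyContinuousOnInterval
      (fun t => net (θ t) x - ∑ j : Fin n, ntk x (gridPoint n j) * A j t) 0 T :=
    (h.ac_net x hT).sub (ac_finsetSum _ fun j _ => (hAac j).const_mul _)
  have hmain := ac_abs_sub_le_of_ae_abs_deriv_le (C := η * √W) hT (by positivity) hc0 hac ?_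
  · have e0 : ∀ j, A j 0 = 0 := fun j => by simp [A]
    simp only [h.init, hnet, e0, mul_zero, Finset.sum_const_zero, sub_zero] at hmain
    have e1 : ntkSpan (fun j => A j T) x = ∑ j : Fin n, ntk x (gridPoint n j) * A j T :=
      Finset.sum_congr rfl fun j _ => mul_comm _ _
    rw [e1]
    refine hmain.trans (le_of_eq ?_)
    rw [hc]; field_simp; ring
  filter_upwards [h.ae_hasDerivAt x, ae_restrict_mem measurableSet_Ioi] with t ht ht0 htT
  obtain ⟨s, sx, hs, hsx, -, hd⟩ := ht
  have hut : ∀ j, u j t = residual y (θ t) j := fun j => by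
    simp only [u]
    rw [min_eq_left htT.le, max_eq_right (le_of_lt ht0)]
  obtain ⟨hnear, hV⟩ := h.sqLoss_le_exp hn hK hη hδ hW hW0 hm (le_of_lt ht0)
  refine ⟨_, hd.sub (HasDerivAt.fun_sum fun j _ => (hA j t).const_mul _), ?_⟩
  have e : -(1 / (n : ℝ) * ∑ j : Fin n, tangentKernel (θ t) x sx (gridPoint n j) (s j) *
      residual y (θ t) j) - ∑ j : Fin n, ntk x (gridPoint n j) * (-(1 / (n : ℝ)) * u j t) =
      -(1 / (n : ℝ) * ∑ j : Fin n, (tangentKernel (θ t) x sx (gridPoint n j) (s j) -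
        ntk x (gridPoint n j)) * residual y (θ t) j) := by
    simp only [hut, Finset.mul_sum, ← Finset.sum_neg_distrib, ← Finset.sum_sub_distrib]
    exact Finset.sum_congr rfl fun j _ => by ring
  rw [e, abs_neg]
  refine (abs_sum_mul_residual_le hn (fun j => hK _ hnear x hx j sx (s j) hsx (hs j)) y _).trans ?_
  rw [mul_assoc]
  exact mul_le_mul_of_nonneg_left (sqrt_mul_exp_le hV) hη0

/-- The residuals stay close to the solution of the linear differential equation given by the
limiting kernel. -/
theorem IsGradientFlow.abs_residual_sub_le (h : IsGradientFlow y θ₀ θ) (hn : 2 ≤ n) {W δ η : ℝ}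
    (hK : KernelStable n δ η θ₀) (hη : η ≤ 1 / (52 * (n : ℝ) ^ 2)) (hδ : δ ≤ 1 / 3)
    (hη0 : 0 ≤ η) (hW : 0 < W) (hW0 : sqLoss y θ₀ ≤ W)
    (hm : √(2 / (2 * (m : ℝ))) * √(2 * W) * (52 * (n : ℝ) ^ 2) ≤ δ / 2)
    {v : ℝ → Fin n → ℝ} (hv0 : ∀ i, v 0 i = residual y θ₀ i)
    (hv : ∀ i t, HasDerivAt (fun t => v t i) (-(1 / (n : ℝ)) *
      ∑ j : Fin n, ntk (gridPoint n i) (gridPoint n j) * v t j) t)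
    (hvW : ∀ t, 0 ≤ t → ∑ i, v t i ^ 2 ≤ W) {T : ℝ} (hT : 0 ≤ T) (i : Fin n) :
    (residual y (θ T) i - v T i) ^ 2 ≤ 4 * η * n * W * (52 * (n : ℝ) ^ 2) := by
  have hn0 : (0 : ℝ) < n := by positivity
  set c := 1 / (26 * (n : ℝ) ^ 2) with hc
  have hc0 : 0 < c / 2 := by positivity
  let D : ℝ → Fin n → ℝ := fun t i => residual y (θ t) i - v t i
  have hvac : ∀ i, AbsolutelyContinuousOnInterval (fun t => v t i) 0 T := fun i => by
    refine ac_of_contDiff (contDiff_one_iff_deriv.2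
      ⟨fun t => (hv i t).differentiableAt, ?_⟩) 0 T
    have : deriv (fun t => v t i) = fun t => -(1 / (n : ℝ)) *
        ∑ j : Fin n, ntk (gridPoint n i) (gridPoint n j) * v t j :=
      funext fun t => (hv i t).deriv
    rw [this]
    have hvc : ∀ j, Continuous fun t => v t j := fun j =>
      continuous_iff_continuousAt.2 fun t => (hv j t).continuousAt
    fun_prop
  have hDac : ∀ i, AbsolutelyContinuousOnInterval (fun t => D t i) 0 T := fun i =>
    (h.ac_residual i hT).sub (hvac i)
  let g : ℝ → ℝ := fun t => -(4 * η * n * W / (c / 2)) * Real.exp (-(c / 2 * t))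
  have hg : ∀ t, HasDerivAt g (4 * η * n * W * Real.exp (-(c / 2 * t))) t := fun t => by
    have h1 : HasDerivAt (fun t => -(c / 2 * t)) (-(c / 2 * 1)) t :=
      ((hasDerivAt_id t).const_mul (c / 2)).neg
    refine (h1.exp.const_mul (-(4 * η * n * W / (c / 2)))).congr_deriv ?_
    have hc1 : c ≠ 0 := by linarith
    field_simp
  have hac : AbsolutelyContinuousOnInterval (fun t => ∑ i, D t i ^ 2 - g t) 0 T := by
    have h1 := ac_finsetSum Finset.univ fun i (_ : i ∈ Finset.univ) => (hDac i).mul (hDac i)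
    simp only [Pi.mul_apply, ← sq] at h1
    exact h1.sub (ac_of_contDiff (by fun_prop) _ _)
  have hle := ac_le_of_ae_deriv_nonpos hT hac ?_
  · have hD0 : ∀ i, D 0 i = 0 := fun i => by simp only [D, h.init, hv0, sub_self]
    simp only [hD0, g, mul_zero, neg_zero, Real.exp_zero, ne_eq, OfNat.ofNat_ne_zero,
      not_false_eq_true, zero_pow, Finset.sum_const_zero, mul_one] at hle
    have h1 : D T i ^ 2 ≤ ∑ i, D T i ^ 2 :=
      Finset.single_le_sum (f := fun i => D T i ^ 2) (fun i _ => sq_nonneg _) (Finset.mem_univ i)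
    have h2 : 0 ≤ 4 * η * n * W / (c / 2) * Real.exp (-(c / 2 * T)) := by positivity
    have h3 : 4 * η * n * W / (c / 2) = 4 * η * n * W * (52 * (n : ℝ) ^ 2) := by
      rw [hc]; field_simp; ring
    change D T i ^ 2 ≤ _
    rw [← h3]
    linarith
  filter_upwards [h.ae_hasDerivAt 0, ae_restrict_mem measurableSet_Ioi] with t ht ht0 htT
  obtain ⟨s, -, hs, -, hres, -⟩ := ht
  obtain ⟨hnear, hV⟩ := h.sqLoss_le_exp hn hK hη hδ hW hW0 hm (le_of_lt ht0)
  have hVW : sqLoss y (θ t) ≤ W := by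
    refine hV.trans (mul_le_of_le_one_right hW.le ?_)
    rw [Real.exp_le_one_iff, neg_nonpos]
    exact mul_nonneg (by positivity) (le_of_lt ht0)
  let H : Fin n → Fin n → ℝ := fun i j =>
    tangentKernel (θ t) (gridPoint n i) (s i) (gridPoint n j) (s j)
  let K : Fin n → Fin n → ℝ := fun i j => ntk (gridPoint n i) (gridPoint n j)
  let e : Fin n → ℝ := fun i => 1 / (n : ℝ) * ∑ j, (H i j - K i j) * residual y (θ t) j
  have he : ∀ i, |e i| ≤ η * (√W * Real.exp (-(c / 2 * t))) := fun i =>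
    (abs_sum_mul_residual_le hn (fun j => hK _ hnear _ (gridPoint_mem hn i) j (s i) (s j)
      (hs i) (hs j)) y _).trans (mul_le_mul_of_nonneg_left (sqrt_mul_exp_le hV) hη0)
  have hDd : ∀ i, HasDerivAt (fun u => D u i)
      (-(1 / (n : ℝ)) * ∑ j, K i j * D t j - e i) t := by
    intro i
    refine ((hres i).sub (hv i t)).congr_deriv ?_
    simp only [e, D, H, K, Finset.mul_sum, ← Finset.sum_neg_distrib, ← Finset.sum_sub_distrib]
    exact Finset.sum_congr rfl fun j _ => by ring
  have hDs : HasDerivAt (fun u => ∑ i, D u i ^ 2) (-(2 / (n : ℝ)) *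
      ∑ i, D t i * ∑ j, K i j * D t j - 2 * ∑ i, D t i * e i) t := by
    refine (HasDerivAt.fun_sum fun i (_ : i ∈ Finset.univ) => (hDd i).pow 2).congr_deriv ?_
    rw [Finset.mul_sum, Finset.mul_sum, ← Finset.sum_sub_distrib]
    refine Finset.sum_congr rfl fun i _ => ?_
    push_cast
    ring
  -- The difference D obeys the limiting equation with forcing -e. The limiting form is nonnegative,
  -- so only the cross term of D and e can increase Σ D_i².
  have hpos : 0 ≤ ∑ i, D t i * ∑ j, K i j * D t j := by
    refine le_trans ?_ (le_quadraticForm_of_near hn (η := 0) (by positivity)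
      (M := K) (fun i j => by simp [K]) (D t))
    exact mul_nonneg (by positivity) (Finset.sum_nonneg fun _ _ => sq_nonneg _)
  have hDabs : ∀ i, |D t i| ≤ 2 * √W := by
    intro i
    have h1 : |residual y (θ t) i| ≤ √W := by
      refine Real.abs_le_sqrt (le_trans ?_ hVW)
      exact Finset.single_le_sum (f := fun i => residual y (θ t) i ^ 2) (fun i _ => sq_nonneg _)
        (Finset.mem_univ i)
    have h2 : |v t i| ≤ √W := by
      refine Real.abs_le_sqrt (le_trans ?_ (hvW t (le_of_lt ht0)))
      exact Finset.single_le_sum (f := fun i => v t i ^ 2) (fun i _ => sq_nonneg _)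
        (Finset.mem_univ i)
    exact (abs_sub _ _).trans (by linarith)
  have hcross : -∑ i, D t i * e i ≤ n * (2 * √W * (η * (√W * Real.exp (-(c / 2 * t))))) := by
    rw [← Finset.sum_neg_distrib]
    have : ∀ i ∈ Finset.univ, -(D t i * e i) ≤ 2 * √W * (η * (√W * Real.exp (-(c / 2 * t)))) := by
      intro i _
      refine (neg_le_abs _).trans ?_
      rw [abs_mul]
      exact mul_le_mul (hDabs i) (he i) (abs_nonneg _) (by positivity)
    refine (Finset.sum_le_sum this).trans (le_of_eq ?_)
    simp
  rw [(hDs.fun_sub (hg t)).deriv]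
  have hsq : √W * √W = W := Real.mul_self_sqrt hW.le
  have e1 : (n : ℝ) * (2 * √W * (η * (√W * Real.exp (-(c / 2 * t))))) =
      2 * η * n * W * Real.exp (-(c / 2 * t)) := by
    linear_combination (n * 2 * η * Real.exp (-(c / 2 * t))) * hsq
  rw [e1] at hcross
  have : 0 ≤ 2 / (n : ℝ) * ∑ i, D t i * ∑ j, K i j * D t j := mul_nonneg (by positivity) hpos
  linarith

end Flow

/-! ### Stability of the tangent kernel -/

/-- The three weights that initialize the `r`-th neuron and its mirror image. -/
def block {m : ℕ} (r : Fin m) (ξ : Fin m × Fin 3 → ℝ) : ℝ × ℝ × ℝ :=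
  (ξ (r, 0), ξ (r, 1), ξ (r, 2))

/-- The squared norm of a neuron if its pre-activation at `z` is small compared to its norm, and
`0` otherwise. -/
def nearKink (δ z : ℝ) (v : ℝ × ℝ × ℝ) : ℝ :=
  if |v.2.1 * z + v.2.2| ≤ 3 * δ * weightNorm v then weightNorm v ^ 2 else 0

theorem nearKink_nonneg (δ z : ℝ) (v : ℝ × ℝ × ℝ) : 0 ≤ nearKink δ z v := by
  unfold nearKink; split_ifs <;> positivity

/-- A slope of a perturbed neuron agrees with the gate of the neuron unless the pre-activation of
the neuron is small. -/
theorem abs_slope_sub_gate_le {p p' s ε : ℝ} (hp : |p' - p| ≤ ε) (hs : s ∈ reluSubdiff p') :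
    |s - (if 0 < p then 1 else 0)| ≤ if |p| ≤ ε then 1 else 0 := by
  obtain ⟨h0, h1, hs1, hs0⟩ := hs
  obtain ⟨hl, hr⟩ := abs_le.1 hp
  by_cases hk : |p| ≤ ε
  · rw [if_pos hk, abs_le]
    split_ifs <;> constructor <;> linarith
  · rw [if_neg hk]
    rw [not_le, lt_abs] at hk
    rcases hk with hk | hk
    · have hε : 0 ≤ ε := (abs_nonneg _).trans hp
      rw [if_pos (by linarith), hs1 (by linarith)]; simp
    · have hε : 0 ≤ ε := (abs_nonneg _).trans hp
      rw [if_neg (by linarith), hs0 (by linarith)]; simp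

/-- The weights move by a relative δ and the input x is replaced by a net point z. Activations are
Lipschitz, which costs a multiple of δN²; slopes can change only for a neuron whose pre-activation
at the reference input is within 3δN of zero, which costs the `nearKink` terms. -/
theorem abs_neuron_perturbation_le {δ x x' z a w b a' w' b' s s' N : ℝ} (hδ0 : 0 ≤ δ)
    (hδ : δ ≤ 1 / 3) (hx : x ∈ Icc (0 : ℝ) 1) (hx' : x' ∈ Icc (0 : ℝ) 1) (hz : z ∈ Icc (0 : ℝ) 1)
    (hxz : |x - z| ≤ δ) (hN : N = |a| + |w| + |b|) (ha : |a' - a| ≤ δ * N)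
    (hw : |w' - w| ≤ δ * N) (hb : |b' - b| ≤ δ * N) (hs : s ∈ reluSubdiff (w' * x + b'))
    (hs' : s' ∈ reluSubdiff (w' * x' + b')) :
    |(max (w' * x + b') 0 * max (w' * x' + b') 0 + a' ^ 2 * (s * s') * (x * x' + 1)) -
      (act z (w, b) * act x' (w, b) + (z * x' + 1) * (a ^ 2 * (gate z (w, b) * gate x' (w, b))))| ≤
      16 * δ * N ^ 2 + 2 * (nearKink δ z (a, w, b) + nearKink δ x' (a, w, b)) := by
  have hN0 : 0 ≤ N := by rw [hN]; positivity
  have haN : |a| ≤ N := by rw [hN]; linarith [abs_nonneg w, abs_nonneg b]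
  have hwN : |w| ≤ N := by rw [hN]; linarith [abs_nonneg a, abs_nonneg b]
  have hpre : ∀ x z : ℝ, x ∈ Icc (0 : ℝ) 1 → |x - z| ≤ δ →
      |(w' * x + b') - (w * z + b)| ≤ 3 * δ * N := by
    intro x z hx hxz
    have e : (w' * x + b') - (w * z + b) = (w' - w) * x + w * (x - z) + (b' - b) := by ring
    rw [e]
    refine (abs_add_three _ _ _).trans ?_
    have h1 : |(w' - w) * x| ≤ δ * N := by
      rw [abs_mul, abs_of_nonneg hx.1]
      exact (mul_le_of_le_one_right (abs_nonneg _) hx.2).trans hw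
    have h2 : |w * (x - z)| ≤ N * δ := by
      rw [abs_mul]; exact mul_le_mul hwN hxz (abs_nonneg _) hN0
    linarith
  have hA := hpre x z hx hxz
  have hB := hpre x' x' hx' (by simpa using hδ0)
  have hact : ∀ z ∈ Icc (0 : ℝ) 1, act z (w, b) ≤ N := fun z hz =>
    (act_le hz _).trans (by rw [hN]; simp only; linarith [abs_nonneg a])
  have dA : |max (w' * x + b') 0 - act z (w, b)| ≤ 3 * δ * N :=
    (abs_max_sub_max_le_abs _ _ _).trans hA
  have dB : |max (w' * x' + b') 0 - act x' (w, b)| ≤ 3 * δ * N :=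
    (abs_max_sub_max_le_abs _ _ _).trans hB
  set A := act z (w, b) with hAdef
  set B := act x' (w, b) with hBdef
  set A' := max (w' * x + b') 0
  set B' := max (w' * x' + b') 0
  have hA0 : 0 ≤ A := act_nonneg _ _
  have hAN : A ≤ N := hact z hz
  have hBN : B ≤ N := hact x' hx'
  have hB'0 : 0 ≤ B' := le_max_right _ _
  have hδN : 3 * δ * N ≤ N := mul_le_of_le_one_left hN0 (by linarith)
  have hB'N : B' ≤ 2 * N := by have := (abs_le.1 dB).2; linarith
  have t1 : |A' * B' - A * B| ≤ 9 * δ * N ^ 2 := by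
    have e : A' * B' - A * B = (A' - A) * B' + A * (B' - B) := by ring
    rw [e]
    refine (abs_add_le _ _).trans ?_
    rw [abs_mul, abs_mul, abs_of_nonneg hB'0, abs_of_nonneg hA0]
    have h1 : |A' - A| * B' ≤ 3 * δ * N * (2 * N) :=
      mul_le_mul dA hB'N hB'0 (by positivity)
    have h2 : A * |B' - B| ≤ N * (3 * δ * N) := mul_le_mul hAN dB (abs_nonneg _) hN0
    have e2 : 9 * δ * N ^ 2 = 3 * δ * N * (2 * N) + N * (3 * δ * N) := by ring
    linarith
  have k1 := abs_slope_sub_gate_le hA hs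
  have k2 := abs_slope_sub_gate_le hB hs'
  obtain ⟨s0, s1, -, -⟩ := hs
  obtain ⟨s0', s1', -, -⟩ := hs'
  have eg : ∀ z, (if 0 < w * z + b then (1 : ℝ) else 0) = gate z (w, b) := fun z => rfl
  rw [eg] at k1 k2
  have g0 := gate_nonneg z (w, b)
  have g1 := gate_le_one z (w, b)
  have g0' := gate_nonneg x' (w, b)
  have g1' := gate_le_one x' (w, b)
  set g := gate z (w, b)
  set g' := gate x' (w, b)
  set k := if |w * z + b| ≤ 3 * δ * N then (1 : ℝ) else 0 with hk
  set k' := if |w * x' + b| ≤ 3 * δ * N then (1 : ℝ) else 0 with hk'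
  have hkN : N ^ 2 * k = nearKink δ z (a, w, b) := by
    rw [hk, nearKink, weightNorm, ← hN]; split_ifs <;> ring
  have hkN' : N ^ 2 * k' = nearKink δ x' (a, w, b) := by
    rw [hk', nearKink, weightNorm, ← hN]; split_ifs <;> ring
  have hss : |s * s' - g * g'| ≤ k + k' := by
    have e : s * s' - g * g' = (s - g) * s' + g * (s' - g') := by ring
    rw [e]
    refine (abs_add_le _ _).trans ?_
    rw [abs_mul, abs_mul, abs_of_nonneg s0', abs_of_nonneg g0]
    have h1 := mul_le_of_le_one_right (abs_nonneg (s - g)) s1'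
    have h2 := mul_le_of_le_one_left (abs_nonneg (s' - g')) g1
    linarith
  have ha2 : |a' ^ 2 - a ^ 2| ≤ 3 * δ * N ^ 2 := by
    have e : a' ^ 2 - a ^ 2 = (a' - a) * ((a' - a) + 2 * a) := by ring
    rw [e, abs_mul]
    have h1 : |a' - a + 2 * a| ≤ 3 * N := by
      refine (abs_add_le _ _).trans ?_
      rw [abs_mul, abs_two]
      linarith
    have h2 := mul_le_mul ha h1 (abs_nonneg _) (by positivity)
    have e2 : 3 * δ * N ^ 2 = δ * N * (3 * N) := by ring
    linarith
  have hxx : x * x' + 1 ≤ 2 := by linarith [mul_le_one₀ hx.2 hx'.1 hx'.2]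
  have hxx0 : 0 ≤ x * x' + 1 := by linarith [mul_nonneg hx.1 hx'.1]
  have haa : a ^ 2 ≤ N ^ 2 := by rw [← sq_abs a]; gcongr
  have t2 : |a' ^ 2 * (s * s') * (x * x' + 1) - (z * x' + 1) * (a ^ 2 * (g * g'))| ≤
      7 * δ * N ^ 2 + 2 * (N ^ 2 * k + N ^ 2 * k') := by
    have e : a' ^ 2 * (s * s') * (x * x' + 1) - (z * x' + 1) * (a ^ 2 * (g * g')) =
        (a' ^ 2 - a ^ 2) * ((s * s') * (x * x' + 1)) +
        a ^ 2 * (s * s' - g * g') * (x * x' + 1) + a ^ 2 * (g * g') * ((x - z) * x') := by ring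
    rw [e]
    refine (abs_add_three _ _ _).trans ?_
    have h1 : |(a' ^ 2 - a ^ 2) * ((s * s') * (x * x' + 1))| ≤ 3 * δ * N ^ 2 * (1 * 2) := by
      rw [abs_mul, abs_of_nonneg (mul_nonneg (mul_nonneg s0 s0') hxx0)]
      refine mul_le_mul ha2 ?_ (mul_nonneg (mul_nonneg s0 s0') hxx0) (by positivity)
      exact mul_le_mul (mul_le_one₀ s1 s0' s1') hxx hxx0 zero_le_one
    have h2 : |a ^ 2 * (s * s' - g * g') * (x * x' + 1)| ≤ N ^ 2 * (k + k') * 2 := by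
      rw [abs_mul, abs_mul, abs_of_nonneg (sq_nonneg a), abs_of_nonneg hxx0]
      have hkk : 0 ≤ k + k' := (abs_nonneg _).trans hss
      exact mul_le_mul (mul_le_mul haa hss (abs_nonneg _) (sq_nonneg _)) hxx hxx0 (by positivity)
    have h3 : |a ^ 2 * (g * g') * ((x - z) * x')| ≤ N ^ 2 * (1 * 1) * (δ * 1) := by
      rw [abs_mul, abs_mul (x - z), abs_of_nonneg hx'.1,
        abs_of_nonneg (mul_nonneg (sq_nonneg a) (mul_nonneg g0 g0'))]
      exact mul_le_mul (mul_le_mul haa (mul_le_mul g1 g1' g0' zero_le_one)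
        (mul_nonneg g0 g0') (sq_nonneg _)) (mul_le_mul hxz hx'.2 hx'.1 hδ0)
        (mul_nonneg (abs_nonneg _) hx'.1) (by positivity)
    linarith
  rw [← hkN, ← hkN']
  have e : A' * B' + a' ^ 2 * (s * s') * (x * x' + 1) -
      (A * B + (z * x' + 1) * (a ^ 2 * (g * g'))) = (A' * B' - A * B) +
      (a' ^ 2 * (s * s') * (x * x' + 1) - (z * x' + 1) * (a ^ 2 * (g * g'))) := by ring
  rw [e]
  refine (abs_add_le _ _).trans ?_
  linarith

/-- Near a mirrored initialization, the tangent kernel is close to an empirical mean over the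
neurons at initialization. -/
theorem abs_tangentKernel_sub_le {m : ℕ} {δ : ℝ} (hδ0 : 0 ≤ δ) (hδ : δ ≤ 1 / 3)
    {ξ : Fin m × Fin 3 → ℝ} {θ : Params m} (hθ : IsNear δ (initParams ξ) θ) {x x' z : ℝ}
    (hx : x ∈ Icc (0 : ℝ) 1) (hx' : x' ∈ Icc (0 : ℝ) 1) (hz : z ∈ Icc (0 : ℝ) 1)
    (hxz : |x - z| ≤ δ) {s s' : Neuron m → ℝ} (hs : ∀ r, s r ∈ reluSubdiff (preact θ r x))
    (hs' : ∀ r, s' r ∈ reluSubdiff (preact θ r x')) :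
    |tangentKernel θ x s x' s' - (1 / (m : ℝ) * ∑ r, neuronKernel z x' (block r ξ) + 1)| ≤
      32 * δ * (1 / (m : ℝ) * ∑ r, weightNorm (block r ξ) ^ 2) +
      4 * (1 / (m : ℝ) * ∑ r, nearKink δ z (block r ξ) +
        1 / (m : ℝ) * ∑ r, nearKink δ x' (block r ξ)) := by
  let F : Neuron m → ℝ := fun r => max (preact θ r x) 0 * max (preact θ r x') 0 +
    θ.a r ^ 2 * (s r * s' r) * (x * x' + 1)
  let G : Fin m → ℝ := fun r => act z (block r ξ).2 * act x' (block r ξ).2 + (z * x' + 1) *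
    ((block r ξ).1 ^ 2 * (gate z (block r ξ).2 * gate x' (block r ξ).2))
  let b : Fin m → ℝ := fun r => 16 * δ * weightNorm (block r ξ) ^ 2 +
    2 * (nearKink δ z (block r ξ) + nearKink δ x' (block r ξ))
  have h1 : ∀ r : Fin m, |F (Sum.inl r) - G r| ≤ b r := fun r =>
    abs_neuron_perturbation_le hδ0 hδ hx hx' hz hxz rfl (hθ (Sum.inl r)).1 (hθ (Sum.inl r)).2.1
      (hθ (Sum.inl r)).2.2 (hs _) (hs' _)
  have h2 : ∀ r : Fin m, |F (Sum.inr r) - G r| ≤ b r := fun r => by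
    have hN : neuronNorm (initParams ξ) (Sum.inr r) =
        |-ξ (r, 0)| + |ξ (r, 1)| + |ξ (r, 2)| := rfl
    have h := abs_neuron_perturbation_le hδ0 hδ hx hx' hz hxz hN (hθ (Sum.inr r)).1
      (hθ (Sum.inr r)).2.1 (hθ (Sum.inr r)).2.2 (hs _) (hs' _)
    have e : ∀ z, nearKink δ z (-ξ (r, 0), ξ (r, 1), ξ (r, 2)) = nearKink δ z (block r ξ) :=
      fun z => by
        have h : weightNorm (-ξ (r, 0), ξ (r, 1), ξ (r, 2)) = weightNorm (block r ξ) := by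
          simp only [weightNorm, block, abs_neg]
        unfold nearKink
        rw [h]
        rfl
    rw [e, e, hN, abs_neg, neg_sq] at h
    exact h
  have e : tangentKernel θ x s x' s' - (1 / (m : ℝ) * ∑ r, neuronKernel z x' (block r ξ) + 1) =
      1 / (m : ℝ) * ∑ r : Fin m, ((F (Sum.inl r) - G r) + (F (Sum.inr r) - G r)) := by
    have e1 : ∀ r : Fin m, neuronKernel z x' (block r ξ) = G r + G r := fun r => by
      simp only [neuronKernel, G]; ring
    simp only [tangentKernel, e1, Fintype.sum_sum_type, Finset.sum_add_distrib,
      Finset.sum_sub_distrib, F]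
    ring
  rw [e, abs_mul, abs_of_nonneg (by positivity : (0 : ℝ) ≤ 1 / m)]
  have h3 : |∑ r : Fin m, ((F (Sum.inl r) - G r) + (F (Sum.inr r) - G r))| ≤
      ∑ r : Fin m, 2 * b r :=
    (Finset.abs_sum_le_sum_abs _ _).trans (Finset.sum_le_sum fun r _ =>
      (abs_add_le _ _).trans (by linarith [h1 r, h2 r]))
  refine (mul_le_mul_of_nonneg_left h3 (by positivity)).trans (le_of_eq ?_)
  simp only [b, mul_add, Finset.sum_add_distrib, Finset.mul_sum]
  congr 1
  · exact Finset.sum_congr rfl fun r _ => by ring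
  · congr 1 <;> exact Finset.sum_congr rfl fun r _ => by ring

/-- Reduces stability, uniform over inputs, slopes and nearby parameters, to finitely many empirical
means when Z is finite. The 11 collects 1 for the mean, 1 for passing from z to x, 1 for the norm
term, and 4 · 2 for the kinks at z and at the grid point. -/
theorem kernelStable_of_empirical {m n : ℕ} (hn : 2 ≤ n) {δ η Λ : ℝ} (hδ0 : 0 ≤ δ)
    (hδ : δ ≤ 1 / 3) {ξ : Fin m × Fin 3 → ℝ} {Z : Set ℝ} (hZ : Z ⊆ Icc 0 1)
    (hZnet : ∀ x ∈ Icc (0 : ℝ) 1, ∃ z ∈ Z, |x - z| ≤ δ ∧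
      ∀ i : Fin n, |ntk z (gridPoint n i) - ntk x (gridPoint n i)| ≤ η)
    (hZgrid : ∀ i : Fin n, gridPoint n i ∈ Z)
    (hmean : ∀ z ∈ Z, ∀ i : Fin n, |1 / (m : ℝ) * ∑ r, neuronKernel z (gridPoint n i) (block r ξ) -
      (ntk z (gridPoint n i) - 1)| ≤ η)
    (hnorm : 1 / (m : ℝ) * ∑ r, weightNorm (block r ξ) ^ 2 ≤ Λ) (hΛ : 32 * δ * Λ ≤ η)
    (hkink : ∀ z ∈ Z, 1 / (m : ℝ) * ∑ r, nearKink δ z (block r ξ) ≤ η) :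
    KernelStable n δ (11 * η) (initParams ξ) := by
  intro θ hθ x hx i s s' hs hs'
  obtain ⟨z, hzZ, hxz, hntk⟩ := hZnet x hx
  have h1 := abs_tangentKernel_sub_le hδ0 hδ hθ hx (gridPoint_mem hn i) (hZ hzZ) hxz hs hs'
  have h2 := hmean z hzZ i
  have h3 := hntk i
  have h4 := hkink z hzZ
  have h5 := hkink _ (hZgrid i)
  have h6 : 32 * δ * (1 / (m : ℝ) * ∑ r, weightNorm (block r ξ) ^ 2) ≤ η :=
    (mul_le_mul_of_nonneg_left hnorm (by positivity)).trans hΛ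
  rw [abs_le] at *
  constructor <;> linarith

/-- Mirrored outer weights cancel, so the initial residuals are -y whatever the initialization. -/
theorem net_initParams {m : ℕ} (ξ : Fin m × Fin 3 → ℝ) (x : ℝ) : net (initParams ξ) x = 0 := by
  simp [net, initParams, preact, Fintype.sum_sum_type]

open Filter Topology

/-! ### Random initialization -/

/-- **Weak law of large numbers** for the coordinates of a power of a probability space. -/
theorem tendsto_measure_pi_mean_deviation {Ω : Type*} [MeasurableSpace Ω] {ν : Measure Ω}
    [IsProbabilityMeasure ν] {F : Ω → ℝ} (hF : MemLp F 2 ν) {ε : ℝ} (hε : 0 < ε) :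
    Tendsto (fun m : ℕ => (Measure.pi fun _ : Fin m => ν)
      {v | ε ≤ |1 / (m : ℝ) * ∑ r, F (v r) - ∫ q, F q ∂ν|}) atTop (𝓝 0) := by
  have hlim : Tendsto (fun m : ℕ => ENNReal.ofReal (variance F ν / ε ^ 2 * (1 / (m : ℝ)))) atTop
      (𝓝 0) := by
    have h := (tendsto_one_div_atTop_nhds_zero_nat (𝕜 := ℝ)).const_mul (variance F ν / ε ^ 2)
    simpa using ENNReal.tendsto_ofReal h
  refine tendsto_of_tendsto_of_tendsto_of_le_of_le' tendsto_const_nhds hlim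
    (Eventually.of_forall fun _ => zero_le) ?_
  filter_upwards [eventually_gt_atTop 0] with m hm
  have hm' : (0 : ℝ) < m := by exact_mod_cast hm
  have hc : ∀ r : Fin m, MemLp (fun v : Fin m → Ω => F (v r)) 2 (Measure.pi fun _ : Fin m => ν) :=
    fun r => hF.comp_measurePreserving (measurePreserving_eval _ r)
  have hS : MemLp (fun v : Fin m → Ω => ∑ r, F (v r)) 2 (Measure.pi fun _ : Fin m => ν) :=
    memLp_finsetSum _ fun r _ => hc r
  have hint : ∫ v, ∑ r, F (v r) ∂(Measure.pi fun _ : Fin m => ν) = m * ∫ q, F q ∂ν := by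
    rw [integral_finsetSum _ fun r _ => (hc r).integrable one_le_two]
    have : ∀ r : Fin m, ∫ v : Fin m → Ω, F (v r) ∂(Measure.pi fun _ : Fin m => ν) =
        ∫ q, F q ∂ν := fun r => by
      have hp := measurePreserving_eval (fun _ : Fin m => ν) r
      have h := integral_map hp.measurable.aemeasurable (f := F)
        (by rw [hp.map_eq]; exact hF.aestronglyMeasurable)
      rw [hp.map_eq] at h
      exact h.symm
    simp [this]
  have hvar : variance (fun v : Fin m → Ω => ∑ r, F (v r)) (Measure.pi fun _ : Fin m => ν) =
      m * variance F ν := by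
    have h := variance_sum_pi (μ := fun _ : Fin m => ν) (X := fun _ => F) fun _ => hF
    have e : (∑ r : Fin m, fun v : Fin m → Ω => F (v r)) = fun v => ∑ r, F (v r) := by
      ext v; simp
    rw [e] at h
    simpa using h
  have h := meas_ge_le_variance_div_sq hS (c := m * ε) (by positivity)
  rw [hint, hvar] at h
  refine (measure_mono fun v hv => ?_).trans (h.trans (le_of_eq ?_))
  · simp only [mem_ofPred_eq] at hv ⊢
    have e : ∑ r, F (v r) - m * ∫ q, F q ∂ν =
        m * (1 / (m : ℝ) * ∑ r, F (v r) - ∫ q, F q ∂ν) := by field_simp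
    rw [e, abs_mul, abs_of_pos hm']
    exact mul_le_mul_of_nonneg_left hv hm'.le
  · congr 1; field_simp

/-- The law of the numbers which define the initialization. -/
abbrev initLaw (m : ℕ) : Measure (Fin m × Fin 3 → ℝ) := Measure.pi fun _ => gaussianReal 0 1

/-- The initialization with given weights of the neurons. -/
def unblock {m : ℕ} (v : Fin m → ℝ × ℝ × ℝ) (p : Fin m × Fin 3) : ℝ :=
  ![(v p.1).1, (v p.1).2.1, (v p.1).2.2] p.2

theorem measurable_block {m : ℕ} (r : Fin m) : Measurable (block r) := by
  unfold block; fun_prop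

/-- Regroups the independent Gaussians into independent, identically distributed triples, one per
mirrored pair, so that the law of large numbers applies. -/
theorem measurePreserving_unblock (m : ℕ) :
    MeasurePreserving unblock (Measure.pi fun _ : Fin m => neuronLaw) (initLaw m) := by
  have hmeas : Measurable (unblock (m := m)) := by
    refine measurable_pi_lambda _ fun p => ?_
    obtain ⟨r, j⟩ := p
    fin_cases j <;> simp only [unblock] <;> simp <;> fun_prop
  refine ⟨hmeas, (Measure.pi_eq fun s hs => ?_).symm⟩
  rw [Measure.map_apply hmeas (MeasurableSet.univ_pi hs)]
  have e : unblock ⁻¹' (univ.pi s) =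
      univ.pi fun r : Fin m => s (r, 0) ×ˢ (s (r, 1) ×ˢ s (r, 2)) := by
    ext v
    simp [unblock, Fin.forall_fin_succ]
  rw [e, Measure.pi_pi, Fintype.prod_prod_type]
  refine Finset.prod_congr rfl fun r _ => ?_
  rw [Measure.prod_prod, Measure.prod_prod, Fin.prod_univ_three, mul_assoc]

theorem tendsto_initLaw_mean_deviation {F : ℝ × ℝ × ℝ → ℝ} (hm : Measurable F)
    (hF : MemLp F 2 neuronLaw) {ε : ℝ} (hε : 0 < ε) :
    Tendsto (fun m : ℕ => initLaw m
      {ξ | ε ≤ |1 / (m : ℝ) * ∑ r, F (block r ξ) - ∫ v, F v ∂neuronLaw|}) atTop (𝓝 0) := by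
  refine (tendsto_measure_pi_mean_deviation hF hε).congr fun m => ?_
  have hms : MeasurableSet
      {ξ : Fin m × Fin 3 → ℝ | ε ≤ |1 / (m : ℝ) * ∑ r, F (block r ξ) - ∫ v, F v ∂neuronLaw|} := by
    refine measurableSet_le measurable_const ?_
    have : ∀ r : Fin m, Measurable fun ξ => F (block r ξ) := fun r => hm.comp (measurable_block r)
    exact (((Finset.measurable_sum _ fun r _ => this r).const_mul _).sub_const _).abs
  rw [← (measurePreserving_unblock m).measure_preimage hms.nullMeasurableSet]
  congr 1

/-- A centred Gaussian rarely lies in a given short interval. -/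
theorem gaussianReal_abs_add_le {v : ℝ≥0} (hv : v ≠ 0) (d : ℝ) {ε : ℝ} :
    gaussianReal 0 v {x | |d + x| ≤ ε} ≤ ENNReal.ofReal (ε / √v) := by
  have hv0 : (0 : ℝ) < v := by positivity
  have hs : {x : ℝ | |d + x| ≤ ε} = Icc (-ε - d) (ε - d) := by
    ext x
    rw [mem_ofPred_eq, abs_le, mem_Icc]
    constructor <;> rintro ⟨h1, h2⟩ <;> constructor <;> linarith
  rw [hs, gaussianReal_apply 0 hv]
  have hpdf : ∀ x, gaussianPDF 0 v x ≤ ENNReal.ofReal (1 / (2 * √v)) := fun x => by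
    refine ENNReal.ofReal_le_ofReal ?_
    rw [gaussianPDFReal]
    have h1 : Real.exp (-(x - 0) ^ 2 / (2 * v)) ≤ 1 := by
      rw [Real.exp_le_one_iff]
      exact div_nonpos_of_nonpos_of_nonneg (neg_nonpos.2 (sq_nonneg _)) (by positivity)
    -- The density is at most 1/(2√v) because 2π ≥ 4; over an interval of length 2ε this gives
    -- exactly ε/√v.
    have h2 : 2 * √(v : ℝ) ≤ √(2 * Real.pi * v) := by
      refine Real.le_sqrt_of_sq_le ?_
      rw [mul_pow, Real.sq_sqrt hv0.le]
      have := Real.pi_gt_three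
      nlinarith
    calc (√(2 * Real.pi * v))⁻¹ * Real.exp (-(x - 0) ^ 2 / (2 * v))
        ≤ (√(2 * Real.pi * v))⁻¹ * 1 := by gcongr
      _ ≤ 1 / (2 * √v) := by rw [mul_one, one_div]; gcongr
  calc ∫⁻ x in Icc (-ε - d) (ε - d), gaussianPDF 0 v x
      ≤ ∫⁻ _ in Icc (-ε - d) (ε - d), ENNReal.ofReal (1 / (2 * √v)) := lintegral_mono hpdf
    _ = ENNReal.ofReal (1 / (2 * √v)) * ENNReal.ofReal (ε - d - (-ε - d)) := by
        rw [setLIntegral_const, Real.volume_Icc]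
    _ = ENNReal.ofReal (ε / √v) := by
        rw [← ENNReal.ofReal_mul (by positivity)]
        congr 1
        field_simp
        ring

theorem neuronLaw_abs_preact_le (z ε : ℝ) :
    neuronLaw {v | |v.2.1 * z + v.2.2| ≤ ε} ≤ ENNReal.ofReal ε := by
  have hm : MeasurableSet {q : ℝ × ℝ | |q.1 * z + q.2| ≤ ε} :=
    measurableSet_le (by fun_prop) measurable_const
  have h1 : innerLaw {q : ℝ × ℝ | |q.1 * z + q.2| ≤ ε} ≤ ENNReal.ofReal ε := by
    rw [Measure.prod_apply hm]
    calc ∫⁻ w, gaussianReal 0 1 (Prod.mk w ⁻¹' {q : ℝ × ℝ | |q.1 * z + q.2| ≤ ε}) ∂(gaussianReal 0 1)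
        ≤ ∫⁻ _, ENNReal.ofReal ε ∂(gaussianReal 0 1) := by
          refine lintegral_mono fun w => ?_
          have := gaussianReal_abs_add_le one_ne_zero (w * z) (ε := ε)
          simpa using this
      _ = ENNReal.ofReal ε := by simp
  have hp : MeasurePreserving Prod.snd neuronLaw innerLaw := measurePreserving_snd
  have := hp.measure_preimage hm.nullMeasurableSet
  rw [← this] at h1
  exact h1

theorem measurable_nearKink (δ z : ℝ) : Measurable (nearKink δ z) := by
  have h := measurable_weightNorm
  unfold nearKink
  exact Measurable.ite (measurableSet_le (by fun_prop) (by fun_prop)) (by fun_prop)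
    measurable_const

theorem nearKink_le (δ z : ℝ) (v : ℝ × ℝ × ℝ) : nearKink δ z v ≤ weightNorm v ^ 2 := by
  unfold nearKink; split_ifs <;> [exact le_rfl; positivity]

theorem memLp_nearKink (δ z : ℝ) : MemLp (nearKink δ z) 2 neuronLaw := by
  refine memLp_weightNorm_sq.mono (measurable_nearKink δ z).aestronglyMeasurable
    (Eventually.of_forall fun v => ?_)
  rw [Real.norm_of_nonneg (nearKink_nonneg δ z v), Real.norm_of_nonneg (by positivity)]
  exact nearKink_le δ z v

theorem memLp_neuronKernel {z z' : ℝ} (hz : z ∈ Icc (0 : ℝ) 1) (hz' : z' ∈ Icc (0 : ℝ) 1) :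
    MemLp (neuronKernel z z') 2 neuronLaw := by
  refine (memLp_weightNorm_sq.const_mul 6).mono (measurable_neuronKernel z z').aestronglyMeasurable
    (Eventually.of_forall fun v => ?_)
  have hz1 : z * z' ≤ 1 := mul_le_one₀ hz.2 hz'.1 hz'.2
  have hz0 : 0 ≤ z * z' := mul_nonneg hz.1 hz'.1
  have a0 := act_nonneg z v.2
  have a0' := act_nonneg z' v.2
  have hN : |v.2.1| + |v.2.2| ≤ weightNorm v := by
    unfold weightNorm; linarith [abs_nonneg v.1]
  have a1 := (act_le hz v.2).trans hN
  have a1' := (act_le hz' v.2).trans hN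
  have hv : v.1 ^ 2 ≤ weightNorm v ^ 2 := by
    rw [← sq_abs v.1]
    refine pow_le_pow_left₀ (abs_nonneg _) ?_ 2
    unfold weightNorm; linarith [abs_nonneg v.2.1, abs_nonneg v.2.2]
  have g0 := mul_nonneg (gate_nonneg z v.2) (gate_nonneg z' v.2)
  have g1 := mul_le_one₀ (gate_le_one z v.2) (gate_nonneg z' v.2) (gate_le_one z' v.2)
  have hg0 : 0 ≤ v.1 ^ 2 * (gate z v.2 * gate z' v.2) := mul_nonneg (sq_nonneg _) g0
  have hg : v.1 ^ 2 * (gate z v.2 * gate z' v.2) ≤ weightNorm v ^ 2 :=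
    (mul_le_of_le_one_right (sq_nonneg _) g1).trans hv
  have haa : act z v.2 * act z' v.2 ≤ weightNorm v ^ 2 := by
    rw [sq]; exact mul_le_mul a1 a1' a0' (weightNorm_nonneg v)
  have hkg := mul_le_mul (by linarith : 2 * (z * z' + 1) ≤ 4) hg hg0 (by norm_num)
  have hk0 : 0 ≤ neuronKernel z z' v := by unfold neuronKernel; positivity
  rw [Real.norm_of_nonneg hk0, Real.norm_of_nonneg (by positivity)]
  unfold neuronKernel
  linarith

/-- The mean contribution of neurons with a kink near `z` is uniformly small. -/
theorem exists_integral_nearKink_le {η : ℝ} (hη : 0 < η) :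
    ∃ δ₀ > 0, ∀ δ ≤ δ₀, ∀ z, ∫ v, nearKink δ z v ∂neuronLaw ≤ η := by
  set S := ∫ v, (weightNorm v ^ 2) ^ 2 ∂neuronLaw with hS
  have hS0 : 0 ≤ S := integral_nonneg fun v => by positivity
  set L := √(2 * (S + 1) / η) with hL
  have hL2 : L ^ 2 = 2 * (S + 1) / η := Real.sq_sqrt (by positivity)
  have hLpos : 0 < L := Real.sqrt_pos.2 (by positivity)
  refine ⟨η / (6 * L ^ 3), by positivity, fun δ hδ z => ?_⟩
  -- Truncation at norm L. Larger neurons are handled by the fourth moment S; for smaller ones the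
  -- kink threshold 3δN is at most η/(2L²), which bounds the probability of a kink uniformly in z.
  -- The choice of L makes each part at most η/2.
  have hb : ∀ v, nearKink δ z v ≤ (weightNorm v ^ 2) ^ 2 / L ^ 2 +
      L ^ 2 * indicator {v : ℝ × ℝ × ℝ | |v.2.1 * z + v.2.2| ≤ η / (2 * L ^ 2)} 1 v := fun v => by
    have hN := weightNorm_nonneg v
    have hi : 0 ≤ L ^ 2 * indicator {v : ℝ × ℝ × ℝ | |v.2.1 * z + v.2.2| ≤ η / (2 * L ^ 2)} 1 v :=
      mul_nonneg (sq_nonneg _) (indicator_nonneg (fun _ _ => zero_le_one) _)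
    rcases le_total L (weightNorm v) with h | h
    · have h1 : weightNorm v ^ 2 ≤ (weightNorm v ^ 2) ^ 2 / L ^ 2 := by
        rw [le_div_iff₀ (by positivity), sq (weightNorm v ^ 2)]
        gcongr
      linarith [nearKink_le δ z v]
    · by_cases hk : |v.2.1 * z + v.2.2| ≤ 3 * δ * weightNorm v
      · have h1 : v ∈ {v : ℝ × ℝ × ℝ | |v.2.1 * z + v.2.2| ≤ η / (2 * L ^ 2)} := by
          refine hk.trans ?_
          calc 3 * δ * weightNorm v ≤ 3 * (η / (6 * L ^ 3)) * L := by gcongr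
            _ = η / (2 * L ^ 2) := by field_simp; norm_num
        rw [indicator_of_mem h1, nearKink, if_pos hk]
        have h2 : weightNorm v ^ 2 ≤ L ^ 2 := by gcongr
        have : 0 ≤ (weightNorm v ^ 2) ^ 2 / L ^ 2 := by positivity
        simp only [Pi.one_apply, mul_one]
        linarith
      · rw [nearKink, if_neg hk]
        positivity
  have hms : MeasurableSet {v : ℝ × ℝ × ℝ | |v.2.1 * z + v.2.2| ≤ η / (2 * L ^ 2)} :=
    measurableSet_le (by fun_prop) measurable_const
  have hi1 : Integrable (fun v => (weightNorm v ^ 2) ^ 2 / L ^ 2) neuronLaw :=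
    memLp_weightNorm_sq.integrable_sq.div_const _
  have hi2 : Integrable (fun v => L ^ 2 *
      indicator {v : ℝ × ℝ × ℝ | |v.2.1 * z + v.2.2| ≤ η / (2 * L ^ 2)} 1 v) neuronLaw :=
    ((integrable_const (1 : ℝ)).indicator hms).const_mul _
  calc ∫ v, nearKink δ z v ∂neuronLaw
      ≤ ∫ v, ((weightNorm v ^ 2) ^ 2 / L ^ 2 + L ^ 2 *
        indicator {v : ℝ × ℝ × ℝ | |v.2.1 * z + v.2.2| ≤ η / (2 * L ^ 2)} 1 v) ∂neuronLaw :=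
        integral_mono ((memLp_nearKink δ z).integrable one_le_two) (hi1.add hi2) hb
    _ = S / L ^ 2 + L ^ 2 *
        neuronLaw.real {v : ℝ × ℝ × ℝ | |v.2.1 * z + v.2.2| ≤ η / (2 * L ^ 2)} := by
        rw [integral_add hi1 hi2, integral_div, integral_const_mul, integral_indicator_one hms]
    _ ≤ S / L ^ 2 + L ^ 2 * (η / (2 * L ^ 2)) := by
        gcongr
        exact ENNReal.toReal_le_of_le_ofReal (by positivity) (neuronLaw_abs_preact_le z _)
    _ ≤ η := by
        rw [mul_div_assoc', mul_comm (L ^ 2) η, mul_div_mul_right _ _ (by positivity), hL2]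
        have : S / (2 * (S + 1) / η) ≤ η / 2 := by
          rw [div_le_iff₀ (by positivity)]
          field_simp
          linarith
        linarith

theorem continuous_ntk_left (z : ℝ) : Continuous fun x => ntk x z := by
  unfold ntk
  have := Real.continuous_arctan
  fun_prop

/-- For every `n` and `η`, a wide network has a tangent kernel that is close to its limit near a
random initialization, with probability tending to `1`. -/
theorem exists_tendsto_initLaw_not_kernelStable {n : ℕ} (hn : 2 ≤ n) {η : ℝ} (hη : 0 < η) :
    ∃ δ : ℝ, 0 < δ ∧ δ ≤ 1 / 3 ∧ Tendsto (fun m : ℕ => initLaw m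
      {ξ | ¬ KernelStable n δ η (initParams ξ)}) atTop (𝓝 0) := by
  set κ := η / 11 with hκ
  have hκ0 : 0 < κ := by positivity
  obtain ⟨δ₀, hδ₀, hkink⟩ := exists_integral_nearKink_le (half_pos hκ0)
  set Λ := ∫ v, weightNorm v ^ 2 ∂neuronLaw + 1 with hΛ
  have hΛ0 : 0 < Λ := by
    have : 0 ≤ ∫ v, weightNorm v ^ 2 ∂neuronLaw := integral_nonneg fun v => by positivity
    linarith
  set δ := min (min δ₀ (1 / 3)) (κ / (32 * Λ)) with hδ
  have hδ0 : 0 < δ := by positivity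
  have hδ1 : δ ≤ δ₀ := (min_le_left _ _).trans (min_le_left _ _)
  have hδ2 : δ ≤ 1 / 3 := (min_le_left _ _).trans (min_le_right _ _)
  have hδΛ : 32 * δ * Λ ≤ κ := by
    have : δ ≤ κ / (32 * Λ) := min_le_right _ _
    rw [le_div_iff₀ (by positivity)] at this
    linarith
  obtain ⟨ρ, hρ0, hρ⟩ : ∃ ρ > 0, ∀ x ∈ Icc (0 : ℝ) 1, ∀ z ∈ Icc (0 : ℝ) 1, |x - z| < ρ →
      ∀ i : Fin n, |ntk z (gridPoint n i) - ntk x (gridPoint n i)| ≤ κ := by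
    have hc : Continuous fun x => fun i : Fin n => ntk x (gridPoint n i) :=
      continuous_pi fun i => continuous_ntk_left _
    have hu := isCompact_Icc.uniformContinuousOn_of_continuous (s := Icc (0 : ℝ) 1) hc.continuousOn
    obtain ⟨ρ, hρ0, hρ⟩ := Metric.uniformContinuousOn_iff.1 hu κ hκ0
    refine ⟨ρ, hρ0, fun x hx z hz hxz i => ?_⟩
    have h := hρ z hz x hx (by rw [Real.dist_eq, abs_sub_comm]; exact hxz)
    exact ((dist_le_pi_dist _ _ i).trans h.le)
  obtain ⟨t, htsub, htfin, htcov⟩ :=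
    (isCompact_Icc (a := (0 : ℝ)) (b := 1)).finite_cover_balls (lt_min hδ0 hρ0)
  -- The grid points are included because the second kernel argument is a data point, where kinks
  -- must be controlled too.
  set Z : Set ℝ := t ∪ range fun i : Fin n => gridPoint n i with hZ
  have hZfin : Z.Finite := htfin.union (finite_range _)
  have hZsub : Z ⊆ Icc 0 1 := by
    rintro x (hx | ⟨i, rfl⟩)
    · exact htsub hx
    · exact gridPoint_mem hn i
  have hZnet : ∀ x ∈ Icc (0 : ℝ) 1, ∃ z ∈ Z, |x - z| ≤ δ ∧
      ∀ i : Fin n, |ntk z (gridPoint n i) - ntk x (gridPoint n i)| ≤ κ := by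
    intro x hx
    obtain ⟨z, hz, hxz⟩ := mem_iUnion₂.1 (htcov hx)
    rw [Metric.mem_ball, Real.dist_eq] at hxz
    exact ⟨z, Or.inl hz, (hxz.trans_le (min_le_left _ _)).le,
      hρ x hx z (htsub hz) (hxz.trans_le (min_le_right _ _))⟩
  refine ⟨δ, hδ0, hδ2, ?_⟩
  let A : ℕ → ℝ≥0∞ := fun m => initLaw m
    {ξ | 1 ≤ |1 / (m : ℝ) * ∑ r, weightNorm (block r ξ) ^ 2 - ∫ v, weightNorm v ^ 2 ∂neuronLaw|}
  let D : ℝ → ℕ → ℝ≥0∞ := fun z m => initLaw m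
    {ξ | κ / 2 ≤ |1 / (m : ℝ) * ∑ r, nearKink δ z (block r ξ) - ∫ v, nearKink δ z v ∂neuronLaw|}
  let G : ℝ → Fin n → ℕ → ℝ≥0∞ := fun z i m => initLaw m
    {ξ | κ ≤ |1 / (m : ℝ) * ∑ r, neuronKernel z (gridPoint n i) (block r ξ) -
      ∫ v, neuronKernel z (gridPoint n i) v ∂neuronLaw|}
  have hA : Tendsto A atTop (𝓝 0) :=
    tendsto_initLaw_mean_deviation (measurable_weightNorm.pow_const 2) memLp_weightNorm_sq one_pos
  have hD : ∀ z, Tendsto (D z) atTop (𝓝 0) := fun z =>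
    tendsto_initLaw_mean_deviation (measurable_nearKink δ z) (memLp_nearKink δ z) (half_pos hκ0)
  have hG : ∀ z ∈ Z, ∀ i, Tendsto (G z i) atTop (𝓝 0) := fun z hz i =>
    tendsto_initLaw_mean_deviation (measurable_neuronKernel _ _)
      (memLp_neuronKernel (hZsub hz) (gridPoint_mem hn i)) hκ0
  have hlim : Tendsto (fun m => A m + ∑ z ∈ hZfin.toFinset, (D z m + ∑ i, G z i m)) atTop
      (𝓝 0) := by
    have h2 : Tendsto (fun m => ∑ z ∈ hZfin.toFinset, (D z m + ∑ i, G z i m)) atTop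
        (𝓝 (∑ z ∈ hZfin.toFinset, (0 + ∑ i : Fin n, 0))) :=
      tendsto_finsetSum _ fun z hz => (hD z).add
        (tendsto_finsetSum _ fun i _ => hG z (hZfin.mem_toFinset.1 hz) i)
    simpa using hA.add h2
  refine tendsto_of_tendsto_of_tendsto_of_le_of_le tendsto_const_nhds hlim
    (fun _ => zero_le) fun m => ?_
  have hsub : {ξ : Fin m × Fin 3 → ℝ | ¬ KernelStable n δ η (initParams ξ)} ⊆
      {ξ | 1 ≤ |1 / (m : ℝ) * ∑ r, weightNorm (block r ξ) ^ 2 -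
        ∫ v, weightNorm v ^ 2 ∂neuronLaw|} ∪
      ⋃ z ∈ hZfin.toFinset, ({ξ | κ / 2 ≤ |1 / (m : ℝ) * ∑ r, nearKink δ z (block r ξ) -
        ∫ v, nearKink δ z v ∂neuronLaw|} ∪
        ⋃ i ∈ (Finset.univ : Finset (Fin n)),
          {ξ | κ ≤ |1 / (m : ℝ) * ∑ r, neuronKernel z (gridPoint n i) (block r ξ) -
          ∫ v, neuronKernel z (gridPoint n i) v ∂neuronLaw|}) := by
    intro ξ hξ
    by_contra hcon
    simp only [mem_union, mem_iUnion, mem_ofPred_eq, not_or, not_exists, not_le, Finset.mem_univ,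
      Finite.mem_toFinset] at hcon
    obtain ⟨c1, c2⟩ := hcon
    refine hξ ?_
    have e : η = 11 * κ := by rw [hκ]; ring
    rw [e]
    refine kernelStable_of_empirical hn hδ0.le hδ2 hZsub hZnet (fun i => Or.inr ⟨i, rfl⟩)
      (fun z hz i => ?_) (Λ := Λ) ?_ hδΛ fun z hz => ?_
    · have := (c2 z hz).2 i trivial
      rw [integral_neuronKernel (hZsub hz) (gridPoint_mem hn i)] at this
      exact this.le
    · have := (abs_lt.1 c1).2
      linarith
    · have := (abs_lt.1 (c2 z hz).1).2
      linarith [hkink δ hδ1 z]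
  refine (measure_mono hsub).trans ((measure_union_le _ _).trans ?_)
  refine add_le_add le_rfl ((measure_biUnion_finset_le _ _).trans ?_)
  refine Finset.sum_le_sum fun z _ => (measure_union_le _ _).trans ?_
  exact add_le_add le_rfl (measure_biUnion_finset_le _ _)

/-! ### The limiting dynamics -/

/-- The generator of the limiting dynamics of the residuals. -/
def ntkGenerator (n : ℕ) : (Fin n → ℝ) →L[ℝ] (Fin n → ℝ) :=
  LinearMap.toContinuousLinearMap (Matrix.toLin'
    (Matrix.of fun i j : Fin n => -(1 / (n : ℝ)) * ntk (gridPoint n i) (gridPoint n j)))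

theorem ntkGenerator_apply (n : ℕ) (y : Fin n → ℝ) (i : Fin n) :
    ntkGenerator n y i =
      -(1 / (n : ℝ)) * ∑ j : Fin n, ntk (gridPoint n i) (gridPoint n j) * y j := by
  simp [ntkGenerator, Matrix.mulVec, dotProduct, Finset.mul_sum, mul_assoc]

/-- The limiting dynamics of the residuals. -/
def ntkFlow (n : ℕ) (t : ℝ) : (Fin n → ℝ) →L[ℝ] (Fin n → ℝ) :=
  NormedSpace.exp (t • ntkGenerator n)

theorem ntkFlow_zero (n : ℕ) (y : Fin n → ℝ) : ntkFlow n 0 y = y := by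
  simp [ntkFlow, NormedSpace.exp_zero]

theorem hasDerivAt_ntkFlow (n : ℕ) (y : Fin n → ℝ) (i : Fin n) (t : ℝ) :
    HasDerivAt (fun t => ntkFlow n t y i) (-(1 / (n : ℝ)) *
      ∑ j : Fin n, ntk (gridPoint n i) (gridPoint n j) * ntkFlow n t y j) t := by
  have h : HasDerivAt (fun t => ntkFlow n t) (ntkGenerator n * ntkFlow n t) t :=
    hasDerivAt_exp_smul_const' (𝕂 := ℝ) (ntkGenerator n) t
  have h1 := h.clm_apply (hasDerivAt_const t y)
  have h2 := hasDerivAt_pi.1 h1 i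
  simpa [ntkGenerator_apply] using h2

/-- Unperturbed, the full spectral gap 1/(26 n) is available, so the rate is 1/(13 n²). -/
theorem sum_sq_ntkFlow_le {n : ℕ} (hn : 2 ≤ n) (y : Fin n → ℝ) {t : ℝ} (ht : 0 ≤ t) :
    ∑ i, ntkFlow n t y i ^ 2 ≤ Real.exp (-(1 / (13 * (n : ℝ) ^ 2) * t)) * ∑ i, y i ^ 2 := by
  have hn0 : (0 : ℝ) < n := by positivity
  set c := 1 / (13 * (n : ℝ) ^ 2) with hc
  let V : ℝ → ℝ := fun t => ∑ i, ntkFlow n t y i ^ 2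
  have hV : ∀ t, HasDerivAt V (-(2 / (n : ℝ)) * ∑ i : Fin n, ∑ j : Fin n,
      ntkFlow n t y i * ntkFlow n t y j * ntk (gridPoint n i) (gridPoint n j)) t := fun t => by
    refine (HasDerivAt.fun_sum fun i (_ : i ∈ Finset.univ) =>
      (hasDerivAt_ntkFlow n y i t).pow 2).congr_deriv ?_
    rw [Finset.mul_sum]
    refine Finset.sum_congr rfl fun i _ => ?_
    simp only [Finset.mul_sum]
    refine Finset.sum_congr rfl fun j _ => ?_
    ring
  have hle : ∀ t, -(2 / (n : ℝ)) * ∑ i : Fin n, ∑ j : Fin n,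
      ntkFlow n t y i * ntkFlow n t y j * ntk (gridPoint n i) (gridPoint n j) ≤ -c * V t :=
    fun t => by
    have h := mul_le_mul_of_nonneg_left (le_quadraticForm_ntk hn (ntkFlow n t y))
      (by positivity : 0 ≤ 2 / (n : ℝ))
    have e : 2 / (n : ℝ) * (1 / (26 * n) * ∑ i, ntkFlow n t y i ^ 2) = c * V t := by
      rw [hc]; simp only [V]; field_simp; ring
    linarith
  have hexp : ∀ t, HasDerivAt (fun t => Real.exp (c * t)) (Real.exp (c * t) * c) t := fun t => by
    simpa using ((hasDerivAt_id t).const_mul c).exp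
  have hanti : Antitone fun t => V t * Real.exp (c * t) := by
    refine antitone_of_hasDerivAt_nonpos (fun t => (hV t).mul (hexp t)) fun t => ?_
    have := mul_le_mul_of_nonneg_right (hle t) (Real.exp_pos (c * t)).le
    have e : (-c * V t) * Real.exp (c * t) = -(V t * (Real.exp (c * t) * c)) := by ring
    rw [Pi.zero_apply]
    linarith
  have h := hanti ht
  simp only [mul_zero, Real.exp_zero, mul_one, V, ntkFlow_zero] at h
  rw [Real.exp_neg, inv_mul_eq_div, le_div_iff₀ (Real.exp_pos _)]
  exact h

/-- The limiting kernel interpolates arbitrary values on the grid. -/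
theorem exists_ntkSpan_eq {n : ℕ} (hn : 2 ≤ n) (f : Fin n → ℝ) :
    ∃ β : Fin n → ℝ, ∀ i : Fin n, ntkSpan β (gridPoint n i) = f i := by
  let L : (Fin n → ℝ) →ₗ[ℝ] (Fin n → ℝ) :=
    { toFun := fun β i => ntkSpan β (gridPoint n i)
      map_add' := fun a b => by
        ext i; simp [ntkSpan, add_mul, Finset.sum_add_distrib]
      map_smul' := fun c a => by
        ext i; simp [ntkSpan, Finset.mul_sum, mul_assoc] }
  have hinj : Function.Injective L := by
    rw [← LinearMap.ker_eq_bot, LinearMap.ker_eq_bot']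
    intro β hβ
    have h0 : ∀ i : Fin n, ∑ j : Fin n, β j * ntk (gridPoint n i) (gridPoint n j) = 0 :=
      fun i => congrFun hβ i
    have h := le_quadraticForm_ntk hn β
    have e : ∑ i : Fin n, ∑ j : Fin n, β i * β j * ntk (gridPoint n i) (gridPoint n j) = 0 := by
      refine Finset.sum_eq_zero fun i _ => ?_
      have := h0 i
      simp only [mul_assoc, ← Finset.mul_sum, this, mul_zero]
    rw [e] at h
    have hn0 : (0 : ℝ) < n := by positivity
    have hs : ∑ i, β i ^ 2 ≤ 0 := by
      by_contra hcon
      have : 0 < 1 / (26 * (n : ℝ)) * ∑ i, β i ^ 2 := mul_pos (by positivity) (not_le.1 hcon)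
      linarith
    have hs' := le_antisymm hs (Finset.sum_nonneg fun i _ => sq_nonneg _)
    ext i
    have := (Finset.sum_eq_zero_iff_of_nonneg fun i _ => sq_nonneg _).1 hs' i (Finset.mem_univ i)
    simpa using this
  obtain ⟨β, hβ⟩ := LinearMap.injective_iff_surjective.1 hinj f
  exact ⟨β, fun i => congrFun hβ i⟩

theorem ntkSpan_sub {n : ℕ} (α β : Fin n → ℝ) (x : ℝ) :
    ntkSpan (α - β) x = ntkSpan α x - ntkSpan β x := by
  simp [ntkSpan, sub_mul, Finset.sum_sub_distrib]

theorem continuous_ntkSpan {n : ℕ} (α : Fin n → ℝ) : Continuous (ntkSpan α) := by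
  unfold ntkSpan
  exact continuous_finsetSum _ fun j _ => continuous_const.mul (continuous_ntk_left _)

/-! ### Wide networks follow the limiting dynamics -/

/-- All gradient flows with responses of sum of squares at most `W`, started at `θ₀`, follow the
limiting dynamics up to `ρ`. -/
def FollowsLimit {m : ℕ} (n : ℕ) (W ρ : ℝ) (θ₀ : Params m) : Prop :=
  ∀ y : Fin n → ℝ, ∑ i, y i ^ 2 ≤ W → ∀ θ : ℝ → Params m, IsGradientFlow y θ₀ θ → ∀ t, 0 ≤ t →
    (∀ i : Fin n, |net (θ t) (gridPoint n i) - y i| ≤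
      √W * Real.exp (-(1 / (52 * (n : ℝ) ^ 2) * t))) ∧
    (∃ α : Fin n → ℝ, ∀ x ∈ Icc (0 : ℝ) 1, |net (θ t) x - ntkSpan α x| ≤ ρ) ∧
    ∀ i : Fin n, |net (θ t) (gridPoint n i) - (y i - ntkFlow n t y i)| ≤ ρ

theorem followsLimit_of_kernelStable {m n : ℕ} (hn : 2 ≤ n) {W ρ δ η : ℝ} (hW : 0 < W)
    (hρ : 0 < ρ) {ξ : Fin m × Fin 3 → ℝ} (hK : KernelStable n δ η (initParams ξ))
    (hη0 : 0 ≤ η) (hη : η ≤ 1 / (52 * (n : ℝ) ^ 2)) (hδ : δ ≤ 1 / 3)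
    (hη1 : η * √W * (52 * (n : ℝ) ^ 2) ≤ ρ) (hη2 : 4 * η * n * W * (52 * (n : ℝ) ^ 2) ≤ ρ ^ 2)
    (hm : √(2 / (2 * (m : ℝ))) * √(2 * W) * (52 * (n : ℝ) ^ 2) ≤ δ / 2) :
    FollowsLimit n W ρ (initParams ξ) := by
  intro y hy θ h t ht
  have hn0 : (0 : ℝ) < n := by positivity
  have hres : ∀ i : Fin n, residual y (initParams ξ) i = -y i := fun i => by
    rw [residual, net_initParams, zero_sub]
  have hW0 : sqLoss y (initParams ξ) ≤ W := by
    simpa only [sqLoss, hres, neg_sq] using hy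
  refine ⟨fun i => ?_, ?_, fun i => ?_⟩
  · have h1 := (h.sqLoss_le_exp hn hK hη hδ hW hW0 hm ht).2
    have h2 : residual y (θ t) i ^ 2 ≤ sqLoss y (θ t) :=
      Finset.single_le_sum (f := fun i => residual y (θ t) i ^ 2) (fun i _ => sq_nonneg _)
        (Finset.mem_univ i)
    refine abs_le_of_sq_le_sq (h2.trans (h1.trans (le_of_eq ?_))) (by positivity)
    rw [mul_pow, Real.sq_sqrt hW.le, ← Real.exp_nat_mul]
    congr 2
    push_cast
    field_simp
    ring
  · obtain ⟨α, hα⟩ := h.exists_ntkSpan hn hK hη hδ hη0 hW hW0 hm (net_initParams ξ) ht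
    exact ⟨α, fun x hx => (hα x hx).trans hη1⟩
  · have h1 := h.abs_residual_sub_le hn hK hη hδ hη0 hW hW0 hm
      (v := fun t => ntkFlow n t (-y)) (fun i => by rw [hres, ntkFlow_zero]; rfl)
      (fun i t => hasDerivAt_ntkFlow n (-y) i t) (fun t ht => ?_) ht i
    · refine abs_le_of_sq_le_sq (le_trans (le_of_eq ?_) (h1.trans hη2)) hρ.le
      congr 1
      rw [residual, map_neg, Pi.neg_apply]
      ring
    · refine (sum_sq_ntkFlow_le hn (-y) ht).trans ?_
      simp only [Pi.neg_apply, neg_sq]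
      refine (mul_le_of_le_one_left (Finset.sum_nonneg fun i _ => sq_nonneg _) ?_).trans hy
      rw [Real.exp_le_one_iff, Left.neg_nonpos_iff]
      positivity

/-- The tolerance η is fixed first from n, W and ρ, then the radius δ; only then is m taken large
enough both for stability to be likely and for the weights to stay within δ. -/
theorem exists_initLaw_not_followsLimit_le {n : ℕ} (hn : 2 ≤ n) {W ρ p : ℝ} (hW : 0 < W)
    (hρ : 0 < ρ) (hp : 0 < p) :
    ∃ M : ℕ, ∀ m, M ≤ m →
      initLaw m {ξ | ¬ FollowsLimit n W ρ (initParams ξ)} ≤ ENNReal.ofReal p := by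
  have hn0 : (0 : ℝ) < n := by positivity
  have hsW : 0 < √W := Real.sqrt_pos.2 hW
  set η := min (min (1 / (52 * (n : ℝ) ^ 2)) (ρ / (√W * (52 * (n : ℝ) ^ 2))))
    (ρ ^ 2 / (4 * n * W * (52 * (n : ℝ) ^ 2))) with hη
  have hη0 : 0 < η := by positivity
  have hη1 : η ≤ 1 / (52 * (n : ℝ) ^ 2) := (min_le_left _ _).trans (min_le_left _ _)
  have hη2 : η * √W * (52 * (n : ℝ) ^ 2) ≤ ρ := by
    have h : η ≤ ρ / (√W * (52 * (n : ℝ) ^ 2)) := (min_le_left _ _).trans (min_le_right _ _)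
    rw [le_div_iff₀ (by positivity)] at h
    linarith
  have hη3 : 4 * η * n * W * (52 * (n : ℝ) ^ 2) ≤ ρ ^ 2 := by
    have h : η ≤ ρ ^ 2 / (4 * n * W * (52 * (n : ℝ) ^ 2)) := min_le_right _ _
    rw [le_div_iff₀ (by positivity)] at h
    linarith
  obtain ⟨δ, hδ0, hδ, hlim⟩ := exists_tendsto_initLaw_not_kernelStable hn hη0
  have h1 : ∀ᶠ m : ℕ in atTop, initLaw m {ξ | ¬ KernelStable n δ η (initParams ξ)} ≤
      ENNReal.ofReal p :=
    (hlim.eventually_lt_const (ENNReal.ofReal_pos.2 hp)).mono fun _ h => h.le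
  have h2 : ∀ᶠ m : ℕ in atTop, √(2 / (2 * (m : ℝ))) * √(2 * W) * (52 * (n : ℝ) ^ 2) ≤ δ / 2 := by
    have hl : Tendsto (fun m : ℕ => √(2 / (2 * (m : ℝ))) * √(2 * W) * (52 * (n : ℝ) ^ 2)) atTop
        (𝓝 (√0 * √(2 * W) * (52 * (n : ℝ) ^ 2))) := by
      refine Tendsto.mul_const _ (Tendsto.mul_const _ ((Real.continuous_sqrt.tendsto 0).comp ?_))
      exact tendsto_const_nhds.div_atTop
        (tendsto_natCast_atTop_atTop.const_mul_atTop (by norm_num))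
    rw [Real.sqrt_zero, zero_mul, zero_mul] at hl
    exact (hl.eventually_lt_const (half_pos hδ0)).mono fun _ h => h.le
  obtain ⟨M, hM⟩ := eventually_atTop.1 (h1.and h2)
  refine ⟨M, fun m hm => (measure_mono (ofPred_subset_ofPred.2 fun ξ hξ hK => hξ ?_)).trans
    (hM m hm).1⟩
  exact followsLimit_of_kernelStable hn hW hρ hK hη0.le hη1 hδ hη2 hη3 (hM m hm).2

/-! ### The noise -/

/-- The law of the noise. -/
abbrev noiseLaw (σ : ℝ) (n : ℕ) : Measure (Fin n → ℝ) :=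
  Measure.pi fun _ => gaussianReal 0 (Real.toNNReal (σ ^ 2))

theorem gaussianReal_abs_gt_le {σ r : ℝ} (hr : 0 ≤ r) :
    gaussianReal 0 (Real.toNNReal (σ ^ 2)) {x | r < |x|} ≤
      ENNReal.ofReal (2 * Real.exp (-r ^ 2 / (2 * σ ^ 2))) := by
  have hv : ((Real.toNNReal (σ ^ 2) : ℝ≥0) : ℝ) = σ ^ 2 := Real.coe_toNNReal _ (sq_nonneg σ)
  have hsub : HasSubgaussianMGF id (Real.toNNReal (σ ^ 2))
      (gaussianReal 0 (Real.toNNReal (σ ^ 2))) :=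
    ⟨fun t => integrable_exp_mul_gaussianReal t, fun t => by rw [mgf_id_gaussianReal]; simp⟩
  have h1 := hsub.measure_ge_le hr
  have h2 := hsub.neg.measure_ge_le hr
  rw [hv] at h1 h2
  rw [two_mul, ENNReal.ofReal_add (Real.exp_pos _).le (Real.exp_pos _).le]
  refine (measure_mono (t := {x | r ≤ id x} ∪ {x | r ≤ (-id) x}) fun x hx => ?_).trans
    ((measure_union_le _ _).trans (add_le_add ?_ ?_))
  · rcases lt_abs.1 (show r < |x| from hx) with h | h
    · exact Or.inl h.le
    · exact Or.inr h.le
  · rw [ENNReal.le_ofReal_iff_toReal_le (measure_ne_top _ _) (Real.exp_pos _).le]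
    exact h1
  · rw [ENNReal.le_ofReal_iff_toReal_le (measure_ne_top _ _) (Real.exp_pos _).le]
    exact h2

/-- At the level 2σ√(log n) the Gaussian tail is 2/n² for each variable; a union bound follows. -/
theorem noiseLaw_exists_gt_le {σ : ℝ} (hσ : 0 < σ) {n : ℕ} (hn : 2 ≤ n) :
    noiseLaw σ n {ε | ¬ ∀ i, |ε i| ≤ 2 * σ * √(Real.log n)} ≤ ENNReal.ofReal (2 / n) := by
  have hn0 : (0 : ℝ) < n := by positivity
  have hlog : 0 ≤ Real.log n := Real.log_natCast_nonneg n
  have hi : ∀ i : Fin n, noiseLaw σ n {ε | 2 * σ * √(Real.log n) < |ε i|} ≤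
      ENNReal.ofReal (2 / (n : ℝ) ^ 2) := fun i => by
    have hp := measurePreserving_eval (fun _ : Fin n => gaussianReal 0 (Real.toNNReal (σ ^ 2))) i
    have hm : MeasurableSet {x : ℝ | 2 * σ * √(Real.log n) < |x|} :=
      measurableSet_lt measurable_const (by fun_prop)
    have h := hp.measure_preimage hm.nullMeasurableSet
    refine h.le.trans ((gaussianReal_abs_gt_le (by positivity)).trans (le_of_eq ?_))
    congr 1
    have e : -(2 * σ * √(Real.log n)) ^ 2 / (2 * σ ^ 2) = -(2 * Real.log n) := by
      rw [mul_pow, Real.sq_sqrt hlog]; field_simp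
    rw [e, Real.exp_neg, ← Nat.cast_two (R := ℝ), Real.exp_nat_mul, Real.exp_log hn0]
    rfl
  have hsub : {ε : Fin n → ℝ | ¬ ∀ i, |ε i| ≤ 2 * σ * √(Real.log n)} ⊆
      ⋃ i ∈ (Finset.univ : Finset (Fin n)), {ε | 2 * σ * √(Real.log n) < |ε i|} := by
    intro ε hε
    obtain ⟨i, hi⟩ := not_forall.1 hε
    exact mem_biUnion (Finset.mem_univ i) (not_le.1 hi)
  refine (measure_mono hsub).trans ((measure_biUnion_finset_le _ _).trans
    ((Finset.sum_le_sum fun i _ => hi i).trans (le_of_eq ?_)))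
  rw [Finset.sum_const, Finset.card_univ, Fintype.card_fin, nsmul_eq_mul,
    ← ENNReal.ofReal_natCast, ← ENNReal.ofReal_mul hn0.le]
  congr 1
  field_simp

open Classical in
/-- Whatever the shifts, most shifted noise variables are not small. -/
theorem noiseLaw_card_small_le {σ : ℝ} (hσ : 0 < σ) {n : ℕ} (hn : 2 ≤ n) (d : Fin n → ℝ) :
    noiseLaw σ n {ε | (n : ℝ) / 2 ≤ (Finset.univ.filter fun k => |d k + ε k| ≤ σ / 4).card} ≤
      ENNReal.ofReal (4 / n) := by
  have hn0 : (0 : ℝ) < n := by positivity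
  set ν := gaussianReal 0 (Real.toNNReal (σ ^ 2)) with hν
  let s : Fin n → Set ℝ := fun k => {x | |d k + x| ≤ σ / 4}
  have hs : ∀ k, MeasurableSet (s k) := fun k => measurableSet_le (by fun_prop) measurable_const
  let X : Fin n → ℝ → ℝ := fun k => (s k).indicator 1
  have hXm : ∀ k, Measurable (X k) := fun k => measurable_one.indicator (hs k)
  have hX01 : ∀ k x, X k x ∈ Icc (0 : ℝ) 1 := fun k x => by
    by_cases h : x ∈ s k <;> simp [X, h]
  have hX2 : ∀ k, MemLp (X k) 2 ν := fun k =>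
    MemLp.of_bound (hXm k).aestronglyMeasurable 1 (Filter.Eventually.of_forall fun x => by
      rw [Real.norm_of_nonneg (hX01 k x).1]; exact (hX01 k x).2)
  have hmean : ∀ k, ∫ x, X k x ∂ν ≤ 1 / 4 := fun k => by
    rw [integral_indicator_one (hs k)]
    have h := gaussianReal_abs_add_le (v := Real.toNNReal (σ ^ 2))
      (by simpa using hσ.ne') (d k) (ε := σ / 4)
    refine ENNReal.toReal_le_of_le_ofReal (by norm_num) (h.trans (le_of_eq ?_))
    rw [Real.coe_toNNReal _ (sq_nonneg σ), Real.sqrt_sq hσ.le]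
    congr 1
    field_simp
  have hvar : ∀ k, variance (X k) ν ≤ 1 / 4 := fun k => by
    have h := variance_le_sq_of_bounded (μ := ν) (X := X k)
      (Filter.Eventually.of_forall (hX01 k)) (hXm k).aemeasurable
    norm_num at h
    exact h
  have hc : ∀ k, MemLp (fun ε : Fin n → ℝ => X k (ε k)) 2 (noiseLaw σ n) := fun k =>
    (hX2 k).comp_measurePreserving (measurePreserving_eval _ k)
  have hS : MemLp (fun ε : Fin n → ℝ => ∑ k, X k (ε k)) 2 (noiseLaw σ n) :=
    memLp_finsetSum _ fun k _ => hc k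
  have hV : variance (fun ε : Fin n → ℝ => ∑ k, X k (ε k)) (noiseLaw σ n) ≤ n / 4 := by
    have h := variance_sum_pi (μ := fun _ : Fin n => ν) (X := X) hX2
    have e : (∑ k : Fin n, fun ε : Fin n → ℝ => X k (ε k)) = fun ε => ∑ k, X k (ε k) := by
      ext ε; simp
    rw [e] at h
    refine h.le.trans ((Finset.sum_le_sum fun k _ => hvar k).trans (le_of_eq ?_))
    simp
    ring
  have hE : ∫ ε, ∑ k, X k (ε k) ∂(noiseLaw σ n) ≤ n / 4 := by
    rw [integral_finsetSum _ fun k _ => (hc k).integrable one_le_two]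
    have : ∀ k : Fin n, ∫ ε : Fin n → ℝ, X k (ε k) ∂(noiseLaw σ n) = ∫ x, X k x ∂ν := fun k => by
      have hp := measurePreserving_eval (fun _ : Fin n => ν) k
      have h := integral_map (μ := noiseLaw σ n) hp.measurable.aemeasurable (f := X k)
        (hXm k).aestronglyMeasurable
      rw [hp.map_eq] at h
      exact h.symm
    simp only [this]
    refine (Finset.sum_le_sum fun k _ => hmean k).trans (le_of_eq ?_)
    simp
    ring
  -- Each shifted variable is small with probability at most 1/4 wherever the shift puts it. The
  -- expected count is at most n/4 and its variance at most n/4, so Chebyshev at deviation n/4 gives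
  -- 4/n.
  have h := meas_ge_le_variance_div_sq hS (c := n / 4) (by positivity)
  refine (measure_mono (ofPred_subset_ofPred.2 fun ε hε => ?_)).trans
    (h.trans (ENNReal.ofReal_le_ofReal ?_))
  · have e : ((Finset.univ.filter fun k => |d k + ε k| ≤ σ / 4).card : ℝ) = ∑ k, X k (ε k) := by
      rw [Finset.card_filter]
      push_cast
      refine Finset.sum_congr rfl fun k _ => ?_
      simp only [X, s, indicator_apply, mem_ofPred_eq, Pi.one_apply]
    rw [e] at hε
    exact le_trans (by linarith) (le_abs_self _)
  · refine (div_le_div_of_nonneg_right hV (sq_nonneg _)).trans (le_of_eq ?_)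
    field_simp

/-! ### Lower bounds for the excess risk -/

/-- On the grid cell that starts at `a` and has length `1 / N`, integration against this function
is dual to the value at `a` of an affine function. -/
def cellTest (a N x : ℝ) : ℝ := 4 - 6 * ((x - a) * N)

theorem continuous_cellTest (a N : ℝ) : Continuous (cellTest a N) := by
  unfold cellTest; fun_prop

theorem abs_cellTest_le {a N x : ℝ} (hN : 0 < N) (hx : x ∈ Icc a (a + 1 / N)) :
    |cellTest a N x| ≤ 4 := by
  have h0 : 0 ≤ (x - a) * N := mul_nonneg (by linarith [hx.1]) hN.le
  have h1 : (x - a) * N ≤ 1 := by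
    have : x - a ≤ 1 / N := by linarith [hx.2]
    rwa [le_div_iff₀ hN] at this
  rw [cellTest, abs_le]
  constructor <;> linarith

/-- The right endpoint value q drops out, so distinct cells see distinct, independent noise
variables. -/
theorem integral_cellTest_mul_affine {a N : ℝ} (hN : 0 < N) (p q : ℝ) :
    ∫ x in a..a + 1 / N, cellTest a N x * ((1 - (x - a) * N) * p + (x - a) * N * q) = p / N := by
  have hd : ∀ x ∈ uIcc a (a + 1 / N), HasDerivAt
      (fun x => 1 / N * (4 * p * ((x - a) * N) + (4 * (q - p) - 6 * p) / 2 * ((x - a) * N) ^ 2 -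
        2 * (q - p) * ((x - a) * N) ^ 3))
      (cellTest a N x * ((1 - (x - a) * N) * p + (x - a) * N * q)) x := by
    intro x _
    have h : HasDerivAt (fun x => (x - a) * N) N x := by
      simpa using ((hasDerivAt_id x).sub_const a).mul_const N
    refine ((((h.const_mul (4 * p)).add ((h.pow 2).const_mul ((4 * (q - p) - 6 * p) / 2))).sub
      ((h.pow 3).const_mul (2 * (q - p)))).const_mul (1 / N)).congr_deriv ?_
    rw [cellTest]
    field_simp
    push_cast
    ring
  rw [intervalIntegral.integral_eq_sub_of_hasDerivAt hd]
  · field_simp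
    ring
  · refine Continuous.intervalIntegrable ?_ _ _
    have := continuous_cellTest a N
    fun_prop

theorem integral_cellTest_sq {a N : ℝ} (hN : 0 < N) :
    ∫ x in a..a + 1 / N, cellTest a N x ^ 2 = 4 / N := by
  rw [← integral_cellTest_mul_affine hN 4 (-2)]
  refine intervalIntegral.integral_congr fun x _ => ?_
  simp only [cellTest]
  ring

/-- A perturbation of the sum of `D` and an affine function has a large square integral if the
moment of `D` does not nearly cancel the value of the affine function. -/
theorem le_integral_sq_cell {a N p q τ κ : ℝ} (hN : 0 < N) {F D : ℝ → ℝ}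
    (hF : ContinuousOn F (Icc a (a + 1 / N))) (hD : ContinuousOn D (Icc a (a + 1 / N)))
    (he : ∀ x ∈ Icc a (a + 1 / N),
      |F x - (D x + ((1 - (x - a) * N) * p + (x - a) * N * q))| ≤ τ) (hκ : 0 ≤ κ)
    (hb : κ + 4 * τ ≤ |N * (∫ x in a..a + 1 / N, cellTest a N x * D x) + p|) :
    κ ^ 2 / (4 * N) ≤ ∫ x in a..a + 1 / N, F x ^ 2 := by
  have hle : a ≤ a + 1 / N := by linarith [one_div_pos.2 hN]
  have hψ := (continuous_cellTest a N).continuousOn (s := Icc a (a + 1 / N))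
  have hii : ∀ {f : ℝ → ℝ}, ContinuousOn f (Icc a (a + 1 / N)) →
      IntervalIntegrable f volume a (a + 1 / N) := fun hf => hf.intervalIntegrable_of_Icc hle
  set l : ℝ → ℝ := fun x => (1 - (x - a) * N) * p + (x - a) * N * q with hl
  have hlc : ContinuousOn l (Icc a (a + 1 / N)) := by
    have : Continuous l := by rw [hl]; fun_prop
    exact this.continuousOn
  have iF : IntervalIntegrable (fun x => cellTest a N x * F x) volume a (a + 1 / N) :=
    hii (hψ.mul hF)
  have iD : IntervalIntegrable (fun x => cellTest a N x * D x) volume a (a + 1 / N) :=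
    hii (hψ.mul hD)
  have il : IntervalIntegrable (fun x => cellTest a N x * l x) volume a (a + 1 / N) :=
    hii (hψ.mul hlc)
  have iψ : IntervalIntegrable (fun x => cellTest a N x ^ 2) volume a (a + 1 / N) :=
    hii (hψ.pow 2)
  set I := ∫ x in a..a + 1 / N, cellTest a N x * F x with hI
  set J := ∫ x in a..a + 1 / N, cellTest a N x * D x with hJ
  have hIJ : |N * I - (N * J + p)| ≤ 4 * τ := by
    have e : I - (J + p / N) = ∫ x in a..a + 1 / N, cellTest a N x * (F x - (D x + l x)) := by
      rw [← integral_cellTest_mul_affine (a := a) hN p q, hI, hJ,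
        ← intervalIntegral.integral_add iD il, ← intervalIntegral.integral_sub iF (iD.add il)]
      refine intervalIntegral.integral_congr fun x _ => ?_
      simp only [hl]
      ring
    have h := intervalIntegral.norm_integral_le_of_norm_le_const (a := a) (b := a + 1 / N)
      (f := fun x => cellTest a N x * (F x - (D x + l x))) (C := 4 * τ) fun x hx => by
        rw [uIoc_of_le hle] at hx
        have hx' := Ioc_subset_Icc_self hx
        rw [Real.norm_eq_abs, abs_mul]
        exact mul_le_mul (abs_cellTest_le hN hx') (he x hx') (abs_nonneg _) (by norm_num)
    rw [← e, Real.norm_eq_abs, add_sub_cancel_left, abs_of_pos (one_div_pos.2 hN)] at h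
    have e2 : N * I - (N * J + p) = N * (I - (J + p / N)) := by field_simp
    rw [e2, abs_mul, abs_of_pos hN]
    calc N * |I - (J + p / N)| ≤ N * (4 * τ * (1 / N)) := by gcongr
      _ = 4 * τ := by field_simp
  have hκI : κ ≤ |N * I| := by
    have h := abs_sub_abs_le_abs_sub (N * J + p) (N * I)
    rw [abs_sub_comm] at h
    linarith
  have hκI2 : κ ^ 2 ≤ (N * I) ^ 2 := by
    rw [← sq_abs (N * I)]; gcongr
  -- Cauchy–Schwarz in the form F² ≥ 2cψF - c²ψ², with the optimal c = ∫ψF / ∫ψ² = N I / 4.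
  have hsq : ∫ x in a..a + 1 / N, (2 * (N * I / 4) * (cellTest a N x * F x) -
      (N * I / 4) ^ 2 * cellTest a N x ^ 2) ≤ ∫ x in a..a + 1 / N, F x ^ 2 := by
    refine intervalIntegral.integral_mono_on hle ((iF.const_mul _).sub (iψ.const_mul _))
      (hii (hF.pow 2)) fun x _ => ?_
    have := sq_nonneg (F x - N * I / 4 * cellTest a N x)
    linarith
  rw [intervalIntegral.integral_sub (iF.const_mul _) (iψ.const_mul _), intervalIntegral.integral_const_mul,
    intervalIntegral.integral_const_mul, integral_cellTest_sq hN, ← hI] at hsq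
  refine le_trans ?_ hsq
  have e : 2 * (N * I / 4) * I - (N * I / 4) ^ 2 * (4 / N) = (N * I) ^ 2 / (4 * N) := by
    field_simp; ring
  rw [e]
  gcongr

open Classical in
/-- If a function is, up to `σ / 64`, the sum of `D` and the linear interpolant of `ε`, and the
numbers `ε k`, shifted by the moments of `D`, are mostly not small, then its square integral is
bounded below. -/
theorem le_integral_sq_of_card_small_lt {n : ℕ} (hn : 5 ≤ n) {σ : ℝ} (hσ : 0 < σ) {F D : ℝ → ℝ}
    (hF : ContinuousOn F (Icc 0 1)) (hD : ContinuousOn D (Icc 0 1)) {ε : Fin n → ℝ}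
    (he : ∀ x ∈ Icc (0 : ℝ) 1, |F x - (D x + linearInterp ε x)| ≤ σ / 64)
    (hcard : ((Finset.univ.filter fun k : Fin n => |((n : ℝ) - 1) *
      (∫ x in gridPoint n k..gridPoint n k + 1 / ((n : ℝ) - 1),
        cellTest (gridPoint n k) ((n : ℝ) - 1) x * D x) + ε k| ≤ σ / 4).card : ℝ) < (n : ℝ) / 2) :
    σ ^ 2 / 512 ≤ ∫ x in (0 : ℝ)..1, F x ^ 2 := by
  have hN := cast_sub_one_pos (show 2 ≤ n by omega)
  set N := (n : ℝ) - 1 with hNdef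
  have hsucc : ∀ k, gridPoint n k + 1 / N = gridPoint n (k + 1) := fun k => by
    rw [hNdef, ← gridPoint_succ_sub (n := n) k]; ring
  have hsub : ∀ k, k + 1 < n → Icc (gridPoint n k) (gridPoint n k + 1 / N) ⊆ Icc 0 1 := by
    intro k hk
    rw [hsucc]
    have h0 := (gridPoint_mem (by omega) (⟨k, by omega⟩ : Fin n)).1
    have h1 := (gridPoint_mem (by omega) (⟨k + 1, hk⟩ : Fin n)).2
    exact Icc_subset_Icc h0 h1
  have hFii : ∀ k < n - 1, IntervalIntegrable (fun x => F x ^ 2) volume (gridPoint n k)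
      (gridPoint n (k + 1)) := fun k hk => by
    have h := (hF.mono (hsub k (by omega))).pow 2
    rw [hsucc] at h
    exact h.intervalIntegrable_of_Icc (gridPoint_mono (by omega) (by omega))
  have hsum := intervalIntegral.sum_integral_adjacent_intervals hFii
  rw [gridPoint_zero, gridPoint_last (by omega)] at hsum
  let bad : ℕ → Prop := fun k => ∃ h : k < n, |N * (∫ x in gridPoint n k..gridPoint n k + 1 / N,
    cellTest (gridPoint n k) N x * D x) + ε ⟨k, h⟩| ≤ σ / 4
  have hcell : ∀ k ∈ Finset.range (n - 1), (if bad k then 0 else σ ^ 2 / (128 * N)) ≤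
      ∫ x in gridPoint n k..gridPoint n (k + 1), F x ^ 2 := by
    intro k hk
    have hk1 : k + 1 < n := by have := Finset.mem_range.1 hk; omega
    split_ifs with hb
    · exact intervalIntegral.integral_nonneg (gridPoint_mono (by omega) (by omega))
        fun x _ => sq_nonneg _
    · have hb' := not_exists.1 hb (by omega : k < n)
      rw [← hsucc]
      -- The budget is 3σ/16 + 4 · σ/64 = σ/4, the threshold defining a small variable.
      have h := le_integral_sq_cell (κ := 3 * σ / 16) (τ := σ / 64) (p := ε ⟨k, by omega⟩)
        (q := ε ⟨k + 1, hk1⟩) hN (hF.mono (hsub k hk1)) (hD.mono (hsub k hk1))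
        (fun x hx => ?_) (by positivity) (by linarith [not_le.1 hb'])
      · refine le_trans ?_ h
        rw [div_le_div_iff₀ (by positivity) (by positivity)]
        nlinarith [sq_nonneg σ, mul_nonneg (sq_nonneg σ) hN.le]
      · have hx' := hx
        rw [hsucc] at hx'
        obtain ⟨l, hl, -, -, hle⟩ := linearInterp_eq_convex ε k hk1 x hx'
        have := he x (hsub k hk1 hx)
        rw [hle, hl] at this
        exact this
  have hle := Finset.sum_le_sum hcell
  rw [hsum] at hle
  refine le_trans ?_ hle
  have hbadcard : (((Finset.range (n - 1)).filter bad).card : ℝ) < (n : ℝ) / 2 := by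
    refine lt_of_le_of_lt ?_ hcard
    norm_cast
    refine Finset.card_le_card_of_injOn (fun k => if h : k < n then ⟨k, h⟩ else ⟨0, by omega⟩)
      (fun k hk => ?_) fun k hk k' hk' hkk => ?_
    · obtain ⟨-, h, hb⟩ := Finset.mem_filter.1 hk
      simp only [dif_pos h]
      exact Finset.mem_filter.2 ⟨Finset.mem_univ _, hb⟩
    · obtain ⟨-, h, -⟩ := Finset.mem_filter.1 hk
      obtain ⟨-, h', -⟩ := Finset.mem_filter.1 hk'
      simpa [h, h'] using hkk
  have hcount : ((Finset.range (n - 1)).filter bad).card +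
      ((Finset.range (n - 1)).filter fun k => ¬ bad k).card = n - 1 := by
    rw [Finset.card_filter_add_card_filter_not, Finset.card_range]
  have hcount' : (((Finset.range (n - 1)).filter bad).card : ℝ) +
      ((Finset.range (n - 1)).filter fun k => ¬ bad k).card = N := by
    have : ((n - 1 : ℕ) : ℝ) = N := by rw [Nat.cast_sub (by omega)]; simp [hNdef]
    exact Eq.trans (by exact_mod_cast hcount) this
  have hn5 : (5 : ℝ) ≤ n := by exact_mod_cast hn
  -- Fewer than n/2 of the n - 1 cells are bad, and n - 1 - n/2 ≥ (n - 1)/4 for n ≥ 5; the last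
  -- index starts no cell.
  have hgood : N / 4 ≤ ((Finset.range (n - 1)).filter fun k => ¬ bad k).card := by
    linarith
  rw [Finset.sum_ite, Finset.sum_const_zero, zero_add, Finset.sum_const, nsmul_eq_mul]
  calc σ ^ 2 / 512 = N / 4 * (σ ^ 2 / (128 * N)) := by field_simp; norm_num
    _ ≤ _ := by gcongr

/-! ### The trained network -/

theorem exp_neg_div_le {n : ℕ} (hn : 2 ≤ n) {k t : ℝ} (hk : 0 < k) {j : ℕ}
    (ht : k * j * (n : ℝ) ^ 2 * Real.log n ≤ t) :
    Real.exp (-(1 / (k * (n : ℝ) ^ 2) * t)) ≤ 1 / (n : ℝ) ^ j := by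
  have hn0 : (0 : ℝ) < n := by positivity
  have e : 1 / (n : ℝ) ^ j = Real.exp (-(j * Real.log n)) := by
    rw [Real.exp_neg, Real.exp_nat_mul, Real.exp_log hn0, one_div]
  rw [e]
  refine Real.exp_le_exp.2 (neg_le_neg ?_)
  rw [one_div_mul_eq_div, le_div_iff₀ (by positivity)]
  linarith

theorem sum_sq_le_of_abs_le {n : ℕ} {y : Fin n → ℝ} {Y : ℝ} (hy : ∀ i, |y i| ≤ Y) :
    ∑ i, y i ^ 2 ≤ n * Y ^ 2 := by
  refine (Finset.sum_le_sum fun i _ => show y i ^ 2 ≤ Y ^ 2 from ?_).trans (le_of_eq (by simp))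
  rw [← sq_abs (y i)]
  exact pow_le_pow_left₀ (abs_nonneg _) (hy i) 2

/-- A wide network which is trained for a long time is close to the linear interpolant. -/
theorem FollowsLimit.abs_net_sub_linearInterp_le {m n : ℕ} (hn : 2 ≤ n) {C Y ρ t : ℝ}
    {θ₀ : Params m} (hC : ∀ (α : Fin n → ℝ) (Y : ℝ), (∀ i : Fin n, |ntkSpan α (gridPoint n i)| ≤ Y) →
      ∀ x ∈ Icc (0 : ℝ) 1, |ntkSpan α x - linearInterp (fun i : Fin n => ntkSpan α (gridPoint n i)) x|
        ≤ C * Y / ((n : ℝ) - 1) ^ 2)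
    (h : FollowsLimit n (n * Y ^ 2) ρ θ₀) (hY : 0 ≤ Y) (hρ : ρ ≤ Y / (n : ℝ) ^ 2)
    (ht : 156 * (n : ℝ) ^ 2 * Real.log n < t) {y : Fin n → ℝ} (hy : ∀ i, |y i| ≤ Y)
    {θ : ℝ → Params m} (hθ : IsGradientFlow y θ₀ θ) {x : ℝ} (hx : x ∈ Icc (0 : ℝ) 1) :
    |net (θ t) x - linearInterp y x| ≤ (3 * C + 3) * Y / ((n : ℝ) - 1) ^ 2 := by
  have hn2 : (2 : ℝ) ≤ n := by exact_mod_cast hn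
  have hn0 : (0 : ℝ) < n := by linarith
  have hN := cast_sub_one_pos hn
  have hlog : 0 ≤ Real.log n := Real.log_natCast_nonneg n
  have ht0 : 0 ≤ t := le_trans (by positivity) ht.le
  obtain ⟨h1, ⟨α, h2⟩, -⟩ := h y (sum_sq_le_of_abs_le hy) θ hθ t ht0
  have hres : ∀ i : Fin n, |net (θ t) (gridPoint n i) - y i| ≤ Y / (n : ℝ) ^ 2 := fun i => by
    refine (h1 i).trans ?_
    have e1 : √(n * Y ^ 2) ≤ n * Y := by
      rw [Real.sqrt_le_iff]
      refine ⟨by positivity, ?_⟩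
      have : (n : ℝ) ≤ n ^ 2 := by nlinarith
      rw [mul_pow]
      gcongr
    -- 156 = 52 · 3 gives the decay n⁻³, which beats √(n Y²) ≤ nY and leaves Y/n².
    have e2 := exp_neg_div_le hn (k := 52) (by norm_num) (j := 3) (t := t) (by push_cast; linarith)
    calc √(n * Y ^ 2) * Real.exp (-(1 / (52 * (n : ℝ) ^ 2) * t))
        ≤ n * Y * (1 / (n : ℝ) ^ 3) :=
          mul_le_mul e1 e2 (Real.exp_pos _).le (by positivity)
      _ = Y / (n : ℝ) ^ 2 := by field_simp
  have hspan : ∀ i : Fin n, |ntkSpan α (gridPoint n i) - y i| ≤ 2 * (Y / (n : ℝ) ^ 2) := fun i => by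
    have e : ntkSpan α (gridPoint n i) - y i = -(net (θ t) (gridPoint n i) -
      ntkSpan α (gridPoint n i)) + (net (θ t) (gridPoint n i) - y i) := by ring
    rw [e]
    refine (abs_add_le _ _).trans ?_
    rw [abs_neg]
    linarith [hres i, h2 _ (gridPoint_mem hn i)]
  have hYn : Y / (n : ℝ) ^ 2 ≤ Y / ((n : ℝ) - 1) ^ 2 := by
    gcongr; linarith
  have hY3 : ∀ i : Fin n, |ntkSpan α (gridPoint n i)| ≤ 3 * Y := fun i => by
    have h3 := abs_sub_abs_le_abs_sub (ntkSpan α (gridPoint n i)) (y i)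
    have h4 : Y / (n : ℝ) ^ 2 ≤ Y := div_le_self hY (by nlinarith)
    linarith [hspan i, hy i]
  have h5 := hC α _ hY3 x hx
  have h6 : |linearInterp (fun i : Fin n => ntkSpan α (gridPoint n i)) x - linearInterp y x| ≤
      2 * (Y / (n : ℝ) ^ 2) := by
    rw [linearInterp_sub hn _ _ hx]
    exact abs_linearInterp_le hn hspan hx
  have e : net (θ t) x - linearInterp y x = (net (θ t) x - ntkSpan α x) +
      (ntkSpan α x - linearInterp (fun i : Fin n => ntkSpan α (gridPoint n i)) x) +
      (linearInterp (fun i : Fin n => ntkSpan α (gridPoint n i)) x - linearInterp y x) := by ring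
  rw [e]
  refine (abs_add_three _ _ _).trans ?_
  have e2 : (3 * C + 3) * Y / ((n : ℝ) - 1) ^ 2 =
      C * (3 * Y) / ((n : ℝ) - 1) ^ 2 + 3 * (Y / ((n : ℝ) - 1) ^ 2) := by ring
  rw [e2]
  linarith [h2 x hx]

/-- By this time the limiting dynamics has forgotten the noise: 156 = 13 · 12 gives the factor n⁻¹²
in the squared norm, far more than the noise bound requires. -/
theorem abs_ntkFlow_le {n : ℕ} (hn : 2 ≤ n) {σ t : ℝ} (hσ : 0 < σ)
    (ht : 156 * (n : ℝ) ^ 2 * Real.log n < t) {ε : Fin n → ℝ}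
    (hε : ∀ i, |ε i| ≤ 2 * σ * √(Real.log n)) (i : Fin n) :
    |ntkFlow n t ε i| ≤ 2 * σ / (n : ℝ) ^ 2 := by
  have hn2 : (2 : ℝ) ≤ n := by exact_mod_cast hn
  have hn0 : (0 : ℝ) < n := by linarith
  have hlog : 0 ≤ Real.log n := Real.log_natCast_nonneg n
  have ht0 : 0 ≤ t := le_trans (by positivity) ht.le
  have h1 : ntkFlow n t ε i ^ 2 ≤ ∑ i, ntkFlow n t ε i ^ 2 :=
    Finset.single_le_sum (f := fun i => ntkFlow n t ε i ^ 2) (fun i _ => sq_nonneg _)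
      (Finset.mem_univ i)
  have h2 := sum_sq_ntkFlow_le hn ε ht0
  have h3 := exp_neg_div_le hn (k := 13) (by norm_num) (j := 12) (t := t) (by push_cast; linarith)
  have h4 := sum_sq_le_of_abs_le hε
  refine abs_le_of_sq_le_sq (h1.trans (h2.trans ?_)) (by positivity)
  calc Real.exp (-(1 / (13 * (n : ℝ) ^ 2) * t)) * ∑ i, ε i ^ 2
      ≤ 1 / (n : ℝ) ^ 12 * (n * (2 * σ * √(Real.log n)) ^ 2) :=
        mul_le_mul h3 h4 (Finset.sum_nonneg fun i _ => sq_nonneg _) (by positivity)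
    _ = 1 / (n : ℝ) ^ 12 * (n * (4 * σ ^ 2 * Real.log n)) := by
        rw [mul_pow, Real.sq_sqrt hlog]; ring
    _ ≤ 1 / (n : ℝ) ^ 12 * (n * (4 * σ ^ 2 * n)) := by
        gcongr; exact Real.log_le_self hn0.le
    _ = (2 * σ / (n : ℝ) ^ 2) ^ 2 * (1 / (n : ℝ) ^ 6) := by field_simp; norm_num
    _ ≤ (2 * σ / (n : ℝ) ^ 2) ^ 2 * 1 := by
        gcongr
        rw [div_le_one (by positivity)]
        exact one_le_pow₀ (by linarith)
    _ = _ := mul_one _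

theorem sqrt_log_le_self {n : ℕ} (hn : 2 ≤ n) : √(Real.log n) ≤ n := by
  have hn2 : (2 : ℝ) ≤ n := by exact_mod_cast hn
  rw [Real.sqrt_le_iff]
  have := Real.log_le_self (by linarith : (0 : ℝ) ≤ n)
  exact ⟨by linarith, by nlinarith⟩

/-- The error of a wide network which is trained for a long time is close to the sum of a function
that does not depend on the noise and of the linear interpolant of the noise. -/
theorem FollowsLimit.abs_error_sub_le {m n : ℕ} (hn : 2 ≤ n) {C W σ ρ t : ℝ}
    {θ₀ : Params m} (hC : ∀ (α : Fin n → ℝ) (Y : ℝ), (∀ i : Fin n, |ntkSpan α (gridPoint n i)| ≤ Y) →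
      ∀ x ∈ Icc (0 : ℝ) 1, |ntkSpan α x - linearInterp (fun i : Fin n => ntkSpan α (gridPoint n i)) x|
        ≤ C * Y / ((n : ℝ) - 1) ^ 2) (hC0 : 0 < C) (hnC : 64 * (5 + 12 * C) ≤ n)
    (h : FollowsLimit n W ρ θ₀) (hσ : 0 < σ) (hρ : ρ ≤ σ / (n : ℝ) ^ 2)
    (ht : 156 * (n : ℝ) ^ 2 * Real.log n < t) {fstar : ℝ → ℝ} {ε : Fin n → ℝ}
    (hε : ∀ i, |ε i| ≤ 2 * σ * √(Real.log n)) (hW : ∑ i, response fstar ε i ^ 2 ≤ W)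
    {β : Fin n → ℝ} (hβ : ∀ i : Fin n, ntkSpan β (gridPoint n i) =
      fstar (gridPoint n i) - ntkFlow n t (fun i => fstar (gridPoint n i)) i)
    {θ : ℝ → Params m} (hθ : IsGradientFlow (response fstar ε) θ₀ θ) {x : ℝ}
    (hx : x ∈ Icc (0 : ℝ) 1) :
    |(net (θ t) x - fstar x) - ((ntkSpan β x - fstar x) + linearInterp ε x)| ≤ σ / 64 := by
  have hn2 : (2 : ℝ) ≤ n := by exact_mod_cast hn
  have hn0 : (0 : ℝ) < n := by linarith
  have hN := cast_sub_one_pos hn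
  have hlog : 0 ≤ Real.log n := Real.log_natCast_nonneg n
  have ht0 : 0 ≤ t := le_trans (by positivity) ht.le
  obtain ⟨-, ⟨α, h2⟩, h3⟩ := h _ hW θ hθ t ht0
  -- Subtracting the noise-free part leaves a span function with grid values close to ε. Its
  -- interpolation error depends on σ and not on the size of `fstar`, so the required size of n is
  -- absolute.
  set γ := α - β with hγ
  have hresp : response fstar ε = (fun i : Fin n => fstar (gridPoint n i)) + ε := rfl
  have hgrid : ∀ i : Fin n, |ntkSpan γ (gridPoint n i) - ε i| ≤ 4 * (σ / (n : ℝ) ^ 2) := by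
    intro i
    have e : ntkSpan γ (gridPoint n i) - ε i =
        -(net (θ t) (gridPoint n i) - ntkSpan α (gridPoint n i)) +
        (net (θ t) (gridPoint n i) - (response fstar ε i - ntkFlow n t (response fstar ε) i)) +
        -ntkFlow n t ε i := by
      rw [hγ, ntkSpan_sub, hβ, hresp, map_add]
      simp only [Pi.add_apply]
      ring
    rw [e]
    refine (abs_add_three _ _ _).trans ?_
    rw [abs_neg, abs_neg]
    have h5 := abs_ntkFlow_le hn hσ ht hε i
    rw [mul_div_assoc] at h5
    linarith [h2 _ (gridPoint_mem hn i), h3 i]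
  have hσn : σ / (n : ℝ) ^ 2 ≤ σ / n := by
    gcongr; nlinarith
  have hσn' : σ / (n : ℝ) ^ 2 ≤ σ / 4 := by
    gcongr; nlinarith
  have hsup : ∀ i : Fin n, |ntkSpan γ (gridPoint n i)| ≤ 3 * σ * n := fun i => by
    have h5 := abs_sub_abs_le_abs_sub (ntkSpan γ (gridPoint n i)) (ε i)
    have h6 : 2 * σ * √(Real.log n) ≤ 2 * σ * n := by
      gcongr; exact sqrt_log_le_self hn
    have h7 : σ * 1 ≤ σ * n := by gcongr; linarith
    linarith [hgrid i, hε i]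
  have h5 := hC γ _ hsup x hx
  have h6 : |linearInterp (fun i : Fin n => ntkSpan γ (gridPoint n i)) x - linearInterp ε x| ≤
      4 * (σ / (n : ℝ) ^ 2) := by
    rw [linearInterp_sub hn _ _ hx]
    exact abs_linearInterp_le hn hgrid hx
  have e : (net (θ t) x - fstar x) - ((ntkSpan β x - fstar x) + linearInterp ε x) =
      (net (θ t) x - ntkSpan α x) +
      (ntkSpan γ x - linearInterp (fun i : Fin n => ntkSpan γ (gridPoint n i)) x) +
      (linearInterp (fun i : Fin n => ntkSpan γ (gridPoint n i)) x - linearInterp ε x) := by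
    rw [hγ, ntkSpan_sub]; ring
  rw [e]
  refine (abs_add_three _ _ _).trans ?_
  have h7 : C * (3 * σ * n) / ((n : ℝ) - 1) ^ 2 ≤ 12 * C * (σ / n) := by
    have hh : (n : ℝ) / 2 ≤ (n : ℝ) - 1 := by linarith
    calc C * (3 * σ * n) / ((n : ℝ) - 1) ^ 2 ≤ C * (3 * σ * n) / ((n : ℝ) / 2) ^ 2 := by
          gcongr
      _ = 12 * C * (σ / n) := by field_simp; norm_num
  have h8 : (5 + 12 * C) * (σ / n) ≤ σ / 64 := by
    rw [mul_div_assoc', div_le_div_iff₀ hn0 (by norm_num)]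
    nlinarith
  linarith [h2 x hx]

theorem continuous_net {m : ℕ} (θ : Params m) : Continuous (net θ) := by
  unfold net preact; fun_prop

/-- The joint law is dominated on a union of an event about the noise and an event about the
initialization. -/
theorem jointLaw_le (σ : ℝ) (n m : ℕ) {E : (Fin n → ℝ) × (Fin m × Fin 3 → ℝ) → Prop}
    {A : Set (Fin n → ℝ)} {S : Set (Fin m × Fin 3 → ℝ)}
    (hE : ∀ ω, ω.1 ∉ A → ω.2 ∉ S → E ω) :
    jointLaw σ n m {ω | ¬ E ω} ≤ noiseLaw σ n A + initLaw m S := by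
  have hsub : {ω | ¬ E ω} ⊆ A ×ˢ univ ∪ univ ×ˢ S := by
    intro ω hω
    by_contra hcon
    rw [mem_union, not_or] at hcon
    exact hω (hE ω (fun h => hcon.1 ⟨h, mem_univ _⟩) fun h => hcon.2 ⟨mem_univ _, h⟩)
  refine (measure_mono hsub).trans ((measure_union_le _ _).trans (le_of_eq ?_))
  rw [jointLaw, Measure.prod_prod, Measure.prod_prod, measure_univ, measure_univ, mul_one, one_mul]

/-- For n ≤ C the claimed probability is not positive. Small n, to which the analytic estimates do
not apply, are thus absorbed into the constants. -/
theorem holdsWithProbAtLeast_of_le {σ : ℝ} {n m : ℕ} (hn : 2 ≤ n) {C : ℝ} (hC : n ≤ C)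
    (E : (Fin n → ℝ) × (Fin m × Fin 3 → ℝ) → Prop) :
    HoldsWithProbAtLeast (jointLaw σ n m) (1 - C / n) E := by
  have hn0 : (0 : ℝ) < n := by positivity
  have : IsProbabilityMeasure (jointLaw σ n m) := by unfold jointLaw; infer_instance
  rw [HoldsWithProbAtLeast, sub_sub_cancel]
  refine prob_le_one.trans ?_
  rw [← ENNReal.ofReal_one]
  refine ENNReal.ofReal_le_ofReal ?_
  rwa [one_le_div hn0]

end WideNet

end

/-! ### Proof of the theorem -/

open WideNet

theorem theorem4 :
    ∃ C₁ C₂ C₅ : ℝ, 0 < C₁ ∧ 0 < C₂ ∧ 0 < C₅ ∧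
      ∀ σ : ℝ, 0 < σ → ∃ C₄ : ℝ, 0 < C₄ ∧
        ∀ B : ℝ, ∃ C₃ : ℝ, 0 < C₃ ∧
          ∀ fstar : ℝ → ℝ, ContinuousOn fstar (Icc 0 1) → (∀ x ∈ Icc (0 : ℝ) 1, |fstar x| ≤ B) →
            ∀ n : ℕ, 2 ≤ n → ∃ M : ℕ, ∀ m : ℕ, M ≤ m →
              ∀ t : ℝ, C₁ * (n : ℝ) ^ 2 * Real.log n < t →
                WideNet.HoldsWithProbAtLeast (WideNet.jointLaw σ n m) (1 - C₂ / n)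
                  (fun ω => ∀ θ : ℝ → WideNet.Params m,
                    WideNet.IsGradientFlow (WideNet.response fstar ω.1)
                      (WideNet.initParams ω.2) θ →
                    ∀ x ∈ Icc (0 : ℝ) 1,
                      |WideNet.net (θ t) x
                          - WideNet.linearInterp (WideNet.response fstar ω.1) x|
                        ≤ C₃ * √(Real.log n) / ((n : ℝ) - 1) ^ 2) ∧
                WideNet.HoldsWithProbAtLeast (WideNet.jointLaw σ n m) (1 - C₅ / n)
                  (fun ω => ∀ θ : ℝ → WideNet.Params m,
                    WideNet.IsGradientFlow (WideNet.response fstar ω.1)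
                      (WideNet.initParams ω.2) θ →
                    C₄ ≤ WideNet.excessRisk fstar (WideNet.net (θ t))) := by
  classical
  obtain ⟨C, N, hC0, hN2, hC⟩ := exists_abs_ntkSpan_sub_linearInterp_le
  -- The summands 3 = 2 + 1 and 7 = 2 + 4 + 1 count failure probabilities in units of 1/n (noise
  -- maximum, small-noise count, initialization); the others make the claims vacuous for small n.
  refine ⟨156, N + 3, N + 64 * (5 + 12 * C) + 7, by norm_num, by positivity, by positivity,
    fun σ hσ => ⟨σ ^ 2 / 512, by positivity, fun B => ?_⟩⟩
  refine ⟨(3 * C + 3) * (2 * |B| + 2 * σ), by positivity, fun fstar hf hB n hn => ?_⟩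
  have hn2 : (2 : ℝ) ≤ n := by exact_mod_cast hn
  have hn0 : (0 : ℝ) < n := by linarith
  -- This lets |B| be absorbed into a multiple of √(log n), and gives σ ≤ Y, so the single tolerance
  -- σ/n² serves both claims.
  have hlog : 1 / 2 ≤ √(Real.log n) := by
    refine Real.le_sqrt_of_sq_le ?_
    have h1 := Real.log_le_log (by norm_num) hn2
    have h2 := Real.log_two_gt_d9
    norm_num at h2 ⊢
    linarith
  set Y := |B| + 2 * σ * √(Real.log n) with hY
  have hσY : σ ≤ Y := by
    have h1 : 2 * σ * (1 / 2) ≤ 2 * σ * √(Real.log n) := by gcongr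
    linarith [abs_nonneg B]
  have hY0 : 0 < Y := hσ.trans_le hσY
  obtain ⟨M, hM⟩ := exists_initLaw_not_followsLimit_le hn (W := n * Y ^ 2)
    (ρ := σ / (n : ℝ) ^ 2) (p := 1 / n) (by positivity) (by positivity) (by positivity)
  refine ⟨M, fun m hm t ht => ⟨?_, ?_⟩⟩
  · rcases lt_or_ge n N with hnN | hnN
    · have : (n : ℝ) ≤ N := by exact_mod_cast hnN.le
      exact holdsWithProbAtLeast_of_le hn (by linarith) _
    refine (jointLaw_le σ n m (A := {ε | ¬ ∀ i, |ε i| ≤ 2 * σ * √(Real.log n)})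
      (S := {ξ | ¬ FollowsLimit n (n * Y ^ 2) (σ / (n : ℝ) ^ 2) (initParams ξ)})
      fun ω h1 h2 θ hθ x hx => ?_).trans
      ((add_le_add (noiseLaw_exists_gt_le hσ hn) (hM m hm)).trans ?_)
    · have hε := not_not.1 h1
      have hy : ∀ i, |response fstar ω.1 i| ≤ Y := fun i =>
        (abs_add_le _ _).trans (add_le_add ((hB _ (gridPoint_mem hn i)).trans (le_abs_self B))
          (hε i))
      refine ((not_not.1 h2).abs_net_sub_linearInterp_le hn (fun α Y => hC n hnN α Y) hY0.le
        (by gcongr) ht hy hθ hx).trans ?_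
      rw [mul_assoc _ _ √(Real.log n)]
      have : Y ≤ (2 * |B| + 2 * σ) * √(Real.log n) := by
        have h3 : 2 * |B| * (1 / 2) ≤ 2 * |B| * √(Real.log n) := by gcongr
        rw [hY]
        linarith
      gcongr
    · rw [← ENNReal.ofReal_add (by positivity) (by positivity), sub_sub_cancel, ← add_div]
      refine ENNReal.ofReal_le_ofReal (div_le_div_of_nonneg_right ?_ hn0.le)
      linarith [Nat.cast_nonneg (α := ℝ) N]
  · rcases lt_or_ge (n : ℝ) (N + 64 * (5 + 12 * C)) with hnN | hnN
    · exact holdsWithProbAtLeast_of_le hn (by linarith) _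
    have hN0 : (0 : ℝ) ≤ N := Nat.cast_nonneg N
    have hnN' : N ≤ n := by
      have : (N : ℝ) ≤ n := by linarith
      exact_mod_cast this
    have hn5 : 5 ≤ n := by
      have : ((5 : ℕ) : ℝ) ≤ n := by push_cast; linarith
      exact_mod_cast this
    obtain ⟨β, hβ⟩ := exists_ntkSpan_eq hn (fun i : Fin n =>
      fstar (gridPoint n i) - ntkFlow n t (fun i => fstar (gridPoint n i)) i)
    -- The noise-free error at time t. It and the shifts d are fixed before the noise is drawn, as
    -- the count of small shifted variables requires.
    let D : ℝ → ℝ := fun x => ntkSpan β x - fstar x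
    let d : Fin n → ℝ := fun k => ((n : ℝ) - 1) *
      (∫ x in gridPoint n k..gridPoint n k + 1 / ((n : ℝ) - 1),
        cellTest (gridPoint n k) ((n : ℝ) - 1) x * D x)
    refine (jointLaw_le σ n m (A := {ε | ¬ ∀ i, |ε i| ≤ 2 * σ * √(Real.log n)} ∪
        {ε | (n : ℝ) / 2 ≤ (Finset.univ.filter fun k => |d k + ε k| ≤ σ / 4).card})
      (S := {ξ | ¬ FollowsLimit n (n * Y ^ 2) (σ / (n : ℝ) ^ 2) (initParams ξ)})
      fun ω h1 h2 θ hθ => ?_).trans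
      ((add_le_add ((measure_union_le _ _).trans (add_le_add (noiseLaw_exists_gt_le hσ hn)
        (noiseLaw_card_small_le hσ hn d))) (hM m hm)).trans ?_)
    · rw [mem_union, not_or] at h1
      have hε := not_not.1 h1.1
      have hcard : ((Finset.univ.filter fun k => |d k + ω.1 k| ≤ σ / 4).card : ℝ) < (n : ℝ) / 2 :=
        lt_of_not_ge h1.2
      have hy : ∀ i, |response fstar ω.1 i| ≤ Y := fun i =>
        (abs_add_le _ _).trans (add_le_add ((hB _ (gridPoint_mem hn i)).trans (le_abs_self B))
          (hε i))
      refine le_integral_sq_of_card_small_lt hn5 hσ (D := D) (ε := ω.1)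
        ((continuous_net _).continuousOn.sub hf) ((continuous_ntkSpan β).continuousOn.sub hf)
        (fun x hx => ?_) (by convert hcard)
      exact (not_not.1 h2).abs_error_sub_le hn (fun α Y => hC n hnN' α Y) hC0 (by linarith) hσ
        le_rfl ht hε (sum_sq_le_of_abs_le hy) hβ hθ hx
    · rw [← ENNReal.ofReal_add (by positivity) (by positivity),
        ← ENNReal.ofReal_add (by positivity) (by positivity), sub_sub_cancel, ← add_div, ← add_div]
      refine ENNReal.ofReal_le_ofReal (div_le_div_of_nonneg_right ?_ hn0.le)
      linarith
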